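/- Let $N\ge 2$ be an integer, $1<p<\infty$, and $p^*=\frac{Np}{N-p}$ if $p<N$, $p^*=+\infty$ if $p\ge N$. Let $V:\mathbb R^N\to\mathbb R$ be Lebesgue measurable with - $(V_1)$ $\operatorname{ess\,inf}_{\mathbb R^N}V>0$; - $(V_2)$ $\lim_{|x|\to\infty}\int_{B_1(x)}\frac{dy}{V(y)}=0$; - $(V_3)$ for every $\varrho>0$, $V$ is essentially bounded from above on $\{|x|\le\varrho\}$. Let $W^{1,p}_V(\mathbb R^N)=\{u\in W^{1,p}(\mathbb R^N):\int V|u|^p\,dx<\infty\}$ with $\|u\|_V=\big(\int|\nabla u|^p\,dx+\int V|u|^p\,dx\big)^{1/p}$, and $X=W^{1,p}_V(\mathbb R^N)\cap L^\infty(\mathbb R^N)$ with $\|u\|_X=\|u\|_V+|u|_\infty$. For $k\in\mathbb N=\{1,2,\dots\}$ let $B_k=\{|x|<k\}$ and let $X_{B_k}\subset X$ be the space of the extensions by zero of the functions $u\in W^{1,p}_0(B_k)\cap L^\infty(B_k)$ with $\int_{B_k} V|u|^p\,dx<\infty$. Let $A,g:\mathbb R^N\times\mathbb R\to\mathbb R$,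 where $A(\cdot,t)$ and $g(\cdot,t)$ are measurable for every $t$, and for a.e. $x$ the function $A(x,\cdot)$ is $C^1$ and $g(x,\cdot)$ is continuous. Put $A_t=\partial A/\partial t$ and $G(x,t)=\int_0^t g(x,s)\,ds$. Assume, for a.e. $x\in\mathbb R^N$ in each inequality: - $(h_1)$ $\sup_{|t|\le\rho}|A(\cdot,t)|$ and $\sup_{|t|\le\rho}|A_t(\cdot,t)|$ belong to $L^\infty(\mathbb R^N)$ for every $\rho>0$; - $(h_2)$ $A(x,t)\ge\alpha_0$ for all $t$, for some $\alpha_0>0$; - $(h_3)$ $(\mu-p)A(x,t)-A_t(x,t)t\ge\alpha_1A(x,t)$ for all $t$, for some $\mu>p$, $\alpha_1>0$; - $(h_4)$ $pA(x,t)+A_t(x,t)t\ge\alpha_2A(x,t)$ for all $t$, for some $\alpha_2>0$; - $(g_1)$ $|g(x,t)|\le a_1|t|^{p-1}+a_2|t|^{q-1}$ for all $t$, for some $a_1,a_2>0$ and $p\le q<p^*$; - $(g_2)$ $\lim_{t\to0}\frac{g(x,t)}{|t|^{p-2}t}=\bar\alpha<\frac{\alpha_0}{\tau_p^p}$ uniformly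 for a.e. $x$, where $\tau_p>0$ is a constant with $|u|_{L^p(\mathbb R^N)}\le\tau_p\|u\|_V$ for all $u\in W^{1,p}_V(\mathbb R^N)$; - $(g_3)$ $0<\mu G(x,t)\le g(x,t)t$ for all $t\ne0$, with $\mu$ as in $(h_3)$. For $u\in X$ let $$J(u)=\frac1p\int_{\mathbb R^N}A(x,u)|\nabla u|^p\,dx+\frac1p\int_{\mathbb R^N}V(x)|u|^p\,dx-\int_{\mathbb R^N}G(x,u)\,dx,$$ and for $u,v\in X$ let $$\langle dJ(u),v\rangle=\int_{\mathbb R^N}A(x,u)|\nabla u|^{p-2}\nabla u\cdot\nabla v\,dx+\frac1p\int_{\mathbb R^N}A_t(x,u)v|\nabla u|^p\,dx+\int_{\mathbb R^N}V(x)|u|^{p-2}uv\,dx-\int_{\mathbb R^N}g(x,u)v\,dx .$$ Let $(u_k)_{k\ge1}$ be functions and $\alpha^*,\alpha^{**}\in\mathbb R$ constants such that, for every $k$: $(i)$ $u_k\in X_{B_k}$; $(ii)$ $\alpha^*\le J(u_k)\le\alpha^{**}$; $(iii)$ $\langle dJ(u_k),v\rangle=0$ for all $v\in X_{B_k}$.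 Let $u_\infty\in W^{1,p}_V(\mathbb R^N)$ be such that, along a subsequence, $u_k\rightharpoonup u_\infty$ weakly in $W^{1,p}_V(\mathbb R^N)$, $u_k\to u_\infty$ strongly in $L^r(\mathbb R^N)$ for every $p\le r<p^*$, and $u_k\to u_\infty$ a.e. in $\mathbb R^N$. Then $u_\infty\in X$, the functional $J:X\to\mathbb R$ is Fréchet differentiable at $u_\infty$ with differential $v\mapsto\langle dJ(u_\infty),v\rangle$, and $$\langle dJ(u_\infty),\varphi\rangle=0\quad\text{for all }\varphi\in C_c^\infty(\mathbb R^N).$$ Moreover $\langle dJ(u_\infty),v\rangle=0$ for all $v\in X$, i.e. $dJ(u_\infty)=0$ in $X$. -/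

import Mathlib

open MeasureTheory Filter Topology
open scoped ContDiff ENNReal

noncomputable section

namespace QuasilinearSchrodinger

/-- The Euclidean space `ℝ^N`. -/
abbrev RN (N : ℕ) : Type := EuclideanSpace ℝ (Fin N)

/-- `φ ∈ C_c^∞(ℝ^N)`. -/
def IsTestFunction {N : ℕ} (φ : RN N → ℝ) : Prop :=
  ContDiff ℝ ∞ φ ∧ HasCompactSupport φ

/-- `G` is a weak (distributional) gradient of `u` on `ℝ^N`. -/
def IsWeakGradient {N : ℕ} (u : RN N → ℝ) (G : RN N → RN N) : Prop :=
  LocallyIntegrable u ∧ LocallyIntegrable G ∧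
    ∀ φ : RN N → ℝ, IsTestFunction φ →
      ∫ x, u x • gradient φ x = - ∫ x, φ x • G x

open Classical in
/-- The weak gradient `∇u` (unique up to null sets); it is `0` by convention when `u` has none. -/
def weakGrad {N : ℕ} (u : RN N → ℝ) : RN N → RN N :=
  if h : ∃ G, IsWeakGradient u G then h.choose else 0

/-- `u ∈ W^{1,p}(ℝ^N)`. -/
def MemW {N : ℕ} (p : ℝ) (u : RN N → ℝ) : Prop :=
  MemLp u (ENNReal.ofReal p) ∧ IsWeakGradient u (weakGrad u) ∧
    MemLp (weakGrad u) (ENNReal.ofReal p)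

/-- `u ∈ W_V^{1,p}(ℝ^N)`: `u ∈ W^{1,p}(ℝ^N)` and `∫ V |u|^p < ∞`. -/
def MemWV {N : ℕ} (p : ℝ) (V : RN N → ℝ) (u : RN N → ℝ) : Prop :=
  MemW p u ∧ Integrable (fun x => V x * |u x| ^ p)

/-- `u ∈ X = W_V^{1,p}(ℝ^N) ∩ L^∞(ℝ^N)`. -/
def MemX {N : ℕ} (p : ℝ) (V : RN N → ℝ) (u : RN N → ℝ) : Prop :=
  MemWV p V u ∧ MemLp u ∞

/-- `u` is the extension by zero to `ℝ^N` of an element of `W_0^{1,p}(Ω)`, the closure of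
`C_c^∞(Ω)` in the `W^{1,p}` norm. -/
def MemW0 {N : ℕ} (p : ℝ) (Ω : Set (RN N)) (u : RN N → ℝ) : Prop :=
  MemW p u ∧ (∀ᵐ x, x ∉ Ω → u x = 0) ∧
    ∀ ε : ℝ≥0∞, 0 < ε → ∃ φ : RN N → ℝ, IsTestFunction φ ∧ tsupport φ ⊆ Ω ∧
      eLpNorm (fun x => u x - φ x) (ENNReal.ofReal p) volume < ε ∧
      eLpNorm (fun x => weakGrad u x - gradient φ x) (ENNReal.ofReal p) volume < ε

/-- `u` is the extension by zero to `ℝ^N` of an element of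
`X_Ω = W_{0,V}^{1,p}(Ω) ∩ L^∞(Ω)`. -/
def MemXOn {N : ℕ} (p : ℝ) (V : RN N → ℝ) (Ω : Set (RN N)) (u : RN N → ℝ) : Prop :=
  MemW0 p Ω u ∧ MemX p V u

/-- `‖u‖_V = (∫ |∇u|^p + ∫ V |u|^p)^{1/p}`. -/
def normV {N : ℕ} (p : ℝ) (V : RN N → ℝ) (u : RN N → ℝ) : ℝ :=
  ((∫ x, ‖weakGrad u x‖ ^ p) + ∫ x, V x * |u x| ^ p) ^ (1 / p)

/-- `‖u‖_X = ‖u‖_V + |u|_∞`. -/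
def normX {N : ℕ} (p : ℝ) (V : RN N → ℝ) (u : RN N → ℝ) : ℝ :=
  normV p V u + (eLpNorm u ∞ volume).toReal

/-- `ℓ` restricts to a bounded linear functional on `W_V^{1,p}(ℝ^N)` (boundedness forces `ℓ` to
respect equality almost everywhere). The values of `ℓ` off `W_V^{1,p}(ℝ^N)` are irrelevant. -/
def IsDualWV {N : ℕ} (p : ℝ) (V : RN N → ℝ) (ℓ : (RN N → ℝ) → ℝ) : Prop :=
  (∀ u v, MemWV p V u → MemWV p V v → ℓ (u + v) = ℓ u + ℓ v) ∧
  (∀ (c : ℝ) (u), MemWV p V u → ℓ (c • u) = c * ℓ u) ∧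
  ∃ C : ℝ, ∀ u, MemWV p V u → |ℓ u| ≤ C * normV p V u

/-- `w_j ⇀ w` weakly in `W_V^{1,p}(ℝ^N)`. -/
def WeakTendstoWV {N : ℕ} (p : ℝ) (V : RN N → ℝ) (w : ℕ → RN N → ℝ) (w' : RN N → ℝ) : Prop :=
  ∀ ℓ : (RN N → ℝ) → ℝ, IsDualWV p V ℓ → Tendsto (fun j => ℓ (w j)) atTop (𝓝 (ℓ w'))

/-- The critical Sobolev exponent `p^*`. -/
def criticalExponent (N : ℕ) (p : ℝ) : EReal :=
  if p < N then ((N * p / (N - p) : ℝ) : EReal) else ⊤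

/-- `C^k`-Carathéodory functions: Lebesgue measurable in `x` for every `t`, and of class `C^k`
in `t` for almost every `x`. -/
def IsCaratheodory {N : ℕ} (k : ℕ) (h : RN N → ℝ → ℝ) : Prop :=
  (∀ t, AEMeasurable (fun x => h x t) volume) ∧ ∀ᵐ x, ContDiff ℝ k (h x)

/-- `A_t = ∂A/∂t`. -/
def partialT {N : ℕ} (A : RN N → ℝ → ℝ) (x : RN N) (t : ℝ) : ℝ := deriv (A x) t

/-- `G(x,t) = ∫_0^t g(x,s) ds`. -/
def primitiveT {N : ℕ} (g : RN N → ℝ → ℝ) (x : RN N) (t : ℝ) : ℝ := ∫ s in (0 : ℝ)..t, g x s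

/-- The functional `J`. -/
def J {N : ℕ} (p : ℝ) (A : RN N → ℝ → ℝ) (V : RN N → ℝ) (g : RN N → ℝ → ℝ)
    (u : RN N → ℝ) : ℝ :=
  (1 / p) * (∫ x, A x (u x) * ‖weakGrad u x‖ ^ p) + (1 / p) * (∫ x, V x * |u x| ^ p)
    - ∫ x, primitiveT g x (u x)

/-- The differential `⟨dJ(u), v⟩`. -/
def dJ {N : ℕ} (p : ℝ) (A : RN N → ℝ → ℝ) (V : RN N → ℝ) (g : RN N → ℝ → ℝ)
    (u v : RN N → ℝ) : ℝ :=
  (∫ x, A x (u x) * ‖weakGrad u x‖ ^ (p - 2) * inner ℝ (weakGrad u x) (weakGrad v x))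
    + (1 / p) * (∫ x, partialT A x (u x) * v x * ‖weakGrad u x‖ ^ p)
    + (∫ x, V x * |u x| ^ (p - 2) * u x * v x)
    - ∫ x, g x (u x) * v x

/-- `F : X → ℝ` is Fréchet differentiable at `u ∈ X` (for the norm `‖·‖_X`), with
differential `L`; the linearity and boundedness of `L` on `X` are part of the notion. -/
def HasFrechetDifferentialX {N : ℕ} (p : ℝ) (V : RN N → ℝ) (F : (RN N → ℝ) → ℝ)
    (u : RN N → ℝ) (L : (RN N → ℝ) → ℝ) : Prop :=
  (∀ v w, MemX p V v → MemX p V w → L (v + w) = L v + L w) ∧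
  (∀ (c : ℝ) (v), MemX p V v → L (c • v) = c * L v) ∧
  (∃ C : ℝ, ∀ v, MemX p V v → |L v| ≤ C * normX p V v) ∧
  ∀ ε : ℝ, 0 < ε → ∃ δ : ℝ, 0 < δ ∧ ∀ v, MemX p V v → normX p V v < δ →
    |F (u + v) - F u - L v| ≤ ε * normX p V v

end QuasilinearSchrodinger

end

open QuasilinearSchrodinger

namespace QuasilinearSchrodinger

variable {N : ℕ}

/-! ### Gradients of smooth functions -/

/-! The obstacle is the term `A_t(x,u) v |∇u|^p`. It makes sense only for bounded `v`, which is why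
one works in `X`, and it is not continuous under weak convergence of gradients. Two facts about the
`u_k` overcome this: a bound in `L^∞` uniform in `k`, and strong `L^p` convergence of the gradients
on bounded sets.

The `L^∞` bound is a Moser iteration. Testing the equation with a smooth version of `u|u|^s`,
hypothesis (h4) makes the two principal terms jointly coercive, the potential term is nonnegative,
and the growth of `g` bounds the rest (`energy_estimate`). Combined with the Sobolev inequality
`W^{1,1} → L^{N/(N-1)}` applied to a further power of `u`, this gives a reverse Hölder inequality
whose constant does not depend on the ball (`exists_reverse_holder`). The induced recursion on
exponents moves away from its fixed point `(q/p - 1)N`, and this point lies below `q` exactly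
because `q < p^*`. So the iteration can start from the `L^p` and `L^q` norms, which are bounded by
strong convergence (`exists_uniform_bound`). The case `s = 0` bounds the gradients.

For the gradients, one tests with `η ψ(u_k - u_∞)`, where `η` is a cutoff and `ψ(t) = t exp(λt²)`.
Since `ψ' - c|ψ| ≥ 1/2`, the term in `A_t |∇u_k|^p` is absorbed by the principal part. What remains
is the monotonicity integrand of the `p`-Laplacian plus terms tending to zero
(`tendsto_integral_cutoff`). The cutoff is needed because `u_∞` need not vanish outside any ball; a
compactly supported element of `X` is admissible on every large ball by mollification
(`MemW.memW0_ball`).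

The equation then passes to the limit for every compactly supported `v` in `X`, and dilated cutoffs
extend it to all of `X`. Fréchet differentiability at `u_∞` is independent of the sequence: each of
the three integrals in `J` is expanded to first order along an arbitrary null sequence of
increments, and `L^∞` control of the increments handles the dependence of `A` on `u`. -/

theorem norm_gradient_eq (φ : RN N → ℝ) (x : RN N) : ‖gradient φ x‖ = ‖fderiv ℝ φ x‖ := by
  rw [← toDual_gradient, LinearIsometryEquiv.norm_map]

theorem continuous_gradient {φ : RN N → ℝ} (h : ContDiff ℝ 1 φ) : Continuous (gradient φ) := by
  have : gradient φ = fun x => (InnerProductSpace.toDual ℝ (RN N)).symm (fderiv ℝ φ x) := rfl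
  rw [this]
  exact (LinearIsometryEquiv.continuous _).comp (h.continuous_fderiv (by norm_num))

theorem gradient_mul' {φ ψ : RN N → ℝ} {x : RN N} (h : DifferentiableAt ℝ φ x)
    (h' : DifferentiableAt ℝ ψ x) :
    gradient (fun y => φ y * ψ y) x = φ x • gradient ψ x + ψ x • gradient φ x := by
  refine HasGradientAt.gradient ?_
  rw [hasGradientAt_iff_hasFDerivAt, map_add, map_smul, map_smul, toDual_gradient, toDual_gradient]
  exact h.hasFDerivAt.mul h'.hasFDerivAt

theorem gradient_comp_real {F : ℝ → ℝ} {φ : RN N → ℝ} {x : RN N}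
    (hF : DifferentiableAt ℝ F (φ x)) (h : DifferentiableAt ℝ φ x) :
    gradient (fun y => F (φ y)) x = deriv F (φ x) • gradient φ x := by
  refine HasGradientAt.gradient ?_
  rw [hasGradientAt_iff_hasFDerivAt, map_smul, toDual_gradient]
  exact hF.hasDerivAt.comp_hasFDerivAt x h.hasFDerivAt

theorem gradient_eq_zero_of_notMem_tsupport {φ : RN N → ℝ} {x : RN N} (h : x ∉ tsupport φ) :
    gradient φ x = 0 := by
  have h1 : φ =ᶠ[𝓝 x] fun _ => (0 : ℝ) := notMem_tsupport_iff_eventuallyEq.mp h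
  rw [h1.gradient_eq, gradient_fun_const]

namespace IsTestFunction

variable {φ ψ : RN N → ℝ}

theorem continuous (h : IsTestFunction φ) : Continuous φ := h.1.continuous

theorem contDiff_one (h : IsTestFunction φ) : ContDiff ℝ 1 φ := h.1.of_le (by exact_mod_cast le_top)

theorem differentiableAt (h : IsTestFunction φ) (x : RN N) : DifferentiableAt ℝ φ x :=
  (h.contDiff_one.differentiable (by norm_num)) x

theorem continuous_gradient (h : IsTestFunction φ) : Continuous (gradient φ) :=
  QuasilinearSchrodinger.continuous_gradient h.contDiff_one

theorem hasCompactSupport_gradient (h : IsTestFunction φ) : HasCompactSupport (gradient φ) := by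
  refine HasCompactSupport.of_support_subset_isCompact h.2 fun x hx => ?_
  by_contra h'
  exact hx (gradient_eq_zero_of_notMem_tsupport h')

theorem mul (h : IsTestFunction φ) (h' : IsTestFunction ψ) :
    IsTestFunction (fun x => φ x * ψ x) :=
  ⟨h.1.mul h'.1, h.2.mul_right⟩

theorem memLp (h : IsTestFunction φ) (r : ℝ≥0∞) : MemLp φ r :=
  h.continuous.memLp_of_hasCompactSupport h.2

theorem memLp_gradient (h : IsTestFunction φ) (r : ℝ≥0∞) : MemLp (gradient φ) r :=
  h.continuous_gradient.memLp_of_hasCompactSupport h.hasCompactSupport_gradient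

theorem exists_bound (h : IsTestFunction φ) : ∃ C : ℝ, 0 ≤ C ∧ ∀ x, |φ x| ≤ C := by
  obtain ⟨C, hC⟩ := h.2.exists_bound_of_continuous h.continuous
  exact ⟨C, (norm_nonneg _).trans (hC 0), hC⟩

theorem exists_bound_gradient (h : IsTestFunction φ) :
    ∃ C : ℝ, 0 ≤ C ∧ ∀ x, ‖gradient φ x‖ ≤ C := by
  obtain ⟨C, hC⟩ := h.hasCompactSupport_gradient.exists_bound_of_continuous h.continuous_gradient
  exact ⟨C, (norm_nonneg _).trans (hC 0), hC⟩

/-- Pairing the vector identity with a fixed `v` reduces it to scalar integration by parts in the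
direction `v`. -/
theorem isWeakGradient (h : IsTestFunction φ) : IsWeakGradient φ (gradient φ) := by
  refine ⟨h.continuous.locallyIntegrable, h.continuous_gradient.locallyIntegrable, ?_⟩
  intro ψ hψ
  have i1 : Integrable (fun x => φ x • gradient ψ x) :=
    h.continuous.locallyIntegrable.integrable_smul_right_of_hasCompactSupport
      hψ.continuous_gradient hψ.hasCompactSupport_gradient
  have i2 : Integrable (fun x => ψ x • gradient φ x) :=
    hψ.continuous.locallyIntegrable.integrable_smul_right_of_hasCompactSupport
      h.continuous_gradient h.hasCompactSupport_gradient
  refine ext_inner_left ℝ fun v => ?_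
  rw [inner_neg_right, ← integral_inner i1, ← integral_inner i2]
  have e1 : ∀ x, inner ℝ v (φ x • gradient ψ x) = φ x * fderiv ℝ ψ x v := fun x => by
    rw [inner_smul_right, real_inner_comm, inner_gradient_left]
  have e2 : ∀ x, inner ℝ v (ψ x • gradient φ x) = fderiv ℝ φ x v * ψ x := fun x => by
    rw [inner_smul_right, real_inner_comm, inner_gradient_left, mul_comm]
  simp_rw [e1, e2]
  refine integral_mul_fderiv_eq_neg_fderiv_mul_of_integrable ?_ ?_ ?_
    (fun x _ => h.differentiableAt x) (fun x _ => hψ.differentiableAt x)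
  · simpa only [e2] using i2.const_inner (𝕜 := ℝ) v
  · simpa only [e1] using i1.const_inner (𝕜 := ℝ) v
  · exact (h.continuous.mul hψ.continuous).integrable_of_hasCompactSupport (h.mul hψ).2

end IsTestFunction

/-! ### Weak gradients -/

namespace IsWeakGradient

variable {u v : RN N → ℝ} {G H : RN N → RN N}

/-- The fundamental lemma of the calculus of variations. As `weakGrad` is an arbitrary choice, this
uniqueness is what makes every later formula for it valid almost everywhere. -/
theorem ae_eq (h : IsWeakGradient u G) (h' : IsWeakGradient u H) : G =ᵐ[volume] H := by
  refine ae_eq_of_integral_contDiff_smul_eq h.2.1 h'.2.1 fun g g1 g2 => ?_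
  have := (h.2.2 g ⟨g1, g2⟩).symm.trans (h'.2.2 g ⟨g1, g2⟩)
  exact neg_injective this

theorem weakGrad_spec (h : IsWeakGradient u G) : IsWeakGradient u (weakGrad u) := by
  have h' : ∃ G, IsWeakGradient u G := ⟨G, h⟩
  rw [weakGrad, dif_pos h']
  exact h'.choose_spec

theorem weakGrad_ae_eq (h : IsWeakGradient u G) : weakGrad u =ᵐ[volume] G :=
  h.weakGrad_spec.ae_eq h

theorem congr (h : IsWeakGradient u G) (huv : u =ᵐ[volume] v) (hGH : G =ᵐ[volume] H) :
    IsWeakGradient v H := by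
  refine ⟨h.1.congr huv, h.2.1.congr hGH, fun φ hφ => ?_⟩
  have e1 : ∫ x, v x • gradient φ x = ∫ x, u x • gradient φ x :=
    integral_congr_ae (by filter_upwards [huv] with x hx; rw [hx])
  have e2 : ∫ x, φ x • H x = ∫ x, φ x • G x :=
    integral_congr_ae (by filter_upwards [hGH] with x hx; rw [hx])
  rw [e1, e2, h.2.2 φ hφ]

theorem integrable_left (h : IsWeakGradient u G) {φ : RN N → ℝ} (hφ : IsTestFunction φ) :
    Integrable fun x => u x • gradient φ x :=
  h.1.integrable_smul_right_of_hasCompactSupport hφ.continuous_gradient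
    hφ.hasCompactSupport_gradient

theorem integrable_right (h : IsWeakGradient u G) {φ : RN N → ℝ} (hφ : IsTestFunction φ) :
    Integrable fun x => φ x • G x :=
  h.2.1.integrable_smul_left_of_hasCompactSupport hφ.continuous hφ.2

theorem add (h : IsWeakGradient u G) (h' : IsWeakGradient v H) :
    IsWeakGradient (u + v) (G + H) := by
  refine ⟨h.1.add h'.1, h.2.1.add h'.2.1, fun φ hφ => ?_⟩
  simp_rw [Pi.add_apply, add_smul, smul_add]
  rw [integral_add (h.integrable_left hφ) (h'.integrable_left hφ),
    integral_add (h.integrable_right hφ) (h'.integrable_right hφ), h.2.2 φ hφ, h'.2.2 φ hφ, neg_add]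

theorem const_smul (h : IsWeakGradient u G) (c : ℝ) : IsWeakGradient (c • u) (c • G) := by
  refine ⟨h.1.smul c, h.2.1.smul c, fun φ hφ => ?_⟩
  have e1 : ∀ x, (c • u) x • gradient φ x = c • (u x • gradient φ x) := fun x => by
    simp [mul_smul]
  have e2 : ∀ x, φ x • (c • G) x = c • (φ x • G x) := fun x => by
    simp [smul_comm c (φ x)]
  simp_rw [e1, e2]
  rw [integral_smul, integral_smul, h.2.2 φ hφ, smul_neg]

/-- If `φ` is a test function, so is `ηφ`. Testing the definition for `u` with `ηφ` and expanding
the product rule gives the identity for `ηu`. -/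
theorem mul_test (h : IsWeakGradient u G) {η : RN N → ℝ} (hη : IsTestFunction η) :
    IsWeakGradient (fun x => η x * u x) (fun x => η x • G x + u x • gradient η x) := by
  refine ⟨?_, ?_, fun φ hφ => ?_⟩
  · exact (h.1.integrable_smul_left_of_hasCompactSupport hη.continuous hη.2).locallyIntegrable
  · exact ((h.integrable_right hη).add (h.integrable_left hη)).locallyIntegrable
  · have key := h.2.2 _ (hη.mul hφ)
    have e0 : ∀ x, u x • gradient (fun y => η y * φ y) x
        = (η x * u x) • gradient φ x + φ x • (u x • gradient η x) := fun x => by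
      rw [gradient_mul' (hη.differentiableAt x) (hφ.differentiableAt x), smul_add, smul_smul,
        smul_smul, smul_smul, mul_comm (u x), mul_comm (u x)]
    have i1 : Integrable fun x => (η x * u x) • gradient φ x := by
      have : LocallyIntegrable (fun x => η x * u x) :=
        (h.1.integrable_smul_left_of_hasCompactSupport hη.continuous hη.2).locallyIntegrable
      exact this.integrable_smul_right_of_hasCompactSupport hφ.continuous_gradient
        hφ.hasCompactSupport_gradient
    have i2 : Integrable fun x => φ x • (u x • gradient η x) :=
      (h.integrable_left hη).locallyIntegrable.integrable_smul_left_of_hasCompactSupport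
        hφ.continuous hφ.2
    have i3 : Integrable fun x => φ x • (η x • G x) :=
      (h.integrable_right hη).locallyIntegrable.integrable_smul_left_of_hasCompactSupport
        hφ.continuous hφ.2
    simp_rw [e0] at key
    rw [integral_add i1 i2] at key
    simp_rw [smul_add]
    rw [integral_add i3 i2]
    have e3 : ∫ x, (η x * φ x) • G x = ∫ x, φ x • (η x • G x) := by
      refine integral_congr_ae (Eventually.of_forall fun x => ?_)
      simp only [smul_smul, mul_comm]
    rw [e3] at key
    rw [neg_add, ← key]
    abel

end IsWeakGradient

/-! ### The spaces `W^{1,p}`, `W_V^{1,p}` and `X` -/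

theorem memW_of_isWeakGradient {p : ℝ} {u : RN N → ℝ} {G : RN N → RN N}
    (hu : MemLp u (ENNReal.ofReal p)) (h : IsWeakGradient u G) (hG : MemLp G (ENNReal.ofReal p)) :
    MemW p u :=
  ⟨hu, h.weakGrad_spec, hG.ae_eq h.weakGrad_ae_eq.symm⟩

theorem IsTestFunction.memW {φ : RN N → ℝ} (h : IsTestFunction φ) (p : ℝ) : MemW p φ :=
  memW_of_isWeakGradient (h.memLp _) h.isWeakGradient (h.memLp_gradient _)

namespace MemW

variable {p : ℝ} {u v : RN N → ℝ}

theorem weakGrad_add (h : MemW p u) (h' : MemW p v) :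
    weakGrad (u + v) =ᵐ[volume] weakGrad u + weakGrad v := (h.2.1.add h'.2.1).weakGrad_ae_eq

theorem weakGrad_smul (h : MemW p u) (c : ℝ) :
    weakGrad (c • u) =ᵐ[volume] c • weakGrad u := (h.2.1.const_smul c).weakGrad_ae_eq

theorem add (h : MemW p u) (h' : MemW p v) : MemW p (u + v) :=
  memW_of_isWeakGradient (h.1.add h'.1) (h.2.1.add h'.2.1) (h.2.2.add h'.2.2)

theorem smul (h : MemW p u) (c : ℝ) : MemW p (c • u) :=
  memW_of_isWeakGradient (h.1.const_smul c) (h.2.1.const_smul c) (h.2.2.const_smul c)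

theorem weakGrad_sub (h : MemW p u) (h' : MemW p v) :
    weakGrad (u - v) =ᵐ[volume] weakGrad u - weakGrad v := by
  have h1 := h.weakGrad_add (h'.smul (-1))
  have h2 := h'.weakGrad_smul (-1)
  rw [neg_one_smul, ← sub_eq_add_neg] at h1
  filter_upwards [h1, h2] with x h1 h2
  rw [neg_one_smul] at h2
  rw [h1, Pi.add_apply, h2]; simp [sub_eq_add_neg]

theorem weakGrad_mul_test (h : MemW p u) {η : RN N → ℝ} (hη : IsTestFunction η) :
    weakGrad (fun x => η x * u x) =ᵐ[volume] fun x => η x • weakGrad u x + u x • gradient η x :=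
  (h.2.1.mul_test hη).weakGrad_ae_eq

theorem mul_test (h : MemW p u) {η : RN N → ℝ} (hη : IsTestFunction η) :
    MemW p (fun x => η x * u x) := by
  obtain ⟨C, hC0, hC⟩ := hη.exists_bound
  obtain ⟨D, hD0, hD⟩ := hη.exists_bound_gradient
  refine memW_of_isWeakGradient ?_ (h.2.1.mul_test hη) (MemLp.add ?_ ?_)
  · refine h.1.of_le_mul (c := C) (hη.continuous.aestronglyMeasurable.mul h.1.1)
      (Eventually.of_forall fun x => ?_)
    rw [norm_mul]
    exact mul_le_mul_of_nonneg_right (hC x) (norm_nonneg _)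
  · refine h.2.2.of_le_mul (c := C) (hη.continuous.aestronglyMeasurable.smul h.2.2.1)
      (Eventually.of_forall fun x => ?_)
    rw [norm_smul]
    exact mul_le_mul_of_nonneg_right (hC x) (norm_nonneg _)
  · refine h.1.of_le_mul (c := D) (h.1.1.smul hη.continuous_gradient.aestronglyMeasurable)
      (Eventually.of_forall fun x => ?_)
    rw [norm_smul, mul_comm]
    exact mul_le_mul_of_nonneg_right (hD x) (norm_nonneg _)

end MemW

/-- Multiplication by a bounded measurable function preserves integrability of `V |u|^p`; stated
in the form of a comparison `|v| ≤ C |u|`. -/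
theorem integrable_weight_rpow_of_le {p : ℝ} (hp : 0 < p) {V u v : RN N → ℝ}
    (hV : AEMeasurable V) (h : Integrable fun x => V x * |u x| ^ p) (hv : AEMeasurable v) {C : ℝ}
    (hC : 0 ≤ C) (hvu : ∀ᵐ x, |v x| ≤ C * |u x|) : Integrable fun x => V x * |v x| ^ p := by
  refine (h.const_mul (C ^ p)).mono (hV.mul (by fun_prop)).aestronglyMeasurable ?_
  filter_upwards [hvu] with x hx
  have e1 : ‖V x * |v x| ^ p‖ = |V x| * |v x| ^ p := by
    rw [Real.norm_eq_abs, abs_mul, abs_of_nonneg (Real.rpow_nonneg (abs_nonneg (v x)) p)]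
  have e2 : ‖C ^ p * (V x * |u x| ^ p)‖ = |V x| * (C * |u x|) ^ p := by
    rw [Real.norm_eq_abs, abs_mul, abs_mul, abs_of_nonneg (Real.rpow_nonneg (abs_nonneg (u x)) p),
      abs_of_nonneg (Real.rpow_nonneg hC p), Real.mul_rpow hC (abs_nonneg _), mul_left_comm]
  rw [e1, e2]
  refine mul_le_mul_of_nonneg_left ?_ (abs_nonneg _)
  exact Real.rpow_le_rpow (abs_nonneg _) hx hp.le

theorem add_rpow_le_two_rpow_mul {p a b : ℝ} (hp : 0 < p) (ha : 0 ≤ a) (hb : 0 ≤ b) :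
    (a + b) ^ p ≤ 2 ^ p * (a ^ p + b ^ p) := by
  have h1 : (a + b) ^ p ≤ (2 * max a b) ^ p :=
    Real.rpow_le_rpow (by positivity) (by linarith [le_max_left a b, le_max_right a b]) hp.le
  refine h1.trans ?_
  rw [Real.mul_rpow (by norm_num) (le_max_of_le_left ha)]
  refine mul_le_mul_of_nonneg_left ?_ (by positivity)
  rcases max_cases a b with ⟨h, -⟩ | ⟨h, -⟩ <;> rw [h]
  · linarith [Real.rpow_nonneg hb p]
  · linarith [Real.rpow_nonneg ha p]

namespace MemWV

variable {p : ℝ} {V u v : RN N → ℝ}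

theorem add (hp : 0 < p) (hV : AEMeasurable V) (h : MemWV p V u) (h' : MemWV p V v) :
    MemWV p V (u + v) := by
  refine ⟨h.1.add h'.1, ?_⟩
  have hu := h.1.1.1.aemeasurable
  have hv := h'.1.1.1.aemeasurable
  refine ((h.2.norm.add h'.2.norm).const_mul (2 ^ p)).mono
    (hV.mul (by fun_prop)).aestronglyMeasurable (Eventually.of_forall fun x => ?_)
  simp only [Pi.add_apply, norm_mul, Real.norm_eq_abs]
  rw [abs_of_nonneg (by positivity : (0 : ℝ) ≤ |u x + v x| ^ p),
    abs_of_nonneg (by positivity : (0 : ℝ) ≤ |u x| ^ p),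
    abs_of_nonneg (by positivity : (0 : ℝ) ≤ |v x| ^ p),
    abs_of_nonneg (by positivity : (0 : ℝ) ≤ 2 ^ p),
    abs_of_nonneg (by positivity : (0 : ℝ) ≤ |V x| * |u x| ^ p + |V x| * |v x| ^ p),
    ← mul_add, mul_left_comm]
  refine mul_le_mul_of_nonneg_left ?_ (abs_nonneg _)
  exact (Real.rpow_le_rpow (abs_nonneg _) (abs_add_le _ _) hp.le).trans
    (add_rpow_le_two_rpow_mul hp (abs_nonneg _) (abs_nonneg _))

theorem smul (hp : 0 < p) (hV : AEMeasurable V) (h : MemWV p V u) (c : ℝ) :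
    MemWV p V (c • u) := by
  have hu := h.1.1.1.aemeasurable
  refine ⟨h.1.smul c, integrable_weight_rpow_of_le hp hV h.2 (hu.const_smul c) (abs_nonneg c)
    (Eventually.of_forall fun x => ?_)⟩
  simp [abs_mul]

end MemWV

namespace MemX

variable {p : ℝ} {V u v : RN N → ℝ}

theorem add (hp : 0 < p) (hV : AEMeasurable V) (h : MemX p V u) (h' : MemX p V v) :
    MemX p V (u + v) := ⟨h.1.add hp hV h'.1, h.2.add h'.2⟩

theorem smul (hp : 0 < p) (hV : AEMeasurable V) (h : MemX p V u) (c : ℝ) :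
    MemX p V (c • u) := ⟨h.1.smul hp hV c, h.2.const_smul c⟩

theorem sub (hp : 0 < p) (hV : AEMeasurable V) (h : MemX p V u) (h' : MemX p V v) :
    MemX p V (u - v) := by
  have := h.add hp hV (h'.smul hp hV (-1)); rwa [neg_one_smul, ← sub_eq_add_neg] at this

theorem mul_test (hp : 0 < p) (hV : AEMeasurable V) (h : MemX p V u) {η : RN N → ℝ}
    (hη : IsTestFunction η) : MemX p V (fun x => η x * u x) := by
  obtain ⟨C, hC0, hC⟩ := hη.exists_bound
  have hu := h.1.1.1.1.aemeasurable
  refine ⟨⟨h.1.1.mul_test hη, integrable_weight_rpow_of_le hp hV h.1.2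
    (hη.continuous.aemeasurable.mul hu) hC0 (Eventually.of_forall fun x => ?_)⟩, ?_⟩
  · rw [abs_mul]
    exact mul_le_mul_of_nonneg_right (hC x) (abs_nonneg _)
  · refine h.2.of_le_mul (c := C) (hη.continuous.aestronglyMeasurable.mul h.2.1)
      (Eventually.of_forall fun x => ?_)
    rw [norm_mul]
    exact mul_le_mul_of_nonneg_right (hC x) (norm_nonneg _)

theorem ae_abs_le (h : MemX p V u) : ∀ᵐ x, |u x| ≤ (eLpNorm u ∞ volume).toReal := by
  have h1 : eLpNormEssSup u volume ≠ ⊤ := by simpa using h.2.2.ne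
  filter_upwards [ae_le_eLpNormEssSup (f := u) (μ := volume)] with x hx
  have h2 := ENNReal.toReal_mono h1 hx
  simpa using h2

theorem exists_bound (h : MemX p V u) : ∃ T : ℝ, 0 ≤ T ∧ ∀ᵐ x, |u x| ≤ T :=
  ⟨(eLpNorm u ∞ volume).toReal, ENNReal.toReal_nonneg, h.ae_abs_le⟩

end MemX

end QuasilinearSchrodinger

namespace QuasilinearSchrodinger

variable {N : ℕ}

/-! ### Mollification -/

section Mollification

variable {E : Type*} [NormedAddCommGroup E] [NormedSpace ℝ E]

open scoped Convolution

/-- A mollification is an average of translates, so its `L^p` norm does not exceed that of `f`: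
Jensen pointwise, then Tonelli and translation invariance. -/
theorem eLpNorm_normed_convolution_le_of_stronglyMeasurable {p : ℝ} (hp : 1 ≤ p)
    (φ : ContDiffBump (0 : RN N)) {f : RN N → E} (hf : StronglyMeasurable f) :
    eLpNorm (φ.normed volume ⋆[ContinuousLinearMap.lsmul ℝ ℝ, volume] f) (ENNReal.ofReal p) volume
      ≤ eLpNorm f (ENNReal.ofReal p) volume := by
  have hp0 : 0 < p := by linarith
  set ρ : RN N → ℝ≥0∞ := fun t => ENNReal.ofReal (φ.normed volume t) with hρ
  have hρm : Measurable ρ := (φ.continuous_normed.measurable).ennreal_ofReal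
  -- The mollifier as a probability measure: Jensen becomes the monotonicity of `L^p(ν)` norms in
  -- the exponent.
  set ν : Measure (RN N) := volume.withDensity ρ with hν
  have hν1 : IsProbabilityMeasure ν := by
    refine ⟨?_⟩
    rw [hν, withDensity_apply _ MeasurableSet.univ, Measure.restrict_univ,
      ← ofReal_integral_eq_lintegral_ofReal φ.integrable_normed
        (Eventually.of_forall φ.nonneg_normed), φ.integral_normed, ENNReal.ofReal_one]
  have hpt : ∀ x, ‖(φ.normed volume ⋆[ContinuousLinearMap.lsmul ℝ ℝ, volume] f) x‖ₑ ^ p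
      ≤ ∫⁻ t, ‖f (x - t)‖ₑ ^ p ∂ν := fun x => by
    have hm : StronglyMeasurable fun t => f (x - t) :=
      hf.comp_measurable (measurable_const.sub measurable_id)
    have h1 : ‖(φ.normed volume ⋆[ContinuousLinearMap.lsmul ℝ ℝ, volume] f) x‖ₑ
        ≤ ∫⁻ t, ‖f (x - t)‖ₑ ∂ν := by
      rw [convolution_def]
      refine (enorm_integral_le_lintegral_enorm _).trans ?_
      rw [hν, lintegral_withDensity_eq_lintegral_mul _ hρm hm.enorm]
      refine lintegral_mono fun t => ?_
      simp only [ContinuousLinearMap.lsmul_apply, enorm_smul, Pi.mul_apply, hρ]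
      rw [Real.enorm_eq_ofReal (φ.nonneg_normed t)]
    have h2 := eLpNorm_le_eLpNorm_of_exponent_le (μ := ν) (p := 1) (q := ENNReal.ofReal p)
      (by rw [← ENNReal.ofReal_one]; exact ENNReal.ofReal_le_ofReal hp) hm.aestronglyMeasurable
    rw [eLpNorm_one_eq_lintegral_enorm, eLpNorm_eq_lintegral_rpow_enorm_toReal
      (by simpa using hp0) ENNReal.ofReal_ne_top, ENNReal.toReal_ofReal hp0.le] at h2
    calc _ ≤ ((∫⁻ t, ‖f (x - t)‖ₑ ^ p ∂ν) ^ (1 / p)) ^ p :=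
          ENNReal.rpow_le_rpow (h1.trans h2) hp0.le
      _ = _ := by rw [← ENNReal.rpow_mul, one_div_mul_cancel hp0.ne', ENNReal.rpow_one]
  rw [eLpNorm_eq_lintegral_rpow_enorm_toReal (by simpa using hp0) ENNReal.ofReal_ne_top,
    eLpNorm_eq_lintegral_rpow_enorm_toReal (by simpa using hp0) ENNReal.ofReal_ne_top,
    ENNReal.toReal_ofReal hp0.le]
  refine ENNReal.rpow_le_rpow ?_ (by positivity)
  calc _ ≤ ∫⁻ x, ∫⁻ t, ‖f (x - t)‖ₑ ^ p ∂ν := lintegral_mono hpt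
    _ = ∫⁻ t, (∫⁻ x, ‖f (x - t)‖ₑ ^ p) ∂ν := by
        refine lintegral_lintegral_swap ?_
        have : StronglyMeasurable (fun z : RN N × RN N => f (z.1 - z.2)) :=
          hf.comp_measurable (measurable_fst.sub measurable_snd)
        exact (this.enorm.pow_const p).aemeasurable
    _ = ∫⁻ _t, (∫⁻ x, ‖f x‖ₑ ^ p) ∂ν := by
        refine lintegral_congr fun t => ?_
        exact lintegral_sub_right_eq_self (fun x => ‖f x‖ₑ ^ p) t
    _ = _ := by simp

theorem eLpNorm_normed_convolution_le {p : ℝ} (hp : 1 ≤ p)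
    (φ : ContDiffBump (0 : RN N)) {f : RN N → E} (hf : AEStronglyMeasurable f volume) :
    eLpNorm (φ.normed volume ⋆[ContinuousLinearMap.lsmul ℝ ℝ, volume] f) (ENNReal.ofReal p) volume
      ≤ eLpNorm f (ENNReal.ofReal p) volume := by
  obtain ⟨g, hg, hfg⟩ := hf
  rw [convolution_congr (L := ContinuousLinearMap.lsmul ℝ ℝ) (ae_eq_refl _) hfg,
    eLpNorm_congr_ae hfg]
  exact eLpNorm_normed_convolution_le_of_stronglyMeasurable hp φ hg

/-- Uniform continuity makes the difference uniformly small, and once the mollifier radius is below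
1 it lives in one compact neighbourhood `K` of the support. So its `L^p` norm is at most `δ` times a
power of the volume of `K`. -/
theorem tendsto_eLpNorm_convolution_sub_of_hasCompactSupport [CompleteSpace E] {p : ℝ}
    {φ : ℕ → ContDiffBump (0 : RN N)} (hφ : Tendsto (fun n => (φ n).rOut) atTop (𝓝 0))
    {g : RN N → E} (hg : Continuous g) (hgc : HasCompactSupport g) :
    Tendsto (fun n => eLpNorm
      ((φ n).normed volume ⋆[ContinuousLinearMap.lsmul ℝ ℝ, volume] g - g)
        (ENNReal.ofReal p) volume) atTop (𝓝 0) := by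
  set K := Metric.cthickening 1 (tsupport g) with hK
  have hKc : IsCompact K := hgc.isCompact.cthickening
  have hKfin : volume K ≠ ⊤ := hKc.measure_lt_top.ne
  set c : ℝ≥0∞ := volume K ^ (ENNReal.ofReal p).toReal⁻¹ with hc
  have hcfin : c ≠ ⊤ := ENNReal.rpow_ne_top_of_nonneg (by positivity) hKfin
  have hunif := hg.uniformContinuous_of_tendsto_cocompact hgc.is_zero_at_infty
  rw [ENNReal.tendsto_nhds_zero]
  intro ε hε
  obtain ⟨δ, hδ0, hδ⟩ : ∃ δ : ℝ, 0 < δ ∧ c * ENNReal.ofReal δ ≤ ε := by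
    have : Tendsto (fun δ : ℝ => c * ENNReal.ofReal δ) (𝓝[>] 0) (𝓝 (c * ENNReal.ofReal 0)) :=
      (ENNReal.Tendsto.const_mul (ENNReal.tendsto_ofReal tendsto_id) (Or.inr hcfin)).mono_left
        nhdsWithin_le_nhds
    rw [ENNReal.ofReal_zero, mul_zero] at this
    obtain ⟨δ, h1, h2⟩ := ((this.eventually (ge_mem_nhds hε)).and self_mem_nhdsWithin).exists
    exact ⟨δ, h2, h1⟩
  obtain ⟨r, hr0, hr⟩ := Metric.uniformContinuous_iff.mp hunif δ hδ0
  filter_upwards [hφ.eventually (gt_mem_nhds (lt_min hr0 one_pos))] with n hn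
  have hb : ∀ x, ‖((φ n).normed volume ⋆[ContinuousLinearMap.lsmul ℝ ℝ, volume] g - g) x‖ ≤ δ := by
    intro x
    rw [Pi.sub_apply, ← dist_eq_norm]
    refine ContDiffBump.dist_normed_convolution_le hg.aestronglyMeasurable fun y hy => ?_
    exact (hr ((Metric.mem_ball.mp hy).trans (hn.trans_le (min_le_left _ _)))).le
  have hsupp : ∀ x, x ∉ K →
      ((φ n).normed volume ⋆[ContinuousLinearMap.lsmul ℝ ℝ, volume] g - g) x = 0 := by
    intro x hx
    have hx1 : g x = 0 := by
      by_contra h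
      exact hx (Metric.self_subset_cthickening _ (subset_tsupport g h))
    rw [Pi.sub_apply, hx1, sub_zero, convolution_def]
    refine integral_eq_zero_of_ae (Eventually.of_forall fun t => ?_)
    by_cases ht : t ∈ Metric.ball (0 : RN N) (φ n).rOut
    · have : g (x - t) = 0 := by
        by_contra h
        refine hx (Metric.mem_cthickening_of_dist_le x (x - t) 1 _ (subset_tsupport g h) ?_)
        rw [dist_eq_norm, sub_sub_cancel]
        rw [mem_ball_zero_iff] at ht
        exact (ht.trans (hn.trans_le (min_le_right _ _))).le
      simp [this]
    · have : (φ n).normed volume t = 0 := by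
        rw [← Function.notMem_support, (φ n).support_normed_eq]; exact ht
      simp [this]
  rw [← eLpNorm_restrict_eq_of_support_subset (s := K)
    (fun x hx => by by_contra h; exact hx (hsupp x h))]
  refine (eLpNorm_le_of_ae_bound (Eventually.of_forall hb)).trans ?_
  rw [Measure.restrict_apply_univ]
  exact hδ

/-- Density of continuous compactly supported functions in `L^p` and an `ε/3` argument, where
mollification being a contraction controls the error `f - g`. -/
theorem tendsto_eLpNorm_convolution_sub [CompleteSpace E] {p : ℝ} (hp : 1 ≤ p)
    {φ : ℕ → ContDiffBump (0 : RN N)} (hφ : Tendsto (fun n => (φ n).rOut) atTop (𝓝 0))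
    {f : RN N → E} (hf : MemLp f (ENNReal.ofReal p)) :
    Tendsto (fun n => eLpNorm
      ((φ n).normed volume ⋆[ContinuousLinearMap.lsmul ℝ ℝ, volume] f - f)
        (ENNReal.ofReal p) volume) atTop (𝓝 0) := by
  have hp1 : (1 : ℝ≥0∞) ≤ ENNReal.ofReal p := by
    rw [← ENNReal.ofReal_one]; exact ENNReal.ofReal_le_ofReal hp
  rw [ENNReal.tendsto_nhds_zero]
  intro ε hε
  obtain ⟨g, hgc, hfg, hg, hgp⟩ := hf.exists_hasCompactSupport_eLpNorm_sub_le
    ENNReal.ofReal_ne_top (ε := ε / 3) (ENNReal.div_pos hε.ne' (by norm_num)).ne'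
  have hε3 : (0 : ℝ≥0∞) < ε / 3 := ENNReal.div_pos hε.ne' (by norm_num)
  filter_upwards [(tendsto_eLpNorm_convolution_sub_of_hasCompactSupport (p := p) hφ hg
    hgc).eventually (ge_mem_nhds hε3)] with n hn
  have hloc : LocallyIntegrable f volume := hf.locallyIntegrable hp1
  have hcs : HasCompactSupport ((φ n).normed volume) := (φ n).hasCompactSupport_normed
  have hcn : Continuous ((φ n).normed volume) := (φ n).continuous_normed
  have ex : ∀ h : RN N → E, LocallyIntegrable h volume →
      ConvolutionExists ((φ n).normed volume) h (ContinuousLinearMap.lsmul ℝ ℝ) volume := fun h hh =>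
    hcs.convolutionExists_left _ hcn hh
  have e : (φ n).normed volume ⋆[ContinuousLinearMap.lsmul ℝ ℝ, volume] f - f
      = ((φ n).normed volume ⋆[ContinuousLinearMap.lsmul ℝ ℝ, volume] (f - g)
        + ((φ n).normed volume ⋆[ContinuousLinearMap.lsmul ℝ ℝ, volume] g - g)) + (g - f) := by
    have : (φ n).normed volume ⋆[ContinuousLinearMap.lsmul ℝ ℝ, volume] f
        = (φ n).normed volume ⋆[ContinuousLinearMap.lsmul ℝ ℝ, volume] (f - g)
          + (φ n).normed volume ⋆[ContinuousLinearMap.lsmul ℝ ℝ, volume] g := by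
      rw [← (ex (f - g) (hloc.sub hg.locallyIntegrable)).distrib_add (ex g hg.locallyIntegrable),
        sub_add_cancel]
    rw [this]; abel
  have cont : ∀ h : RN N → E, LocallyIntegrable h volume → AEStronglyMeasurable
      ((φ n).normed volume ⋆[ContinuousLinearMap.lsmul ℝ ℝ, volume] h) volume := fun h hh =>
    (hcs.continuous_convolution_left _ hcn hh).aestronglyMeasurable
  rw [e]
  refine (eLpNorm_add_le ((cont _ (hloc.sub hg.locallyIntegrable)).add
    ((cont g hg.locallyIntegrable).sub hg.aestronglyMeasurable))
    (hg.aestronglyMeasurable.sub hf.1) hp1).trans ?_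
  refine (add_le_add_left (eLpNorm_add_le (cont _ (hloc.sub hg.locallyIntegrable))
    ((cont g hg.locallyIntegrable).sub hg.aestronglyMeasurable) hp1) _).trans ?_
  rw [eLpNorm_sub_comm g f]
  calc _ ≤ ε / 3 + ε / 3 + ε / 3 := by
        gcongr
        exact (eLpNorm_normed_convolution_le hp (φ n) (hf.1.sub hg.aestronglyMeasurable)).trans hfg
    _ = ε := ENNReal.add_thirds ε

theorem gradient_normed_convolution (φ : ContDiffBump (0 : RN N)) {u : RN N → ℝ}
    {G : RN N → RN N} (h : IsWeakGradient u G) (x : RN N) :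
    gradient (φ.normed volume ⋆[ContinuousLinearMap.lsmul ℝ ℝ, volume] u) x
      = (φ.normed volume ⋆[ContinuousLinearMap.lsmul ℝ ℝ, volume] G) x := by
  have hcs : HasCompactSupport (φ.normed volume) := φ.hasCompactSupport_normed
  have hcd : ContDiff ℝ ∞ (φ.normed volume) := φ.contDiff_normed
  have hd := hcs.hasFDerivAt_convolution_left (ContinuousLinearMap.lsmul ℝ ℝ)
    (hcd.of_le (by exact_mod_cast le_top)) h.1 x
  have hexd := (hcs.fderiv ℝ).convolutionExists_left
    (ContinuousLinearMap.precompL (RN N) (ContinuousLinearMap.lsmul ℝ ℝ : ℝ →L[ℝ] ℝ →L[ℝ] ℝ))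
    (hcd.continuous_fderiv (by simp)) h.1 x
  -- The reflected translate is the test function: the sign produced by the reflection cancels the
  -- sign in the definition of the weak gradient.
  set ψ : RN N → ℝ := fun t => φ.normed volume (x - t) with hψ
  have hψt : IsTestFunction ψ := by
    refine ⟨hcd.comp (contDiff_const.sub contDiff_id), ?_⟩
    exact hcs.comp_homeomorph (Homeomorph.subLeft x)
  have hgψ : ∀ t, gradient ψ t = - gradient (φ.normed volume) (x - t) := fun t => by
    refine HasGradientAt.gradient ?_
    rw [hasGradientAt_iff_hasFDerivAt, map_neg, toDual_gradient]
    have h1 : HasFDerivAt (fun t : RN N => x - t) (-ContinuousLinearMap.id ℝ (RN N)) t :=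
      (hasFDerivAt_id t).const_sub x
    have h2 := ((hcd.differentiable (by simp)) (x - t)).hasFDerivAt.comp t h1
    have e : (fderiv ℝ (φ.normed volume) (x - t)).comp (-ContinuousLinearMap.id ℝ (RN N))
        = -fderiv ℝ (φ.normed volume) (x - t) := by ext; simp
    rw [e] at h2
    exact h2
  have key := h.2.2 ψ hψt
  refine ext_inner_right ℝ fun v => ?_
  rw [inner_gradient_left, hd.fderiv, convolution_eq_swap, convolution_eq_swap]
  have i1 := h.integrable_left hψt
  have i2 := h.integrable_right hψt
  have hconv : Integrable (fun t => (ContinuousLinearMap.precompL (RN N)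
      (ContinuousLinearMap.lsmul ℝ ℝ : ℝ →L[ℝ] ℝ →L[ℝ] ℝ)) (fderiv ℝ (φ.normed volume) (x - t))
        (u t)) := hexd.integrable_swap
  rw [ContinuousLinearMap.integral_apply hconv]
  have e1 : ∀ t, (ContinuousLinearMap.precompL (RN N)
      (ContinuousLinearMap.lsmul ℝ ℝ : ℝ →L[ℝ] ℝ →L[ℝ] ℝ)) (fderiv ℝ (φ.normed volume) (x - t))
        (u t) v = - inner ℝ v (u t • gradient ψ t) := fun t => by
    rw [hgψ, smul_neg, inner_neg_right, neg_neg, inner_smul_right, real_inner_comm,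
      inner_gradient_left]
    simp [mul_comm]
  simp_rw [e1]
  rw [integral_neg, integral_inner i1, key, inner_neg_right, neg_neg, real_inner_comm]
  rfl

/-- A compactly supported `W^{1,p}` function belongs to `W_0^{1,p}` of every larger ball. -/
theorem MemW.memW0_ball {p : ℝ} (hp : 1 ≤ p) {u : RN N → ℝ} (hu : MemW p u) {R k : ℝ}
    (hRk : R < k) (hR : ∀ᵐ x, x ∉ Metric.closedBall (0 : RN N) R → u x = 0) :
    MemW0 p (Metric.ball 0 k) u := by
  refine ⟨hu, ?_, fun ε hε => ?_⟩
  · filter_upwards [hR] with x hx hxk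
    exact hx fun h => hxk (Metric.closedBall_subset_ball hRk h)
  -- `u` vanishes off the ball only almost everywhere; this representative vanishes there
  -- everywhere, so the support of the convolution can be located pointwise.
  set u' : RN N → ℝ := (Metric.closedBall (0 : RN N) R).indicator u with hu'
  have huu' : u =ᵐ[volume] u' := by
    filter_upwards [hR] with x hx
    by_cases h : x ∈ Metric.closedBall (0 : RN N) R
    · rw [hu', Set.indicator_of_mem h]
    · rw [hu', Set.indicator_of_notMem h, hx h]
  have hw : IsWeakGradient u' (weakGrad u) := hu.2.1.congr huu' (ae_eq_refl _)
  have hu'p : MemLp u' (ENNReal.ofReal p) := hu.1.ae_eq huu'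
  -- Radii at most `(k - R)/2` keep the mollified functions supported in the ball of radius `(R +
  -- k)/2 < k`.
  set r : ℕ → ℝ := fun n => (k - R) / 2 / (n + 1) with hr
  have hr0 : ∀ n, 0 < r n := fun n => by
    have : 0 < k - R := by linarith
    positivity
  set φ : ℕ → ContDiffBump (0 : RN N) := fun n =>
    ⟨r n / 2, r n, by have := hr0 n; positivity, by have := hr0 n; linarith⟩ with hφ
  have hφt : Tendsto (fun n => (φ n).rOut) atTop (𝓝 0) := by
    have := tendsto_one_div_add_atTop_nhds_zero_nat (𝕜 := ℝ)
    have := this.const_mul ((k - R) / 2)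
    simpa [hφ, hr, div_eq_mul_inv] using this
  have t1 := tendsto_eLpNorm_convolution_sub hp hφt hu'p
  have t2 := tendsto_eLpNorm_convolution_sub hp hφt hu.2.2
  obtain ⟨n, h1, h2⟩ := ((t1.eventually (gt_mem_nhds hε)).and
    (t2.eventually (gt_mem_nhds hε))).exists
  have hcs : HasCompactSupport ((φ n).normed volume) := (φ n).hasCompactSupport_normed
  have hsub : Function.support ((φ n).normed volume ⋆[ContinuousLinearMap.lsmul ℝ ℝ, volume] u')
      ⊆ Metric.closedBall 0 ((R + k) / 2) := by
    refine (support_convolution_subset _).trans ?_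
    rintro _ ⟨a, ha, b, hb, rfl⟩
    rw [(φ n).support_normed_eq, mem_ball_zero_iff] at ha
    have hb' : b ∈ Metric.closedBall (0 : RN N) R := by
      by_contra h
      exact hb (Set.indicator_of_notMem h _)
    rw [mem_closedBall_zero_iff] at hb' ⊢
    have : r n ≤ (k - R) / 2 := div_le_self (by linarith) (by
      have : (0 : ℝ) ≤ n := Nat.cast_nonneg n
      linarith)
    have ha' : ‖a‖ < r n := ha
    have := norm_add_le a b
    simp only
    linarith
  have hts : tsupport ((φ n).normed volume ⋆[ContinuousLinearMap.lsmul ℝ ℝ, volume] u')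
      ⊆ Metric.closedBall 0 ((R + k) / 2) :=
    closure_minimal hsub Metric.isClosed_closedBall
  refine ⟨(φ n).normed volume ⋆[ContinuousLinearMap.lsmul ℝ ℝ, volume] u', ⟨?_, ?_⟩, ?_, ?_, ?_⟩
  · exact hcs.contDiff_convolution_left _ (φ n).contDiff_normed hw.1
  · exact HasCompactSupport.of_support_subset_isCompact (isCompact_closedBall _ _) hsub
  · exact hts.trans (Metric.closedBall_subset_ball (by linarith))
  · rw [eLpNorm_sub_comm] at h1
    refine lt_of_le_of_lt (le_of_eq (eLpNorm_congr_ae ?_)) h1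
    filter_upwards [huu'] with x hx
    rw [Pi.sub_apply, hx]
  · rw [eLpNorm_sub_comm] at h2
    refine lt_of_le_of_lt (le_of_eq (eLpNorm_congr_ae (Eventually.of_forall fun x => ?_))) h2
    simp only [Pi.sub_apply]
    rw [gradient_normed_convolution (φ n) hw x]

end Mollification

end QuasilinearSchrodinger

namespace QuasilinearSchrodinger

variable {N : ℕ}

/-! ### The chain rule for weak gradients -/

theorem tendsto_eLpNorm_zero_of_dominated {α E E' : Type*} [MeasurableSpace α] {ν : Measure α}
    [NormedAddCommGroup E] [NormedAddCommGroup E'] {p : ℝ} (hp : 0 < p) {f : ℕ → α → E} {g : α → E'}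
    (hf : ∀ n, AEStronglyMeasurable (f n) ν) (hg : MemLp g (ENNReal.ofReal p) ν)
    (hfg : ∀ n, ∀ᵐ x ∂ν, ‖f n x‖ ≤ ‖g x‖)
    (h : ∀ᵐ x ∂ν, Tendsto (fun n => f n x) atTop (𝓝 0)) :
    Tendsto (fun n => eLpNorm (f n) (ENNReal.ofReal p) ν) atTop (𝓝 0) := by
  have hp0 : ENNReal.ofReal p ≠ 0 := by simpa using hp
  simp_rw [eLpNorm_eq_lintegral_rpow_enorm_toReal hp0 ENNReal.ofReal_ne_top,
    ENNReal.toReal_ofReal hp.le]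
  have h1 : Tendsto (fun n => ∫⁻ x, ‖f n x‖ₑ ^ p ∂ν) atTop (𝓝 (∫⁻ _x, 0 ∂ν)) := by
    refine tendsto_lintegral_of_dominated_convergence' (fun x => ‖g x‖ₑ ^ p)
      (fun n => (hf n).enorm.pow_const p) (fun n => ?_) ?_ ?_
    · filter_upwards [hfg n] with x hx
      exact ENNReal.rpow_le_rpow (enorm_le_iff_norm_le.mpr hx) hp.le
    · have := lintegral_rpow_enorm_lt_top_of_eLpNorm_lt_top hp0 ENNReal.ofReal_ne_top hg.2
      rw [ENNReal.toReal_ofReal hp.le] at this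
      exact this.ne
    · filter_upwards [h] with x hx
      have h2 : Tendsto (fun n => ‖f n x‖ₑ) atTop (𝓝 0) := by
        simpa [Function.comp_def] using (continuous_enorm.tendsto (0 : E)).comp hx
      have h3 := (ENNReal.continuous_rpow_const (y := p)).tendsto 0 |>.comp h2
      simpa [ENNReal.zero_rpow_of_pos hp, Function.comp_def] using h3
  rw [lintegral_zero] at h1
  have h3 := (ENNReal.continuous_rpow_const (y := 1 / p)).tendsto 0 |>.comp h1
  rwa [ENNReal.zero_rpow_of_pos (by positivity)] at h3

theorem tendsto_integral_smul_of_tendsto_eLpNorm {E : Type*} [NormedAddCommGroup E]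
    [NormedSpace ℝ E] {p : ℝ} (hp : 1 ≤ p) {f : ℕ → RN N → E} {g : RN N → E} {φ : RN N → ℝ}
    (hf : ∀ n, MemLp (f n) (ENNReal.ofReal p)) (hg : MemLp g (ENNReal.ofReal p))
    (hφ : Continuous φ) (hφc : HasCompactSupport φ)
    (h : Tendsto (fun n => eLpNorm (fun x => g x - f n x) (ENNReal.ofReal p) volume) atTop (𝓝 0)) :
    Tendsto (fun n => ∫ x, φ x • f n x) atTop (𝓝 (∫ x, φ x • g x)) := by
  have hp1 : (1 : ℝ≥0∞) ≤ ENNReal.ofReal p := by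
    rw [← ENNReal.ofReal_one]; exact ENNReal.ofReal_le_ofReal hp
  have hconj := (ENNReal.HolderConjugate.conjExponent hp1).symm
  have hφp : MemLp φ (ENNReal.ofReal p).conjExponent := hφ.memLp_of_hasCompactSupport hφc
  refine tendsto_integral_of_L1' (fun x => φ x • g x)
    (hφ.aestronglyMeasurable.smul hg.1) (Eventually.of_forall fun n => ?_) ?_
  · exact ((hf n).locallyIntegrable hp1).integrable_smul_left_of_hasCompactSupport hφ hφc
  · refine tendsto_of_tendsto_of_tendsto_of_le_of_le tendsto_const_nhds
      (h := fun n => eLpNorm φ (ENNReal.ofReal p).conjExponent volume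
        * eLpNorm (fun x => g x - f n x) (ENNReal.ofReal p) volume) ?_ (fun _ => zero_le) ?_
    · have := ENNReal.Tendsto.const_mul (a := eLpNorm φ (ENNReal.ofReal p).conjExponent volume) h
        (Or.inr hφp.2.ne)
      rwa [mul_zero] at this
    · intro n
      have : (fun x => φ x • f n x) - (fun x => φ x • g x) = φ • (f n - g) := by
        ext x; simp [smul_sub]
      simp only
      rw [this]
      refine (eLpNorm_smul_le_mul_eLpNorm (p := (ENNReal.ofReal p).conjExponent)
        (q := ENNReal.ofReal p) ((hf n).1.sub hg.1) hφ.aestronglyMeasurable).trans ?_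
      rw [eLpNorm_sub_comm]
      rfl

theorem tendsto_integral_smul_right_of_tendsto_eLpNorm {E : Type*} [NormedAddCommGroup E]
    [NormedSpace ℝ E] {p : ℝ} (hp : 1 ≤ p) {f : ℕ → RN N → ℝ} {g : RN N → ℝ} {φ : RN N → E}
    (hf : ∀ n, MemLp (f n) (ENNReal.ofReal p)) (hg : MemLp g (ENNReal.ofReal p))
    (hφ : Continuous φ) (hφc : HasCompactSupport φ)
    (h : Tendsto (fun n => eLpNorm (fun x => g x - f n x) (ENNReal.ofReal p) volume) atTop (𝓝 0)) :
    Tendsto (fun n => ∫ x, f n x • φ x) atTop (𝓝 (∫ x, g x • φ x)) := by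
  have hp1 : (1 : ℝ≥0∞) ≤ ENNReal.ofReal p := by
    rw [← ENNReal.ofReal_one]; exact ENNReal.ofReal_le_ofReal hp
  have hconj := (ENNReal.HolderConjugate.conjExponent hp1)
  have hφp : MemLp φ (ENNReal.ofReal p).conjExponent := hφ.memLp_of_hasCompactSupport hφc
  refine tendsto_integral_of_L1' (fun x => g x • φ x)
    (hg.1.smul hφ.aestronglyMeasurable) (Eventually.of_forall fun n => ?_) ?_
  · exact ((hf n).locallyIntegrable hp1).integrable_smul_right_of_hasCompactSupport hφ hφc
  · refine tendsto_of_tendsto_of_tendsto_of_le_of_le tendsto_const_nhds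
      (h := fun n => eLpNorm (fun x => g x - f n x) (ENNReal.ofReal p) volume
        * eLpNorm φ (ENNReal.ofReal p).conjExponent volume) ?_ (fun _ => zero_le) ?_
    · have := ENNReal.Tendsto.mul_const (b := eLpNorm φ (ENNReal.ofReal p).conjExponent volume) h
        (Or.inr hφp.2.ne)
      rwa [zero_mul] at this
    · intro n
      have : (fun x => f n x • φ x) - (fun x => g x • φ x) = (f n - g) • φ := by
        ext x; simp [sub_smul]
      simp only
      rw [this]
      refine (eLpNorm_smul_le_mul_eLpNorm (p := ENNReal.ofReal p)
        (q := (ENNReal.ofReal p).conjExponent) hφ.aestronglyMeasurable ((hf n).1.sub hg.1)).trans ?_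
      rw [eLpNorm_sub_comm]
      rfl

/-- Weak gradients are closed under convergence in `L^p`. -/
theorem isWeakGradient_of_tendsto {p : ℝ} (hp : 1 ≤ p) {w : ℕ → RN N → ℝ} {G : ℕ → RN N → RN N}
    {w' : RN N → ℝ} {G' : RN N → RN N} (hw : ∀ n, IsWeakGradient (w n) (G n))
    (hwp : ∀ n, MemLp (w n) (ENNReal.ofReal p)) (hGp : ∀ n, MemLp (G n) (ENNReal.ofReal p))
    (hw' : MemLp w' (ENNReal.ofReal p)) (hG' : MemLp G' (ENNReal.ofReal p))
    (h1 : Tendsto (fun n => eLpNorm (fun x => w' x - w n x) (ENNReal.ofReal p) volume)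
      atTop (𝓝 0))
    (h2 : Tendsto (fun n => eLpNorm (fun x => G' x - G n x) (ENNReal.ofReal p) volume)
      atTop (𝓝 0)) : IsWeakGradient w' G' := by
  have hp1 : (1 : ℝ≥0∞) ≤ ENNReal.ofReal p := by
    rw [← ENNReal.ofReal_one]; exact ENNReal.ofReal_le_ofReal hp
  refine ⟨hw'.locallyIntegrable hp1, hG'.locallyIntegrable hp1, fun φ hφ => ?_⟩
  have t1 := tendsto_integral_smul_right_of_tendsto_eLpNorm hp hwp hw' hφ.continuous_gradient
    hφ.hasCompactSupport_gradient h1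
  have t2 := tendsto_integral_smul_of_tendsto_eLpNorm hp hGp hG' hφ.continuous hφ.2 h2
  refine tendsto_nhds_unique t1 ?_
  refine t2.neg.congr fun n => ?_
  rw [(hw n).2.2 φ hφ]

/-- A compactly supported smooth function agreeing with `F` to first order on `[-T, T]`. -/
theorem exists_compactSupport_eqOn {F : ℝ → ℝ} (hF : ContDiff ℝ ∞ F) (hF0 : F 0 = 0) (T : ℝ) :
    ∃ F' : ℝ → ℝ, ContDiff ℝ ∞ F' ∧ HasCompactSupport F' ∧ F' 0 = 0 ∧
      ∀ t, |t| ≤ T → F' t = F t ∧ deriv F' t = deriv F t := by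
  let b : ContDiffBump (0 : ℝ) := ⟨|T| + 1, |T| + 2, by positivity, by linarith⟩
  refine ⟨fun t => F t * b t, hF.mul b.contDiff, b.hasCompactSupport.mul_left, by simp [hF0], ?_⟩
  intro t ht
  have hb : (fun t => F t * b t) =ᶠ[𝓝 t] F := by
    have ht' : t ∈ Metric.ball (0 : ℝ) (|T| + 1) := by
      rw [mem_ball_zero_iff, Real.norm_eq_abs]
      have := le_abs_self T
      linarith
    filter_upwards [Metric.isOpen_ball.mem_nhds ht'] with s hs
    rw [b.one_of_mem_closedBall (Metric.ball_subset_closedBall hs), mul_one]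
  exact ⟨hb.eq_of_nhds, hb.deriv_eq⟩

theorem exists_isTestFunction_cutoff (R : ℝ) : ∃ η : RN N → ℝ, IsTestFunction η ∧
    (∀ x, 0 ≤ η x ∧ η x ≤ 1) ∧
    (∀ x ∈ Metric.closedBall (0 : RN N) R, η x = 1 ∧ gradient η x = 0) ∧
    ∀ x, x ∉ Metric.closedBall (0 : RN N) (|R| + 2) → η x = 0 ∧ gradient η x = 0 := by
  let b : ContDiffBump (0 : RN N) := ⟨|R| + 1, |R| + 2, by positivity, by linarith⟩
  refine ⟨b, ⟨b.contDiff, b.hasCompactSupport⟩, fun x => ⟨b.nonneg, b.le_one⟩, fun x hx => ?_,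
    fun x hx => ?_⟩
  · have hb : (b : RN N → ℝ) =ᶠ[𝓝 x] fun _ => (1 : ℝ) := by
      have hx' : x ∈ Metric.ball (0 : RN N) (|R| + 1) := by
        rw [mem_ball_zero_iff]
        rw [mem_closedBall_zero_iff] at hx
        have := le_abs_self R
        linarith
      filter_upwards [Metric.isOpen_ball.mem_nhds hx'] with s hs
      exact b.one_of_mem_closedBall (Metric.ball_subset_closedBall hs)
    exact ⟨hb.eq_of_nhds, by rw [hb.gradient_eq, gradient_fun_const]⟩
  · have hx' : x ∉ tsupport b := by rw [b.tsupport_eq]; exact hx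
    exact ⟨image_eq_zero_of_notMem_tsupport hx', gradient_eq_zero_of_notMem_tsupport hx'⟩

/-- Approximation by test functions along which also almost everywhere convergence holds. -/
theorem MemW0.exists_seq {p : ℝ} (hp : 0 < p) {Ω : Set (RN N)} {u : RN N → ℝ}
    (hu : MemW0 p Ω u) : ∃ φ : ℕ → RN N → ℝ, (∀ n, IsTestFunction (φ n)) ∧
      (∀ n, tsupport (φ n) ⊆ Ω) ∧
      Tendsto (fun n => eLpNorm (fun x => u x - φ n x) (ENNReal.ofReal p) volume) atTop (𝓝 0) ∧
      Tendsto (fun n => eLpNorm (fun x => weakGrad u x - gradient (φ n) x) (ENNReal.ofReal p)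
        volume) atTop (𝓝 0) ∧
      ∀ᵐ x, Tendsto (fun n => φ n x) atTop (𝓝 (u x)) := by
  have hε : ∀ n : ℕ, (0 : ℝ≥0∞) < ENNReal.ofReal (1 / ((n : ℝ) + 1)) := fun n => by
    rw [ENNReal.ofReal_pos]; positivity
  choose φ h1 h2 h3 h4 using fun n : ℕ => hu.2.2 _ (hε n)
  have ht : Tendsto (fun n : ℕ => ENNReal.ofReal (1 / ((n : ℝ) + 1))) atTop (𝓝 0) := by
    have := ENNReal.tendsto_ofReal (tendsto_one_div_add_atTop_nhds_zero_nat (𝕜 := ℝ))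
    rwa [ENNReal.ofReal_zero] at this
  have t1 : Tendsto (fun n => eLpNorm (fun x => u x - φ n x) (ENNReal.ofReal p) volume)
      atTop (𝓝 0) :=
    tendsto_of_tendsto_of_tendsto_of_le_of_le tendsto_const_nhds ht (fun _ => zero_le)
      fun n => (h3 n).le
  have t2 : Tendsto (fun n => eLpNorm (fun x => weakGrad u x - gradient (φ n) x)
      (ENNReal.ofReal p) volume) atTop (𝓝 0) :=
    tendsto_of_tendsto_of_tendsto_of_le_of_le tendsto_const_nhds ht (fun _ => zero_le)
      fun n => (h4 n).le
  have hm : TendstoInMeasure volume φ atTop u := by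
    refine tendstoInMeasure_of_tendsto_eLpNorm (p := ENNReal.ofReal p) (by simpa using hp)
      (fun n => (h1 n).continuous.aestronglyMeasurable) hu.1.1.1 ?_
    refine t1.congr fun n => ?_
    rw [← eLpNorm_sub_comm]; rfl
  obtain ⟨ns, hns, hae⟩ := hm.exists_seq_tendsto_ae
  exact ⟨fun n => φ (ns n), fun n => h1 _, fun n => h2 _, t1.comp hns.tendsto_atTop,
    t2.comp hns.tendsto_atTop, hae⟩

theorem memLp_comp_of_lipschitz {p : ℝ≥0∞} {F : ℝ → ℝ} (hF0 : F 0 = 0) {C : NNReal}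
    (hC : LipschitzWith C F) {u : RN N → ℝ} (hu : MemLp u p) : MemLp (fun x => F (u x)) p :=
  hC.comp_memLp hF0 hu

/-- For test functions `φ_n → u`, the compositions `F(φ_n)` are again test functions supported in
`Ω` because `F 0 = 0`. Their gradients converge: `(F'(u) - F'(φ_n))∇u` by dominated convergence,
`F'(φ_n)(∇u - ∇φ_n)` because `F'` is bounded. Closedness of the weak gradient concludes. -/
theorem MemW0.comp_of_hasCompactSupport {p : ℝ} (hp : 1 ≤ p) {Ω : Set (RN N)} {u : RN N → ℝ}
    (hu : MemW0 p Ω u) {F : ℝ → ℝ} (hF : ContDiff ℝ ∞ F) (hFc : HasCompactSupport F)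
    (hF0 : F 0 = 0) :
    IsWeakGradient (fun x => F (u x)) (fun x => deriv F (u x) • weakGrad u x) ∧
      MemW0 p Ω (fun x => F (u x)) := by
  have hp0 : 0 < p := by linarith
  have hp1 : (1 : ℝ≥0∞) ≤ ENNReal.ofReal p := by
    rw [← ENNReal.ofReal_one]; exact ENNReal.ofReal_le_ofReal hp
  obtain ⟨φ, h1, h2, t1, t2, hae⟩ := hu.exists_seq hp0
  have hF1 : ContDiff ℝ 1 F := hF.of_le (by exact_mod_cast le_top)
  have hFd : Continuous (deriv F) := hF1.continuous_deriv (by norm_num)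
  obtain ⟨C, hC⟩ := hFc.deriv.exists_bound_of_continuous hFd
  obtain ⟨K, hK⟩ := ContDiff.lipschitzWith_of_hasCompactSupport hFc hF1 (by norm_num)
  have hw' : MemLp (fun x => F (u x)) (ENNReal.ofReal p) := memLp_comp_of_lipschitz hF0 hK hu.1.1
  have hdm : AEStronglyMeasurable (fun x => deriv F (u x)) volume :=
    hFd.comp_aestronglyMeasurable hu.1.1.1
  have hG' : MemLp (fun x => deriv F (u x) • weakGrad u x) (ENNReal.ofReal p) := by
    refine hu.1.2.2.of_le_mul (c := C) (hdm.smul hu.1.2.2.1) (Eventually.of_forall fun x => ?_)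
    rw [norm_smul]
    exact mul_le_mul_of_nonneg_right (hC _) (norm_nonneg _)
  have htest : ∀ n, IsTestFunction (fun x => F (φ n x)) := fun n =>
    ⟨hF.comp (h1 n).1, (h1 n).2.comp_left hF0⟩
  have hgrad : ∀ n, gradient (fun x => F (φ n x)) = fun x => deriv F (φ n x) • gradient (φ n) x :=
    fun n => by
      ext1 x
      exact gradient_comp_real (hF1.differentiable (by norm_num) _) ((h1 n).differentiableAt x)
  have s1 : Tendsto (fun n => eLpNorm (fun x => F (u x) - F (φ n x)) (ENNReal.ofReal p) volume)
      atTop (𝓝 0) := by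
    refine tendsto_of_tendsto_of_tendsto_of_le_of_le tendsto_const_nhds
      (h := fun n => ENNReal.ofReal K * eLpNorm (fun x => u x - φ n x) (ENNReal.ofReal p) volume)
      ?_ (fun _ => zero_le) fun n => ?_
    · have := ENNReal.Tendsto.const_mul (a := ENNReal.ofReal K) t1 (Or.inr ENNReal.ofReal_ne_top)
      rwa [mul_zero] at this
    · refine eLpNorm_le_mul_eLpNorm_of_ae_le_mul (Eventually.of_forall fun x => ?_) _
      simpa [dist_eq_norm] using hK.dist_le_mul (u x) (φ n x)
  have s2 : Tendsto (fun n => eLpNorm (fun x => deriv F (u x) • weakGrad u x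
      - gradient (fun x => F (φ n x)) x) (ENNReal.ofReal p) volume) atTop (𝓝 0) := by
    have a1 : Tendsto (fun n => eLpNorm (fun x => (deriv F (u x) - deriv F (φ n x)) • weakGrad u x)
        (ENNReal.ofReal p) volume) atTop (𝓝 0) := by
      refine tendsto_eLpNorm_zero_of_dominated hp0 (g := fun x => (2 * C) • weakGrad u x)
        (fun n => (hdm.sub (hFd.comp (h1 n).continuous).aestronglyMeasurable).smul hu.1.2.2.1)
        (hu.1.2.2.const_smul (2 * C)) (fun n => Eventually.of_forall fun x => ?_) ?_
      · rw [norm_smul, norm_smul]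
        refine mul_le_mul_of_nonneg_right ?_ (norm_nonneg _)
        refine (norm_sub_le _ _).trans (((add_le_add (hC _) (hC _))).trans ?_)
        rw [← two_mul]; exact le_abs_self _
      · filter_upwards [hae] with x hx
        have : Tendsto (fun n => deriv F (u x) - deriv F (φ n x)) atTop (𝓝 (0 : ℝ)) := by
          have := ((hFd.tendsto (u x)).comp hx).const_sub (deriv F (u x))
          rwa [sub_self] at this
        have := this.smul_const (weakGrad u x)
        rwa [zero_smul] at this
    have a2 : Tendsto (fun n => ENNReal.ofReal C * eLpNorm (fun x => weakGrad u x
        - gradient (φ n) x) (ENNReal.ofReal p) volume) atTop (𝓝 0) := by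
      have := ENNReal.Tendsto.const_mul (a := ENNReal.ofReal C) t2 (Or.inr ENNReal.ofReal_ne_top)
      rwa [mul_zero] at this
    have a3 := a1.add a2
    rw [add_zero] at a3
    refine tendsto_of_tendsto_of_tendsto_of_le_of_le tendsto_const_nhds a3
      (fun _ => zero_le) fun n => ?_
    have e : (fun x => deriv F (u x) • weakGrad u x - gradient (fun x => F (φ n x)) x)
        = (fun x => (deriv F (u x) - deriv F (φ n x)) • weakGrad u x)
          + fun x => deriv F (φ n x) • (weakGrad u x - gradient (φ n) x) := by
      ext1 x
      simp only [Pi.add_apply]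
      rw [hgrad n, sub_smul, smul_sub]
      abel
    simp only
    rw [e]
    have hFφ := (hFd.comp (h1 n).continuous).aestronglyMeasurable (μ := (volume : Measure (RN N)))
    refine (eLpNorm_add_le ((hdm.sub hFφ).smul hu.1.2.2.1)
      (hFφ.smul (hu.1.2.2.1.sub (h1 n).continuous_gradient.aestronglyMeasurable)) hp1).trans ?_
    refine add_le_add le_rfl (eLpNorm_le_mul_eLpNorm_of_ae_le_mul
      (Eventually.of_forall fun x => ?_) _)
    rw [Pi.smul_apply', norm_smul]
    exact mul_le_mul_of_nonneg_right (hC _) (norm_nonneg _)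
  have hwg := isWeakGradient_of_tendsto hp (fun n => (htest n).isWeakGradient)
    (fun n => (htest n).memLp _) (fun n => (htest n).memLp_gradient _) hw' hG' s1 s2
  refine ⟨hwg, memW_of_isWeakGradient hw' hwg hG', ?_, fun ε hε => ?_⟩
  · filter_upwards [hu.2.1] with x hx hxΩ
    rw [hx hxΩ, hF0]
  · obtain ⟨n, e1, e2⟩ := ((s1.eventually (gt_mem_nhds hε)).and
      (s2.eventually (gt_mem_nhds hε))).exists
    refine ⟨fun x => F (φ n x), htest n, (tsupport_comp_subset hF0 (φ n)).trans (h2 n), e1, ?_⟩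
    refine lt_of_le_of_lt (le_of_eq (eLpNorm_congr_ae ?_)) e2
    filter_upwards [hwg.weakGrad_ae_eq] with x hx
    rw [hx]

theorem MemW0.congr {p : ℝ} {Ω : Set (RN N)} {u v : RN N → ℝ} (hu : MemW0 p Ω u)
    (huv : u =ᵐ[volume] v) : MemW0 p Ω v := by
  have hwg : weakGrad v =ᵐ[volume] weakGrad u :=
    (hu.1.2.1.congr huv (ae_eq_refl _)).weakGrad_ae_eq
  refine ⟨memW_of_isWeakGradient (hu.1.1.ae_eq huv) (hu.1.2.1.congr huv (ae_eq_refl _)) hu.1.2.2,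
    ?_, fun ε hε => ?_⟩
  · filter_upwards [huv, hu.2.1] with x h1 h2 h3
    rw [← h1, h2 h3]
  · obtain ⟨φ, h1, h2, h3, h4⟩ := hu.2.2 ε hε
    refine ⟨φ, h1, h2, ?_, ?_⟩
    · refine lt_of_le_of_lt (le_of_eq (eLpNorm_congr_ae ?_)) h3
      filter_upwards [huv] with x hx
      rw [hx]
    · refine lt_of_le_of_lt (le_of_eq (eLpNorm_congr_ae ?_)) h4
      filter_upwards [hwg] with x hx
      rw [hx]

/-- Chain rule in `W_0^{1,p}(Ω) ∩ L^∞`. -/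
theorem MemW0.comp_of_bounded {p : ℝ} (hp : 1 ≤ p) {Ω : Set (RN N)} {u : RN N → ℝ}
    (hu : MemW0 p Ω u) {T : ℝ} (hT : ∀ᵐ x, |u x| ≤ T) {F : ℝ → ℝ} (hF : ContDiff ℝ ∞ F)
    (hF0 : F 0 = 0) :
    IsWeakGradient (fun x => F (u x)) (fun x => deriv F (u x) • weakGrad u x) ∧
      MemW0 p Ω (fun x => F (u x)) := by
  obtain ⟨F', h1, h2, h3, h4⟩ := exists_compactSupport_eqOn hF hF0 T
  obtain ⟨k1, k2⟩ := hu.comp_of_hasCompactSupport hp h1 h2 h3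
  have e1 : (fun x => F' (u x)) =ᵐ[volume] fun x => F (u x) := by
    filter_upwards [hT] with x hx
    rw [(h4 _ hx).1]
  refine ⟨k1.congr e1 ?_, k2.congr e1⟩
  filter_upwards [hT] with x hx
  rw [(h4 _ hx).2]

/-- Chain rule in `W^{1,p}(ℝ^N) ∩ L^∞`. -/
theorem MemW.comp_of_bounded {p : ℝ} (hp : 1 ≤ p) {u : RN N → ℝ}
    (hu : MemW p u) {T : ℝ} (hT : ∀ᵐ x, |u x| ≤ T) {F : ℝ → ℝ} (hF : ContDiff ℝ ∞ F)
    (hF0 : F 0 = 0) :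
    IsWeakGradient (fun x => F (u x)) (fun x => deriv F (u x) • weakGrad u x) ∧
      MemW p (fun x => F (u x)) := by
  have hp1 : (1 : ℝ≥0∞) ≤ ENNReal.ofReal p := by
    rw [← ENNReal.ofReal_one]; exact ENNReal.ofReal_le_ofReal hp
  have hF1 : ContDiff ℝ 1 F := hF.of_le (by exact_mod_cast le_top)
  have hFd : Continuous (deriv F) := hF1.continuous_deriv (by norm_num)
  obtain ⟨F', f1, f2, f3, f4⟩ := exists_compactSupport_eqOn hF hF0 T
  have f5 : ContDiff ℝ 1 F' := f1.of_le (by exact_mod_cast le_top)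
  obtain ⟨K, hK⟩ := ContDiff.lipschitzWith_of_hasCompactSupport f2 f5 (by norm_num)
  obtain ⟨C, hC⟩ := f2.deriv.exists_bound_of_continuous (f5.continuous_deriv (by norm_num))
  have hw : MemLp (fun x => F (u x)) (ENNReal.ofReal p) := by
    refine (memLp_comp_of_lipschitz f3 hK hu.1).ae_eq ?_
    filter_upwards [hT] with x hx
    rw [(f4 _ hx).1]
  have hG : MemLp (fun x => deriv F (u x) • weakGrad u x) (ENNReal.ofReal p) := by
    refine hu.2.2.of_le_mul (c := C)
      ((hFd.comp_aestronglyMeasurable hu.1.1).smul hu.2.2.1) ?_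
    filter_upwards [hT] with x hx
    rw [norm_smul, ← (f4 _ hx).2]
    exact mul_le_mul_of_nonneg_right (hC _) (norm_nonneg _)
  have hwg : IsWeakGradient (fun x => F (u x)) (fun x => deriv F (u x) • weakGrad u x) := by
    refine ⟨hw.locallyIntegrable hp1, hG.locallyIntegrable hp1, fun φ hφ => ?_⟩
    obtain ⟨R, hR⟩ := hφ.2.isBounded.subset_closedBall (0 : RN N)
    -- The identity tested with `φ` sees `u` only on the support of `φ`, where `η = 1`; hence `u`
    -- may be replaced by `ηu`, which lies in `W_0^{1,p}` of a ball.
    obtain ⟨η, hη, hη01, hη1, hη0⟩ := exists_isTestFunction_cutoff (N := N) R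
    have hηu : MemW0 p (Metric.ball 0 (|R| + 3)) (fun x => η x * u x) := by
      refine (hu.mul_test hη).memW0_ball hp (R := |R| + 2) (by linarith)
        (Eventually.of_forall fun x hx => ?_)
      rw [(hη0 x hx).1, zero_mul]
    have hηT : ∀ᵐ x, |η x * u x| ≤ T := by
      filter_upwards [hT] with x hx
      rw [abs_mul, abs_of_nonneg (hη01 x).1]
      exact (mul_le_of_le_one_left (abs_nonneg _) (hη01 x).2).trans hx
    have key := (hηu.comp_of_bounded hp hηT hF hF0).1.2.2 φ hφ
    have e1 : ∀ x, F (η x * u x) • gradient φ x = F (u x) • gradient φ x := fun x => by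
      by_cases hx : x ∈ tsupport φ
      · rw [(hη1 x (hR hx)).1, one_mul]
      · rw [gradient_eq_zero_of_notMem_tsupport hx, smul_zero, smul_zero]
    have e2 : ∀ᵐ x, φ x • deriv F (η x * u x) • weakGrad (fun y => η y * u y) x
        = φ x • deriv F (u x) • weakGrad u x := by
      filter_upwards [hu.weakGrad_mul_test hη] with x hx
      by_cases hx' : x ∈ tsupport φ
      · rw [hx, (hη1 x (hR hx')).1, (hη1 x (hR hx')).2, one_mul, one_smul, smul_zero, add_zero]
      · rw [image_eq_zero_of_notMem_tsupport hx', zero_smul, zero_smul]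
    simp_rw [e1] at key
    rw [key, integral_congr_ae e2]
  exact ⟨hwg, memW_of_isWeakGradient hw hwg hG⟩

end QuasilinearSchrodinger

namespace QuasilinearSchrodinger

variable {N : ℕ}

/-! ### Carathéodory functions -/

namespace IsCaratheodory

theorem ae_continuous {h : RN N → ℝ → ℝ} (hh : IsCaratheodory 0 h) : ∀ᵐ x, Continuous (h x) := by
  filter_upwards [hh.2] with x hx
  exact hx.continuous

theorem of_one {h : RN N → ℝ → ℝ} (hh : IsCaratheodory 1 h) : IsCaratheodory 0 h := by
  refine ⟨hh.1, ?_⟩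
  filter_upwards [hh.2] with x hx
  exact hx.of_le (by norm_num)

/-- A Carathéodory function agrees, off a null set of `x`, with a jointly measurable function which
is continuous in `t` for every `x`. -/
theorem exists_measurable {h : RN N → ℝ → ℝ} (hh : IsCaratheodory 0 h) :
    ∃ h' : RN N → ℝ → ℝ, Measurable (Function.uncurry h') ∧ (∀ x, Continuous (h' x)) ∧
      ∀ᵐ x, h' x = h x := by
  set H : ℚ → RN N → ℝ := fun r => (hh.1 r).mk with hH
  have hS : ∀ᵐ x, (∀ r : ℚ, h x r = H r x) ∧ Continuous (h x) := by
    filter_upwards [ae_all_iff.mpr fun r : ℚ => (hh.1 r).ae_eq_mk, hh.ae_continuous] with x h1 h2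
    exact ⟨h1, h2⟩
  rw [ae_iff] at hS
  -- A measurable null set outside which `h x` is continuous and agrees with measurable
  -- representatives at all rationals. There the value at any real `t` is a limit of measurable
  -- functions of `x`.
  set Z := toMeasurable volume {x | ¬((∀ r : ℚ, h x r = H r x) ∧ Continuous (h x))} with hZ
  have hZm : MeasurableSet Z := measurableSet_toMeasurable _ _
  have hZ0 : volume Z = 0 := by rw [hZ, measure_toMeasurable, hS]
  have hZc : ∀ x, x ∉ Z → (∀ r : ℚ, h x r = H r x) ∧ Continuous (h x) := fun x hx => by
    by_contra h'
    exact hx (subset_toMeasurable _ _ h')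
  classical
  set h' : RN N → ℝ → ℝ := fun x t => if x ∈ Z then 0 else h x t with hh'
  have hcont : ∀ x, Continuous (h' x) := fun x => by
    by_cases hx : x ∈ Z
    · simp only [hh', hx, if_true]; exact continuous_const
    · simp only [hh', hx, if_false]; exact (hZc x hx).2
  have hmeas : ∀ t, Measurable fun x => h' x t := fun t => by
    obtain ⟨r, hr⟩ : ∃ r : ℕ → ℚ, Tendsto (fun n => (r n : ℝ)) atTop (𝓝 t) := by
      have hd : DenseRange ((↑) : ℚ → ℝ) := Rat.denseRange_cast
      obtain ⟨s, hs, hst⟩ := mem_closure_iff_seq_limit.mp (hd t)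
      choose r hr using hs
      exact ⟨r, by simpa only [hr] using hst⟩
    refine measurable_of_tendsto_metrizable (f := fun n x => if x ∈ Z then 0 else H (r n) x)
      (fun n => Measurable.ite hZm measurable_const (hh.1 (r n)).measurable_mk) ?_
    rw [tendsto_pi_nhds]
    intro x
    by_cases hx : x ∈ Z
    · simp only [hh', hx, if_true]; exact tendsto_const_nhds
    · simp only [hh', hx, if_false]
      have := ((hZc x hx).2.tendsto t).comp hr
      refine this.congr fun n => ?_
      exact (hZc x hx).1 (r n)
  refine ⟨h', ?_, hcont, ?_⟩
  · have := measurable_uncurry_of_continuous_of_measurable (u := fun t x => h' x t) hcont hmeas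
    exact this.comp measurable_swap
  · have : ∀ᵐ x, x ∉ Z := by rw [ae_iff]; simpa using hZ0
    filter_upwards [this] with x hx
    funext t
    simp only [hh', hx, if_false]

theorem aemeasurable_comp {h : RN N → ℝ → ℝ} (hh : IsCaratheodory 0 h) {u : RN N → ℝ}
    (hu : AEMeasurable u) : AEMeasurable (fun x => h x (u x)) := by
  obtain ⟨h', h1, -, h3⟩ := hh.exists_measurable
  refine (h1.comp_aemeasurable (aemeasurable_id.prodMk hu)).congr ?_
  filter_upwards [h3] with x hx
  simp [Function.uncurry, hx]

/-- Measurability in `x` holds because the derivative is a limit of difference quotients along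
`1/(n+1)`. -/
theorem partialT {A : RN N → ℝ → ℝ} (hA : IsCaratheodory 1 A) :
    IsCaratheodory 0 (partialT A) := by
  refine ⟨fun t => ?_, ?_⟩
  · refine aemeasurable_of_tendsto_metrizable_ae (u := atTop)
      (f := fun (n : ℕ) x => ((n : ℝ) + 1) * (A x (t + 1 / ((n : ℝ) + 1)) - A x t))
      (fun n => ((hA.1 _).sub (hA.1 _)).const_mul _) ?_
    filter_upwards [hA.2] with x hx
    have hd : HasDerivAt (A x) (QuasilinearSchrodinger.partialT A x t) t :=
      ((hx.differentiable (by norm_num)) t).hasDerivAt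
    have h1 : Tendsto (fun n : ℕ => 1 / ((n : ℝ) + 1)) atTop (𝓝[≠] 0) := by
      refine tendsto_nhdsWithin_iff.mpr ⟨tendsto_one_div_add_atTop_nhds_zero_nat,
        Eventually.of_forall fun n => ?_⟩
      have : (0 : ℝ) < 1 / ((n : ℝ) + 1) := by positivity
      exact this.ne'
    refine (hd.tendsto_slope_zero.comp h1).congr fun n => ?_
    simp
  · filter_upwards [hA.2] with x hx
    have hx' : ContDiff ℝ 1 (A x) := by simpa using hx
    simpa using! (contDiff_zero (𝕜 := ℝ)).mpr (hx'.continuous_deriv (by norm_num))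

theorem ae_hasDerivAt_primitiveT {g : RN N → ℝ → ℝ} (hg : IsCaratheodory 0 g) :
    ∀ᵐ x, ∀ t, HasDerivAt (QuasilinearSchrodinger.primitiveT g x) (g x t) t := by
  filter_upwards [hg.ae_continuous] with x hx t
  exact intervalIntegral.integral_hasDerivAt_right (hx.intervalIntegrable _ _)
    (hx.stronglyMeasurableAtFilter _ _) hx.continuousAt

theorem primitiveT {g : RN N → ℝ → ℝ} (hg : IsCaratheodory 0 g) :
    IsCaratheodory 0 (primitiveT g) := by
  refine ⟨fun t => ?_, ?_⟩
  · obtain ⟨h', h1, h2, h3⟩ := hg.exists_measurable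
    have hm : Measurable fun x => ∫ s in (0 : ℝ)..t, h' x s := by
      simp only [intervalIntegral]
      exact (h1.stronglyMeasurable.integral_prod_right (ν := volume.restrict _)).measurable.sub
        (h1.stronglyMeasurable.integral_prod_right (ν := volume.restrict _)).measurable
    refine hm.aemeasurable.congr ?_
    filter_upwards [h3] with x hx
    simp only [QuasilinearSchrodinger.primitiveT, hx]
  · filter_upwards [hg.ae_hasDerivAt_primitiveT] with x hx
    have : Continuous (QuasilinearSchrodinger.primitiveT g x) :=
      continuous_iff_continuousAt.mpr fun t => (hx t).continuousAt
    simpa using! (contDiff_zero (𝕜 := ℝ)).mpr this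

end IsCaratheodory

end QuasilinearSchrodinger

namespace QuasilinearSchrodinger

variable {N : ℕ}

/-! ### Inequalities for the `p`-Laplacian vector field -/

section Inequalities

variable {E F : Type*} [NormedAddCommGroup E] [InnerProductSpace ℝ E]
  [NormedAddCommGroup F] [NormedSpace ℝ F]

/-- The vector field `a ↦ |a|^{p-2} a`. -/
noncomputable def pMap (p : ℝ) (a : E) : E := ‖a‖ ^ (p - 2) • a

theorem norm_pMap {p : ℝ} (hp : 1 < p) (a : E) : ‖pMap p a‖ = ‖a‖ ^ (p - 1) := by
  rw [pMap, norm_smul, Real.norm_of_nonneg (by positivity)]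
  rcases eq_or_ne a 0 with rfl | ha
  · rw [norm_zero, mul_zero, Real.zero_rpow (by linarith)]
  · rw [← Real.rpow_add_one (norm_ne_zero_iff.mpr ha)]; congr 1; ring

theorem inner_pMap_self {p : ℝ} (hp : 1 < p) (a : E) : inner ℝ (pMap p a) a = ‖a‖ ^ p := by
  rw [pMap, real_inner_smul_left, real_inner_self_eq_norm_sq]
  rcases eq_or_ne a 0 with rfl | ha
  · rw [norm_zero, Real.zero_rpow (by linarith : p ≠ 0)]; simp
  · rw [← Real.rpow_natCast, ← Real.rpow_add (norm_pos_iff.mpr ha)]; congr 1; push_cast; ring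

theorem pMap_smul {p c : ℝ} (hc : 0 < c) (a : E) :
    pMap p (c • a) = c ^ (p - 1) • pMap p a := by
  rw [pMap, pMap, norm_smul, Real.norm_of_nonneg hc.le, Real.mul_rpow hc.le (norm_nonneg _),
    smul_smul, smul_smul]
  congr 1
  have : c ^ (p - 1) = c ^ (p - 2) * c := by rw [← Real.rpow_add_one hc.ne']; congr 1; ring
  rw [this]; ring

theorem continuous_pMap {p : ℝ} (hp : 1 < p) : Continuous (pMap p : E → E) := by
  rw [continuous_iff_continuousAt]
  intro a
  rcases eq_or_ne a 0 with rfl | ha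
  · have h0 : pMap p (0 : E) = 0 := by simp [pMap]
    rw [ContinuousAt, h0, tendsto_zero_iff_norm_tendsto_zero]
    simp_rw [norm_pMap hp]
    have : ContinuousAt (fun a : E => ‖a‖ ^ (p - 1)) 0 :=
      continuous_norm.continuousAt.rpow_const (Or.inr (by linarith))
    have h1 := this.tendsto
    simpa [Real.zero_rpow (by linarith : p - 1 ≠ 0)] using h1
  · exact (continuous_norm.continuousAt.rpow_const (Or.inl (norm_ne_zero_iff.mpr ha))).smul
      continuousAt_id

theorem inner_pMap_le {p : ℝ} (hp : 1 < p) (a b : E) :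
    |inner ℝ (pMap p a) b| ≤ ‖a‖ ^ (p - 1) * ‖b‖ := by
  rw [← norm_pMap hp]; exact abs_real_inner_le_norm _ _

theorem inner_pMap_sub_pos {p : ℝ} (hp : 1 < p) {a b : E} (hab : a ≠ b) :
    0 < inner ℝ (pMap p a - pMap p b) (a - b) := by
  -- Both summands are nonnegative: the first detects a difference of norms, the second a difference
  -- of directions (Cauchy–Schwarz). This works for all `p > 1` at once.
  have e : inner ℝ (pMap p a - pMap p b) (a - b) = (‖a‖ ^ (p - 1) - ‖b‖ ^ (p - 1)) * (‖a‖ - ‖b‖)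
      + (‖a‖ ^ (p - 2) + ‖b‖ ^ (p - 2)) * (‖a‖ * ‖b‖ - inner ℝ a b) := by
    have ha := inner_pMap_self hp a
    have hb := inner_pMap_self hp b
    have h1 : ∀ c : E, ‖c‖ ^ (p - 1) * ‖c‖ = ‖c‖ ^ p := fun c => by
      rw [← norm_pMap hp, ← inner_pMap_self hp, pMap, norm_smul, real_inner_smul_left,
        real_inner_self_eq_norm_sq, Real.norm_of_nonneg (by positivity)]; ring
    have h2 : ∀ c : E, ‖c‖ ^ (p - 2) * ‖c‖ = ‖c‖ ^ (p - 1) := fun c => by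
      rw [← norm_pMap hp, pMap, norm_smul, Real.norm_of_nonneg (by positivity)]
    have h3 : inner ℝ (pMap p a) b = ‖a‖ ^ (p - 2) * inner ℝ a b := by
      rw [pMap, real_inner_smul_left]
    have h4 : inner ℝ (pMap p b) a = ‖b‖ ^ (p - 2) * inner ℝ a b := by
      rw [pMap, real_inner_smul_left, real_inner_comm]
    rw [inner_sub_left, inner_sub_right, inner_sub_right, ha, hb, h3, h4, ← h1 a, ← h1 b,
      ← h2 a, ← h2 b]
    ring
  have hi : inner ℝ a b ≤ ‖a‖ * ‖b‖ := real_inner_le_norm a b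
  have hq : 0 < p - 1 := by linarith
  rw [e]
  rcases lt_trichotomy ‖a‖ ‖b‖ with h | h | h
  · have h1 := Real.rpow_lt_rpow (norm_nonneg a) h hq
    have h2 : 0 < (‖a‖ ^ (p - 1) - ‖b‖ ^ (p - 1)) * (‖a‖ - ‖b‖) :=
      mul_pos_of_neg_of_neg (by linarith) (by linarith)
    have h3 : 0 ≤ (‖a‖ ^ (p - 2) + ‖b‖ ^ (p - 2)) * (‖a‖ * ‖b‖ - inner ℝ a b) :=
      mul_nonneg (by positivity) (by linarith)
    linarith
  · have hb : 0 < ‖b‖ := by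
      rw [norm_pos_iff]; rintro rfl
      rw [norm_zero, norm_eq_zero] at h; exact hab h
    have h2 : inner ℝ a b ≠ ‖a‖ * ‖b‖ := fun h' => by
      have := (inner_eq_norm_mul_iff_real).mp h'
      rw [h] at this
      exact hab (smul_right_injective E hb.ne' this)
    have h3 : 0 < (‖a‖ ^ (p - 2) + ‖b‖ ^ (p - 2)) * (‖a‖ * ‖b‖ - inner ℝ a b) := by
      have : 0 < ‖b‖ ^ (p - 2) := Real.rpow_pos_of_pos hb _
      exact mul_pos (by positivity) (sub_pos.mpr (lt_of_le_of_ne hi h2))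
    rw [h] at h3 ⊢
    simpa using h3
  · have h1 := Real.rpow_lt_rpow (norm_nonneg b) h hq
    have h2 : 0 < (‖a‖ ^ (p - 1) - ‖b‖ ^ (p - 1)) * (‖a‖ - ‖b‖) :=
      mul_pos (by linarith) (by linarith)
    have h3 : 0 ≤ (‖a‖ ^ (p - 2) + ‖b‖ ^ (p - 2)) * (‖a‖ * ‖b‖ - inner ℝ a b) :=
      mul_nonneg (by positivity) (by linarith)
    linarith

theorem inner_pMap_sub_nonneg {p : ℝ} (hp : 1 < p) (a b : E) :
    0 ≤ inner ℝ (pMap p a - pMap p b) (a - b) := by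
  rcases eq_or_ne a b with rfl | h
  · simp
  · exact (inner_pMap_sub_pos hp h).le

variable [FiniteDimensional ℝ E]

/-- Continuity estimate for positively homogeneous continuous maps. -/
theorem exists_norm_sub_le_of_homogeneous {r : ℝ} (hr : 0 < r) {f : E → F} (hf : Continuous f)
    (hh : ∀ c : ℝ, 0 < c → ∀ a, f (c • a) = c ^ r • f a) {ε : ℝ} (hε : 0 < ε) :
    ∃ C : ℝ, 0 ≤ C ∧ ∀ a b, ‖f (a + b) - f a‖ ≤ ε * ‖a‖ ^ r + C * ‖b‖ ^ r := by
  have hK : IsCompact (Metric.closedBall (0 : E) 2) := isCompact_closedBall _ _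
  obtain ⟨M, hM⟩ := hK.exists_bound_of_continuousOn hf.continuousOn
  have hM0 : 0 ≤ M := (norm_nonneg _).trans (hM 0 (by simp))
  have huc := Metric.uniformContinuousOn_iff.mp (hK.uniformContinuousOn_of_continuous
    hf.continuousOn) ε hε
  obtain ⟨δ, hδ, hδ'⟩ := huc
  have hf0 : f 0 = 0 := by
    have := hh 2 (by norm_num) 0
    rw [smul_zero] at this
    have h2 : ((2 : ℝ) ^ r - 1) • f 0 = 0 := by rw [sub_smul, one_smul, ← this, sub_self]
    rcases smul_eq_zero.mp h2 with h3 | h3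
    · have := Real.one_lt_rpow (by norm_num : (1 : ℝ) < 2) hr
      linarith
    · exact h3
  have hnorm : ∀ a, ‖f a‖ ≤ M * ‖a‖ ^ r := fun a => by
    rcases eq_or_ne a 0 with rfl | ha
    · rw [hf0, norm_zero]; positivity
    · have ha' := norm_pos_iff.mpr ha
      have h1 : f a = ‖a‖ ^ r • f (‖a‖⁻¹ • a) := by
        rw [← hh _ ha', smul_smul, mul_inv_cancel₀ ha'.ne', one_smul]
      rw [h1, norm_smul, Real.norm_of_nonneg (by positivity), mul_comm]
      refine mul_le_mul_of_nonneg_right (hM _ ?_) (by positivity)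
      rw [mem_closedBall_zero_iff, norm_smul, norm_inv, norm_norm, inv_mul_cancel₀ ha'.ne']
      norm_num
  set δ' := min δ 1 with hδd
  have hδ'0 : 0 < δ' := lt_min hδ one_pos
  refine ⟨2 * M * (1 / δ' + 1) ^ r, by positivity, fun a b => ?_⟩
  -- If `b` is small relative to `a`, rescaling to `‖a‖ = 1` reduces to uniform continuity on a
  -- ball. Otherwise `‖a‖` is controlled by `‖b‖`, and homogeneity alone bounds both terms by `‖b‖ ^
  -- r`.
  by_cases hab : ‖b‖ < δ' * ‖a‖
  · have ha' : 0 < ‖a‖ := by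
      by_contra h
      have : ‖a‖ = 0 := le_antisymm (not_lt.mp h) (norm_nonneg _)
      rw [this, mul_zero] at hab
      exact absurd hab (not_lt.mpr (norm_nonneg _))
    have h1 : ∀ c, f c = ‖a‖ ^ r • f (‖a‖⁻¹ • c) := fun c => by
      rw [← hh _ ha', smul_smul, mul_inv_cancel₀ ha'.ne', one_smul]
    have hn1 : ‖‖a‖⁻¹ • a‖ = 1 := by
      rw [norm_smul, norm_inv, norm_norm, inv_mul_cancel₀ ha'.ne']
    have hn2 : ‖‖a‖⁻¹ • b‖ < δ' := by
      rw [norm_smul, norm_inv, norm_norm, inv_mul_lt_iff₀ ha', mul_comm]; exact hab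
    rw [h1 (a + b), h1 a, ← smul_sub, norm_smul, Real.norm_of_nonneg (by positivity), mul_comm]
    have h2 : ‖f (‖a‖⁻¹ • (a + b)) - f (‖a‖⁻¹ • a)‖ < ε := by
      rw [← dist_eq_norm]
      refine hδ' _ ?_ _ ?_ ?_
      · rw [mem_closedBall_zero_iff, smul_add]
        have := norm_add_le (‖a‖⁻¹ • a) (‖a‖⁻¹ • b)
        have := min_le_right δ 1
        linarith
      · rw [mem_closedBall_zero_iff, hn1]; norm_num
      · rw [dist_eq_norm, smul_add, add_sub_cancel_left]
        exact hn2.trans_le (min_le_left _ _)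
    have h3 : ‖f (‖a‖⁻¹ • (a + b)) - f (‖a‖⁻¹ • a)‖ * ‖a‖ ^ r ≤ ε * ‖a‖ ^ r :=
      mul_le_mul_of_nonneg_right h2.le (by positivity)
    have h4 : 0 ≤ 2 * M * (1 / δ' + 1) ^ r * ‖b‖ ^ r := by positivity
    linarith
  · have hab' : ‖a‖ ≤ 1 / δ' * ‖b‖ := by
      rw [one_div, ← div_eq_inv_mul, le_div_iff₀ hδ'0, mul_comm]; exact not_lt.mp hab
    have hb1 : ‖a + b‖ ^ r ≤ (1 / δ' + 1) ^ r * ‖b‖ ^ r := by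
      rw [← Real.mul_rpow (by positivity) (norm_nonneg _)]
      refine Real.rpow_le_rpow (norm_nonneg _) ?_ hr.le
      have := norm_add_le a b
      linarith
    have hb2 : ‖a‖ ^ r ≤ (1 / δ' + 1) ^ r * ‖b‖ ^ r := by
      rw [← Real.mul_rpow (by positivity) (norm_nonneg _)]
      refine Real.rpow_le_rpow (norm_nonneg _) ?_ hr.le
      have := norm_nonneg b
      linarith
    have h1 := norm_sub_le (f (a + b)) (f a)
    have h2 := (hnorm (a + b)).trans (mul_le_mul_of_nonneg_left hb1 hM0)
    have h3 := (hnorm a).trans (mul_le_mul_of_nonneg_left hb2 hM0)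
    have h4 : 0 ≤ ε * ‖a‖ ^ r := by positivity
    linarith

theorem exists_norm_pMap_sub_le {p : ℝ} (hp : 1 < p) {ε : ℝ} (hε : 0 < ε) :
    ∃ C : ℝ, 0 ≤ C ∧ ∀ a b : E,
      ‖pMap p (a + b) - pMap p a‖ ≤ ε * ‖a‖ ^ (p - 1) + C * ‖b‖ ^ (p - 1) :=
  exists_norm_sub_le_of_homogeneous (by linarith) (continuous_pMap hp)
    (fun _ hc a => pMap_smul hc a) hε

theorem exists_abs_norm_rpow_sub_le (E : Type*) [NormedAddCommGroup E] [InnerProductSpace ℝ E]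
    [FiniteDimensional ℝ E] {p : ℝ} (hp : 0 < p) {ε : ℝ} (hε : 0 < ε) :
    ∃ C : ℝ, 0 ≤ C ∧ ∀ a b : E,
      |‖a + b‖ ^ p - ‖a‖ ^ p| ≤ ε * ‖a‖ ^ p + C * ‖b‖ ^ p :=
  exists_norm_sub_le_of_homogeneous (f := fun a : E => ‖a‖ ^ p) hp
    (continuous_norm.rpow_const fun _ => Or.inr hp.le)
    (fun c hc a => by
      rw [norm_smul, Real.norm_of_nonneg hc.le, Real.mul_rpow hc.le (norm_nonneg _), smul_eq_mul])
    hε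

/-- First order expansion of `|·|^p`. -/
theorem exists_abs_norm_rpow_expansion_le (E : Type*) [NormedAddCommGroup E]
    [InnerProductSpace ℝ E] [FiniteDimensional ℝ E] {p : ℝ} (hp : 1 < p) {ε : ℝ} (hε : 0 < ε) :
    ∃ C : ℝ, 0 ≤ C ∧ ∀ a b : E, |‖a + b‖ ^ p - ‖a‖ ^ p - p * inner ℝ (pMap p a) b|
      ≤ ε * (‖a‖ ^ (p - 1) * ‖b‖) + C * ‖b‖ ^ p := by
  have hp0 : 0 < p := by linarith
  obtain ⟨C, hC0, hC⟩ := exists_norm_pMap_sub_le (E := E) hp (ε := ε / p) (by positivity)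
  refine ⟨p * C, by positivity, fun a b => ?_⟩
  have hd : ∀ t : ℝ, HasDerivAt (fun t : ℝ => ‖a + t • b‖ ^ p)
      (p * inner ℝ (pMap p (a + t • b)) b) t := fun t => by
    have h1 : HasDerivAt (fun t : ℝ => a + t • b) b t := by
      simpa using ((hasDerivAt_id t).smul_const b).const_add a
    have h2 := (hasFDerivAt_norm_rpow (a + t • b) hp).comp_hasDerivAt t h1
    have e : ((p * ‖a + t • b‖ ^ (p - 2)) • innerSL ℝ (a + t • b)) b
        = p * inner ℝ (pMap p (a + t • b)) b := by
      rw [pMap, real_inner_smul_left, ← mul_assoc]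
      rfl
    rw [e] at h2
    exact h2
  -- The mean value theorem on the segment from `a` to `a + b` turns the remainder into an increment
  -- of `pMap`.
  obtain ⟨t, ht, hte⟩ := exists_hasDerivAt_eq_slope (fun t : ℝ => ‖a + t • b‖ ^ p) _
    (zero_lt_one) (fun t _ => (hd t).continuousAt.continuousWithinAt) (fun t _ => hd t)
  have e : ‖a + b‖ ^ p - ‖a‖ ^ p = p * inner ℝ (pMap p (a + t • b)) b := by
    rw [hte]; simp
  rw [e, ← mul_sub, ← inner_sub_left, abs_mul, abs_of_pos hp0]
  have h1 := abs_real_inner_le_norm (pMap p (a + t • b) - pMap p a) b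
  have h2 := hC a (t • b)
  have h3 : ‖t • b‖ ^ (p - 1) ≤ ‖b‖ ^ (p - 1) := by
    refine Real.rpow_le_rpow (norm_nonneg _) ?_ (by linarith)
    rw [norm_smul, Real.norm_of_nonneg ht.1.le]
    exact mul_le_of_le_one_left (norm_nonneg _) ht.2.le
  have h4 : ‖pMap p (a + t • b) - pMap p a‖ ≤ ε / p * ‖a‖ ^ (p - 1) + C * ‖b‖ ^ (p - 1) :=
    h2.trans (by gcongr)
  have h5 : ‖b‖ ^ (p - 1) * ‖b‖ = ‖b‖ ^ p := by
    rw [← norm_pMap hp, ← inner_pMap_self hp, pMap, norm_smul, real_inner_smul_left,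
        real_inner_self_eq_norm_sq, Real.norm_of_nonneg (by positivity)]; ring
  calc p * |inner ℝ (pMap p (a + t • b) - pMap p a) b|
      ≤ p * ((ε / p * ‖a‖ ^ (p - 1) + C * ‖b‖ ^ (p - 1)) * ‖b‖) := by
        gcongr
        exact h1.trans (mul_le_mul_of_nonneg_right h4 (norm_nonneg _))
    _ = _ := by rw [add_mul, mul_assoc C, h5]; field_simp

/-- A substitute for the usual strong monotonicity inequalities, with no distinction between `p < 2`
and `p ≥ 2`. All terms are homogeneous of degree `p`, so one may assume `‖a‖^p + ‖b‖^p = 1`; when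
`‖a - b‖^p ≥ ε`, the monotonicity term has a positive minimum by compactness. -/
theorem exists_norm_sub_rpow_le (E : Type*) [NormedAddCommGroup E]
    [InnerProductSpace ℝ E] [FiniteDimensional ℝ E] {p : ℝ} (hp : 1 < p) {ε : ℝ} (hε : 0 < ε) :
    ∃ C : ℝ, 0 ≤ C ∧ ∀ a b : E, ‖a - b‖ ^ p ≤ ε * (‖a‖ ^ p + ‖b‖ ^ p)
      + C * inner ℝ (pMap p a - pMap p b) (a - b) := by
  have hp0 : 0 < p := by linarith
  set S : Set (E × E) := {z | ‖z.1‖ ^ p + ‖z.2‖ ^ p = 1 ∧ ε ≤ ‖z.1 - z.2‖ ^ p} with hS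
  have c1 : Continuous fun z : E × E => ‖z.1‖ ^ p + ‖z.2‖ ^ p :=
    ((continuous_fst.norm).rpow_const fun _ => Or.inr hp0.le).add
      ((continuous_snd.norm).rpow_const fun _ => Or.inr hp0.le)
  have c2 : Continuous fun z : E × E => ‖z.1 - z.2‖ ^ p :=
    ((continuous_fst.sub continuous_snd).norm).rpow_const fun _ => Or.inr hp0.le
  have c3 : Continuous fun z : E × E => inner ℝ (pMap p z.1 - pMap p z.2) (z.1 - z.2) :=
    (((continuous_pMap hp).comp continuous_fst).sub ((continuous_pMap hp).comp
      continuous_snd)).inner (continuous_fst.sub continuous_snd)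
  have hle1 : ∀ x : ℝ, 0 ≤ x → x ^ p ≤ 1 → x ≤ 1 := fun x hx h => by
    by_contra h'
    exact absurd h (not_le.mpr (Real.one_lt_rpow (not_le.mp h') hp0))
  have hScomp : IsCompact S := by
    refine (isCompact_closedBall (0 : E × E) 1).of_isClosed_subset
      ((isClosed_eq c1 continuous_const).inter (isClosed_le continuous_const c2)) ?_
    rintro ⟨a, b⟩ ⟨h1, -⟩
    simp only at h1
    rw [mem_closedBall_zero_iff, Prod.norm_def, max_le_iff]
    have := Real.rpow_nonneg (norm_nonneg a) p
    have := Real.rpow_nonneg (norm_nonneg b) p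
    exact ⟨hle1 _ (norm_nonneg _) (by linarith), hle1 _ (norm_nonneg _) (by linarith)⟩
  have hub : ∀ a b : E, ‖a - b‖ ^ p ≤ 2 ^ p * (‖a‖ ^ p + ‖b‖ ^ p) := fun a b =>
    (Real.rpow_le_rpow (norm_nonneg _) (norm_sub_le a b) hp0.le).trans
      (add_rpow_le_two_rpow_mul hp0 (norm_nonneg _) (norm_nonneg _))
  obtain ⟨m, hm0, hm⟩ : ∃ m : ℝ, 0 < m ∧ ∀ z ∈ S,
      m ≤ inner ℝ (pMap p z.1 - pMap p z.2) (z.1 - z.2) := by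
    rcases S.eq_empty_or_nonempty with h | h
    · exact ⟨1, one_pos, fun z hz => by rw [h] at hz; exact hz.elim⟩
    · obtain ⟨z, hz, hmin⟩ := hScomp.exists_isMinOn h c3.continuousOn
      refine ⟨_, ?_, fun w hw => hmin hw⟩
      refine inner_pMap_sub_pos hp fun h' => ?_
      have := hz.2
      rw [h', sub_self, norm_zero, Real.zero_rpow hp0.ne'] at this
      linarith
  have hnorm : ∀ a b : E, ‖a‖ ^ p + ‖b‖ ^ p = 1 → ‖a - b‖ ^ p ≤ ε
      + 2 ^ p / m * inner ℝ (pMap p a - pMap p b) (a - b) := fun a b hab => by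
    by_cases h : ε ≤ ‖a - b‖ ^ p
    · have h1 := hm (a, b) ⟨hab, h⟩
      have h2 := hub a b
      rw [hab, mul_one] at h2
      have h3 : 2 ^ p / m * m ≤ 2 ^ p / m * inner ℝ (pMap p a - pMap p b) (a - b) :=
        mul_le_mul_of_nonneg_left h1 (by positivity)
      rw [div_mul_cancel₀ _ hm0.ne'] at h3
      linarith
    · have h1 := inner_pMap_sub_nonneg hp a b
      have h2 : 0 ≤ 2 ^ p / m * inner ℝ (pMap p a - pMap p b) (a - b) := by positivity
      linarith [not_le.mp h]
  -- `2^p` bounds `‖a - b‖^p` on the normalised set and `m` is the minimum of the monotonicity term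
  -- there.
  refine ⟨2 ^ p / m, by positivity, fun a b => ?_⟩
  set s := ‖a‖ ^ p + ‖b‖ ^ p with hs
  have hs0 : 0 ≤ s := by positivity
  rcases hs0.eq_or_lt with h0 | h0
  · have h1 := hub a b
    rw [← hs, ← h0, mul_zero] at h1
    have h2 : 0 ≤ 2 ^ p / m * inner ℝ (pMap p a - pMap p b) (a - b) :=
      mul_nonneg (by positivity) (inner_pMap_sub_nonneg hp a b)
    rw [← h0]; linarith
  · set c := s ^ (1 / p) with hc
    have hc0 : 0 < c := Real.rpow_pos_of_pos h0 _
    have hcp : c ^ p = s := by rw [hc, ← Real.rpow_mul hs0, one_div_mul_cancel hp0.ne', Real.rpow_one]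
    have ea : ∀ x : E, x = c • (c⁻¹ • x) := fun x => by
      rw [smul_smul, mul_inv_cancel₀ hc0.ne', one_smul]
    have en : ∀ x : E, ‖c⁻¹ • x‖ ^ p = s⁻¹ * ‖x‖ ^ p := fun x => by
      rw [norm_smul, norm_inv, Real.norm_of_nonneg hc0.le, Real.mul_rpow (by positivity)
        (norm_nonneg _), Real.inv_rpow hc0.le, hcp]
    have key := hnorm (c⁻¹ • a) (c⁻¹ • b) (by rw [en, en, ← mul_add, ← hs, inv_mul_cancel₀ h0.ne'])
    rw [← smul_sub, en, pMap_smul (inv_pos.mpr hc0), pMap_smul (inv_pos.mpr hc0), ← smul_sub,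
      real_inner_smul_left, real_inner_smul_right, ← mul_assoc ((c⁻¹) ^ (p - 1)),
      ← Real.rpow_add_one (inv_pos.mpr hc0).ne', sub_add_cancel, Real.inv_rpow hc0.le, hcp] at key
    have := mul_le_mul_of_nonneg_left key hs0
    rw [← mul_assoc, mul_inv_cancel₀ h0.ne', one_mul] at this
    refine this.trans (le_of_eq ?_)
    field_simp

end Inequalities

end QuasilinearSchrodinger

namespace QuasilinearSchrodinger

variable {N : ℕ}

/-! ### Hölder estimates -/

section Holder

variable {α E F : Type*} [MeasurableSpace α] {ν : Measure α} [NormedAddCommGroup E]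
  [NormedAddCommGroup F]

theorem integrable_norm_rpow {p : ℝ} (hp : 0 < p) {f : α → E}
    (hf : MemLp f (ENNReal.ofReal p) ν) : Integrable (fun x => ‖f x‖ ^ p) ν := by
  have := hf.integrable_norm_rpow (by simpa using hp) ENNReal.ofReal_ne_top
  rwa [ENNReal.toReal_ofReal hp.le] at this

theorem memLp_of_integrable_norm_rpow {p : ℝ} (hp : 0 < p) {f : α → E}
    (hfm : AEStronglyMeasurable f ν) (hf : Integrable (fun x => ‖f x‖ ^ p) ν) :
    MemLp f (ENNReal.ofReal p) ν := by
  rw [← integrable_norm_rpow_iff hfm (by simpa using hp) ENNReal.ofReal_ne_top,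
    ENNReal.toReal_ofReal hp.le]
  exact hf

theorem eLpNorm_ofReal_eq {p : ℝ} (hp : 0 < p) {f : α → E} (hf : MemLp f (ENNReal.ofReal p) ν) :
    eLpNorm f (ENNReal.ofReal p) ν = ENNReal.ofReal ((∫ x, ‖f x‖ ^ p ∂ν) ^ (1 / p)) := by
  rw [hf.eLpNorm_eq_integral_rpow_norm (by simpa using hp) ENNReal.ofReal_ne_top,
    ENNReal.toReal_ofReal hp.le, one_div]

theorem integral_norm_rpow_nonneg {p : ℝ} (f : α → E) : 0 ≤ ∫ x, ‖f x‖ ^ p ∂ν :=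
  integral_nonneg fun x => by positivity

/-- A crude Young inequality: the left side is at most the `p`-th power of the larger number. -/
theorem rpow_sub_one_mul_le {p a b : ℝ} (hp : 1 < p) (ha : 0 ≤ a) (hb : 0 ≤ b) :
    a ^ (p - 1) * b ≤ a ^ p + b ^ p := by
  have hp1 : 0 < p - 1 := by linarith
  have e : ∀ c : ℝ, 0 ≤ c → c ^ (p - 1) * c = c ^ p := fun c hc => by
    rcases hc.eq_or_lt with rfl | hc
    · rw [mul_zero, Real.zero_rpow (by linarith)]
    · rw [← Real.rpow_add_one hc.ne']; congr 1; ring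
  rcases le_total a b with h | h
  · have : a ^ (p - 1) * b ≤ b ^ (p - 1) * b := by gcongr
    rw [e b hb] at this
    have := Real.rpow_nonneg ha p
    linarith
  · have : a ^ (p - 1) * b ≤ a ^ (p - 1) * a := by gcongr
    rw [e a ha] at this
    have := Real.rpow_nonneg hb p
    linarith

theorem integrable_rpow_sub_one_mul {p : ℝ} (hp : 1 < p) {f : α → E} {g : α → F}
    (hf : MemLp f (ENNReal.ofReal p) ν) (hg : MemLp g (ENNReal.ofReal p) ν) :
    Integrable (fun x => ‖f x‖ ^ (p - 1) * ‖g x‖) ν := by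
  have hp0 : 0 < p := by linarith
  refine ((integrable_norm_rpow hp0 hf).add (integrable_norm_rpow hp0 hg)).mono'
    ((hf.1.norm.aemeasurable.pow_const _).mul hg.1.norm.aemeasurable).aestronglyMeasurable
    (Eventually.of_forall fun x => ?_)
  rw [Real.norm_of_nonneg (by positivity)]
  exact rpow_sub_one_mul_le hp (norm_nonneg _) (norm_nonneg _)

/-- Hölder's inequality in the form used for `p`-Laplacian type terms. -/
theorem integral_rpow_sub_one_mul_le {p : ℝ} (hp : 1 < p) {f : α → E} {g : α → F}
    (hf : MemLp f (ENNReal.ofReal p) ν) (hg : MemLp g (ENNReal.ofReal p) ν) :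
    ∫ x, ‖f x‖ ^ (p - 1) * ‖g x‖ ∂ν
      ≤ (∫ x, ‖f x‖ ^ p ∂ν) ^ ((p - 1) / p) * (∫ x, ‖g x‖ ^ p ∂ν) ^ (1 / p) := by
  have hp0 : 0 < p := by linarith
  have hp1 : 0 < p - 1 := by linarith
  have hconj : (p / (p - 1)).HolderConjugate p := by
    have := (Real.HolderConjugate.conjExponent hp).symm
    rwa [Real.conjExponent] at this
  have e : ∀ x, (‖f x‖ ^ (p - 1)) ^ (p / (p - 1)) = ‖f x‖ ^ p := fun x => by
    rw [← Real.rpow_mul (norm_nonneg _), mul_div_cancel₀ _ hp1.ne']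
  have hfm : MemLp (fun x => ‖f x‖ ^ (p - 1)) (ENNReal.ofReal (p / (p - 1))) ν := by
    refine memLp_of_integrable_norm_rpow (by positivity)
      (hf.1.norm.aemeasurable.pow_const _).aestronglyMeasurable ?_
    refine (integrable_norm_rpow hp0 hf).congr (Eventually.of_forall fun x => ?_)
    simp only
    rw [Real.norm_of_nonneg (by positivity), e]
  have := integral_mul_le_Lp_mul_Lq_of_nonneg hconj
    (Eventually.of_forall fun x => by positivity) (Eventually.of_forall fun x => norm_nonneg (g x))
    hfm hg.norm
  simp_rw [e] at this
  rwa [one_div_div] at this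

theorem tendsto_integral_norm_smul_rpow [NormedSpace ℝ E] {p : ℝ} (hp : 0 < p) {c : ℕ → α → ℝ}
    {C : ℝ} (hcm : ∀ j, AEMeasurable (c j) ν) (hcC : ∀ j, ∀ᵐ x ∂ν, |c j x| ≤ C)
    (hc : ∀ᵐ x ∂ν, Tendsto (fun j => c j x) atTop (𝓝 0)) {f : α → E}
    (hf : MemLp f (ENNReal.ofReal p) ν) :
    Tendsto (fun j => ∫ x, ‖c j x • f x‖ ^ p ∂ν) atTop (𝓝 0) := by
  have h0 : ∫ x, (0 : ℝ) ∂ν = 0 := integral_zero _ _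
  rw [← h0]
  refine tendsto_integral_of_dominated_convergence (fun x => C ^ p * ‖f x‖ ^ p) (fun j => ?_)
    ((integrable_norm_rpow hp hf).const_mul _) (fun j => ?_) ?_
  · exact (((hcm j).aestronglyMeasurable.smul hf.1).norm.aemeasurable.pow_const
      _).aestronglyMeasurable
  · filter_upwards [hcC j] with x hx
    have hC : 0 ≤ C := (abs_nonneg _).trans hx
    rw [Real.norm_of_nonneg (by positivity), norm_smul, ← Real.mul_rpow hC (norm_nonneg _)]
    exact Real.rpow_le_rpow (by positivity) (mul_le_mul_of_nonneg_right hx (norm_nonneg _)) hp.le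
  · filter_upwards [hc] with x hx
    have h1 : Tendsto (fun j => ‖c j x • f x‖) atTop (𝓝 0) := by
      have := (hx.smul_const (f x)).norm
      rwa [zero_smul, norm_zero] at this
    have h2 := h1.rpow_const (p := p) (Or.inr hp.le)
    rwa [Real.zero_rpow hp.ne'] at h2

/-- The coefficient is attached to the fixed function: `c_j f → 0` in `L^p` by dominated
convergence, while the factor with `w_j` stays bounded by Hölder. -/
theorem tendsto_integral_coeff_mul_rpow_mul [NormedSpace ℝ F] {p : ℝ} (hp : 1 < p)
    {c : ℕ → α → ℝ} {C : ℝ} (hcm : ∀ j, AEMeasurable (c j) ν) (hcC : ∀ j, ∀ᵐ x ∂ν, |c j x| ≤ C)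
    (hc : ∀ᵐ x ∂ν, Tendsto (fun j => c j x) atTop (𝓝 0)) {f : α → F}
    (hf : MemLp f (ENNReal.ofReal p) ν) {w : ℕ → α → E} {B : ℝ}
    (hw : ∀ j, MemLp (w j) (ENNReal.ofReal p) ν) (hwB : ∀ j, ∫ x, ‖w j x‖ ^ p ∂ν ≤ B) :
    Tendsto (fun j => ∫ x, |c j x| * (‖w j x‖ ^ (p - 1) * ‖f x‖) ∂ν) atTop (𝓝 0) := by
  have hp0 : 0 < p := by linarith
  have hcf : ∀ j, MemLp (fun x => c j x • f x) (ENNReal.ofReal p) ν := fun j => by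
    refine hf.of_le_mul (c := C) ((hcm j).aestronglyMeasurable.smul hf.1) ?_
    filter_upwards [hcC j] with x hx
    rw [norm_smul]
    exact mul_le_mul_of_nonneg_right hx (norm_nonneg _)
  have t := (tendsto_integral_norm_smul_rpow hp0 hcm hcC hc hf).rpow_const (p := 1 / p)
    (Or.inr (by positivity))
  rw [Real.zero_rpow (by positivity)] at t
  have t2 := t.const_mul (B ^ ((p - 1) / p))
  rw [mul_zero] at t2
  refine tendsto_of_tendsto_of_tendsto_of_le_of_le tendsto_const_nhds t2
    (fun j => integral_nonneg fun x => by positivity) fun j => ?_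
  have e : ∀ x, |c j x| * (‖w j x‖ ^ (p - 1) * ‖f x‖) = ‖w j x‖ ^ (p - 1) * ‖c j x • f x‖ :=
    fun x => by rw [norm_smul, Real.norm_eq_abs]; ring
  simp_rw [e]
  refine (integral_rpow_sub_one_mul_le hp (hw j) (hcf j)).trans ?_
  refine mul_le_mul_of_nonneg_right ?_ (Real.rpow_nonneg (integral_norm_rpow_nonneg _) _)
  exact Real.rpow_le_rpow (integral_norm_rpow_nonneg _) (hwB j)
    (div_nonneg (by linarith) hp0.le)

theorem tendsto_integral_coeff_mul_mul [NormedSpace ℝ F] {p : ℝ} (hp : 1 < p)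
    {c : ℕ → α → ℝ} {C : ℝ} (hcm : ∀ j, AEMeasurable (c j) ν) (hcC : ∀ j, ∀ᵐ x ∂ν, |c j x| ≤ C)
    (hc : ∀ᵐ x ∂ν, Tendsto (fun j => c j x) atTop (𝓝 0)) {f : α → F}
    (hf : MemLp f (ENNReal.ofReal p) ν) {w : ℕ → α → E} {B : ℝ}
    (hw : ∀ j, MemLp (w j) (ENNReal.ofReal p) ν) (hwB : ∀ j, ∫ x, ‖w j x‖ ^ p ∂ν ≤ B) :
    Tendsto (fun j => ∫ x, |c j x| * (‖f x‖ ^ (p - 1) * ‖w j x‖) ∂ν) atTop (𝓝 0) := by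
  have hp0 : 0 < p := by linarith
  have hp1 : 0 < p - 1 := by linarith
  -- Here `f` enters with power `p - 1`, so its coefficient must be a `(p - 1)`-th root to reproduce
  -- `|c j x|`.
  set d : ℕ → α → ℝ := fun j x => |c j x| ^ (1 / (p - 1)) with hd
  have hdm : ∀ j, AEMeasurable (d j) ν := fun j => by
    have := hcm j
    simp only [hd]
    fun_prop
  have hdC : ∀ j, ∀ᵐ x ∂ν, |d j x| ≤ C ^ (1 / (p - 1)) := fun j => by
    filter_upwards [hcC j] with x hx
    simp only [hd]
    rw [abs_of_nonneg (by positivity)]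
    exact Real.rpow_le_rpow (abs_nonneg _) hx (by positivity)
  have hdt : ∀ᵐ x ∂ν, Tendsto (fun j => d j x) atTop (𝓝 0) := by
    filter_upwards [hc] with x hx
    have h1 := hx.abs.rpow_const (p := 1 / (p - 1)) (Or.inr (by positivity))
    rwa [abs_zero, Real.zero_rpow (by positivity)] at h1
  have hcf : ∀ j, MemLp (fun x => d j x • f x) (ENNReal.ofReal p) ν := fun j => by
    refine hf.of_le_mul (c := C ^ (1 / (p - 1))) ((hdm j).aestronglyMeasurable.smul hf.1) ?_
    filter_upwards [hdC j] with x hx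
    rw [norm_smul]
    exact mul_le_mul_of_nonneg_right hx (norm_nonneg _)
  have t := (tendsto_integral_norm_smul_rpow hp0 hdm hdC hdt hf).rpow_const (p := (p - 1) / p)
    (Or.inr (by positivity))
  rw [Real.zero_rpow (by positivity)] at t
  have t2 := t.mul_const (B ^ (1 / p))
  rw [zero_mul] at t2
  refine tendsto_of_tendsto_of_tendsto_of_le_of_le tendsto_const_nhds t2
    (fun j => integral_nonneg fun x => by positivity) fun j => ?_
  have e : ∀ x, |c j x| * (‖f x‖ ^ (p - 1) * ‖w j x‖) = ‖d j x • f x‖ ^ (p - 1) * ‖w j x‖ :=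
    fun x => by
      have h1 : ‖d j x‖ ^ (p - 1) = |c j x| := by
        simp only [hd]
        rw [Real.norm_of_nonneg (by positivity), ← Real.rpow_mul (abs_nonneg _),
          one_div_mul_cancel hp1.ne', Real.rpow_one]
      rw [norm_smul, Real.mul_rpow (norm_nonneg _) (norm_nonneg _), h1, mul_assoc]
  simp_rw [e]
  refine (integral_rpow_sub_one_mul_le hp (hcf j) (hw j)).trans ?_
  refine mul_le_mul_of_nonneg_left ?_ (Real.rpow_nonneg (integral_norm_rpow_nonneg _) _)
  exact Real.rpow_le_rpow (integral_norm_rpow_nonneg _) (hwB j) (by positivity)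

end Holder

end QuasilinearSchrodinger

namespace QuasilinearSchrodinger

variable {N : ℕ}

/-! ### Moser iteration -/

/-- In logarithms the recursion is affine with ratio `χ`, and its solutions grow like `χ^n`. The
point is that `D` depends only on `χ`, `K`, `B`, not on the sequence. -/
theorem exists_le_exp_of_superlinear_recursion {χ K : ℝ} (hχ : 1 < χ) (hK : 1 ≤ K) (B : ℝ) :
    ∃ D : ℝ, ∀ a : ℕ → ℝ, (∀ n, 1 ≤ a n) → a 0 ≤ B → (∀ n, a (n + 1) ≤ (K * χ ^ n * a n) ^ χ) →
      ∀ n, a n ≤ Real.exp (D * χ ^ n) := by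
  set c := Real.log χ with hc
  set c' := Real.log K with hc'
  have hc0 : 0 < c := Real.log_pos hχ
  have hc'0 : 0 ≤ c' := Real.log_nonneg hK
  have hχ1 : 0 < χ - 1 := by linarith
  -- `-αn - β` is the particular solution of the affine recursion for the logarithms.
  set α := χ * c / (χ - 1) with hα
  set β := (χ * c' + α) / (χ - 1) with hβ
  have eα : α * (χ - 1) = χ * c := div_mul_cancel₀ _ hχ1.ne'
  have eβ : β * (χ - 1) = χ * c' + α := div_mul_cancel₀ _ hχ1.ne'
  have hα0 : 0 ≤ α := by positivity
  have hβ0 : 0 ≤ β := by positivity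
  refine ⟨Real.log B + β, fun a ha h0 hrec n => ?_⟩
  have key : ∀ n : ℕ, Real.log (a n) ≤ (Real.log B + β) * χ ^ n - α * n - β := fun n => by
    induction n with
    | zero =>
      have := Real.log_le_log (by linarith [ha 0]) h0
      simp; linarith
    | succ n ih =>
      have han : 0 < a n := by linarith [ha n]
      have h1 := Real.log_le_log (by linarith [ha (n + 1)]) (hrec n)
      have hp : 0 < K * χ ^ n := by positivity
      rw [Real.log_rpow (by positivity), Real.log_mul hp.ne' han.ne',
        Real.log_mul (by positivity) (by positivity), Real.log_pow, ← hc, ← hc'] at h1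
      have h2 : χ * (c' + n * c + Real.log (a n))
          ≤ χ * (c' + n * c + ((Real.log B + β) * χ ^ n - α * n - β)) := by gcongr
      refine h1.trans (h2.trans (le_of_eq ?_))
      rw [pow_succ]
      push_cast
      linear_combination (-(n : ℝ)) * eα - eβ
  have h1 := key n
  have h2 : 0 ≤ α * n := by positivity
  rw [← Real.log_le_iff_le_exp (by linarith [ha n])]
  linarith

/-- Moser iteration. By `hrel` the exponent map fixes `q - f₀` and multiplies distances from it by
`χ`, so starting at `q` the `n`-th exponent is `q - f₀ + χ^n f₀`. The integrals grow at most like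
`exp(D χ^n)`, and Chebyshev's inequality at a high enough level `T` beats this growth. -/
theorem exists_bound_of_reverse_holder {α : Type*} [MeasurableSpace α] {ν : Measure α}
    {χ K B p q f₀ : ℝ} (hχ : 1 < χ) (hK : 1 ≤ K) (hB : 0 ≤ B) (hp : 0 < p) (hpq : p ≤ q)
    (hf₀ : 0 < f₀) (hf₀q : f₀ ≤ q) (hrel : χ * (1 + q - q / p - f₀) = q - f₀) :
    ∃ T : ℝ, 0 ≤ T ∧ ∀ u : α → ℝ, (∀ e, p ≤ e → Integrable (fun x => |u x| ^ e) ν) →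
      ∫ x, |u x| ^ p ∂ν ≤ B → ∫ x, |u x| ^ q ∂ν ≤ B →
      (∀ s, 0 ≤ s → (∫ x, |u x| ^ (χ * (1 + s + q - q / p)) ∂ν)
        ≤ (K * (1 + s) * ((∫ x, |u x| ^ (p + s) ∂ν) + ∫ x, |u x| ^ (q + s) ∂ν)) ^ χ) →
      ∀ᵐ x ∂ν, |u x| ≤ T := by
  obtain ⟨D, hD⟩ := exists_le_exp_of_superlinear_recursion hχ (K := 4 * K * (1 + f₀))
    (by nlinarith) (B + B + 1)
  have hχ0 : 0 < χ := by linarith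
  have hD1 : 0 < |D| + 1 := by positivity
  -- Since the `n`-th exponent is at least `χ^n f₀`, the power of `T` in Chebyshev's inequality is
  -- at least `exp((|D| + 1)χ^n)`, which exceeds the integral by the factor `exp(χ^n)`.
  set T := Real.exp ((|D| + 1) / f₀) with hT
  have hT0 : 0 < T := Real.exp_pos _
  refine ⟨T, hT0.le, fun u hint hup huq hH => ?_⟩
  set s : ℕ → ℝ := fun n => (χ ^ n - 1) * f₀ with hs
  have hχn : ∀ n : ℕ, 1 ≤ χ ^ n := fun n => one_le_pow₀ hχ.le
  have hs0 : ∀ n, 0 ≤ s n := fun n => mul_nonneg (by linarith [hχn n]) hf₀.le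
  have hes : ∀ n, χ * (1 + s n + q - q / p) = q + s (n + 1) := fun n => by
    simp only [hs]
    rw [pow_succ]
    linear_combination hrel
  -- The summand `B` absorbs the integral of `|u|^{p+s}`, as `|u|^{p+s} ≤ |u|^p + |u|^{q+s}`; the
  -- summand `1` makes powers monotone in the exponent.
  set a : ℕ → ℝ := fun n => (∫ x, |u x| ^ (q + s n) ∂ν) + B + 1 with ha
  have hnn : ∀ e : ℝ, 0 ≤ ∫ x, |u x| ^ e ∂ν := fun e => integral_nonneg fun x => by positivity
  have ha1 : ∀ n, 1 ≤ a n := fun n => by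
    have := hnn (q + s n); simp only [ha]; linarith
  have key := hD a ha1 ?_ ?_
  rotate_left
  · simp only [ha, hs, pow_zero, sub_self, zero_mul, add_zero]; linarith
  · intro n
    have h1 := hH (s n) (hs0 n)
    rw [hes] at h1
    have h2 : ∫ x, |u x| ^ (p + s n) ∂ν ≤ B + ∫ x, |u x| ^ (q + s n) ∂ν := by
      have : ∫ x, |u x| ^ (p + s n) ∂ν ≤ ∫ x, (|u x| ^ p + |u x| ^ (q + s n)) ∂ν := by
        refine integral_mono (hint _ (by linarith [hs0 n])) ((hint _ le_rfl).add
          (hint _ (by linarith [hs0 n]))) fun x => ?_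
        simp only
        have hx := abs_nonneg (u x)
        have n1 : 0 ≤ |u x| ^ p := by positivity
        have n2 : 0 ≤ |u x| ^ (q + s n) := by positivity
        rcases le_total |u x| 1 with h | h
        · rcases hx.eq_or_lt with h0 | h0
          · rw [← h0, Real.zero_rpow (by have := hs0 n; positivity)]; rw [← h0] at n1 n2; linarith
          · have := Real.rpow_le_rpow_of_exponent_ge h0 h (show p ≤ p + s n by linarith [hs0 n])
            linarith
        · have := Real.rpow_le_rpow_of_exponent_le h (show p + s n ≤ q + s n by linarith)
          linarith
      rw [integral_add (hint _ le_rfl) (hint _ (by linarith [hs0 n]))] at this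
      linarith
    have han := ha1 n
    have hsn := hs0 n
    have h3 : ∫ x, |u x| ^ (q + s (n + 1)) ∂ν ≤ (2 * K * (1 + s n) * a n) ^ χ := by
      refine h1.trans (Real.rpow_le_rpow ?_ ?_ hχ0.le)
      · have := hnn (p + s n)
        have := hnn (q + s n)
        positivity
      · have : (∫ x, |u x| ^ (p + s n) ∂ν) + ∫ x, |u x| ^ (q + s n) ∂ν ≤ 2 * a n := by
          simp only [ha]; linarith [hnn (q + s n)]
        calc _ ≤ K * (1 + s n) * (2 * a n) := by gcongr
          _ = _ := by ring
    have h4 : 1 ≤ 2 * K * (1 + s n) := by nlinarith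
    have h5 : a n ≤ (2 * K * (1 + s n) * a n) ^ χ := by
      have e1 : a n ≤ 2 * K * (1 + s n) * a n := le_mul_of_one_le_left (by linarith) h4
      have e2 : (1 : ℝ) ≤ 2 * K * (1 + s n) * a n := han.trans e1
      exact e1.trans (Real.self_le_rpow_of_one_le e2 hχ.le)
    have h6 : a (n + 1) ≤ 2 * (2 * K * (1 + s n) * a n) ^ χ := by
      have : B + 1 ≤ a n := by simp only [ha]; linarith [hnn (q + s n)]
      simp only [ha] at *
      linarith
    refine h6.trans ?_
    have h7 : (2 : ℝ) ≤ 2 ^ χ := Real.self_le_rpow_of_one_le (by norm_num) hχ.le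
    calc 2 * (2 * K * (1 + s n) * a n) ^ χ ≤ 2 ^ χ * (2 * K * (1 + s n) * a n) ^ χ := by gcongr
      _ = (4 * K * (1 + s n) * a n) ^ χ := by
        rw [← Real.mul_rpow (by norm_num) (by positivity)]; congr 1; ring
      _ ≤ (4 * K * (1 + f₀) * χ ^ n * a n) ^ χ := by
        refine Real.rpow_le_rpow (by positivity) ?_ hχ0.le
        have : 1 + s n ≤ (1 + f₀) * χ ^ n := by
          simp only [hs]; nlinarith [hχn n]
        rw [mul_assoc (4 * K) (1 + f₀)]
        gcongr
  have hmeas : ∀ n : ℕ, ν.real {x | T ≤ |u x|} ≤ Real.exp (-(χ ^ n)) := fun n => by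
    have hen : p ≤ q + s n := by linarith [hs0 n]
    have hen0 : 0 < q + s n := by linarith
    have hTe : 0 < T ^ (q + s n) := Real.rpow_pos_of_pos hT0 _
    have h1 := mul_meas_ge_le_integral_of_nonneg
      (Eventually.of_forall fun x => (by positivity : 0 ≤ |u x| ^ (q + s n))) (hint _ hen)
      (T ^ (q + s n))
    have h2 : {x | T ^ (q + s n) ≤ |u x| ^ (q + s n)} = {x | T ≤ |u x|} := by
      ext x
      exact Real.rpow_le_rpow_iff hT0.le (abs_nonneg _) hen0
    rw [h2] at h1
    have h3 : ∫ x, |u x| ^ (q + s n) ∂ν ≤ Real.exp (D * χ ^ n) := by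
      refine le_trans ?_ (key n)
      simp only [ha]; linarith
    have h4 : Real.exp ((|D| + 1) * χ ^ n) ≤ T ^ (q + s n) := by
      rw [hT, ← Real.exp_mul, Real.exp_le_exp, div_mul_eq_mul_div, le_div_iff₀ hf₀, mul_assoc]
      refine mul_le_mul_of_nonneg_left ?_ hD1.le
      simp only [hs]; linarith
    have h5 : Real.exp ((|D| + 1) * χ ^ n) * ν.real {x | T ≤ |u x|} ≤ Real.exp (D * χ ^ n) :=
      (mul_le_mul_of_nonneg_right h4 measureReal_nonneg).trans (h1.trans h3)
    rw [mul_comm, ← le_div_iff₀ (Real.exp_pos _), ← Real.exp_sub] at h5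
    refine h5.trans (Real.exp_le_exp.mpr ?_)
    have := le_abs_self D
    nlinarith [hχn n]
  -- Needed because `ν.real` takes the value 0 on sets of infinite measure.
  have hfin : ν {x | T ≤ |u x|} ≠ ⊤ := by
    have h2 : {x | T ^ p ≤ |u x| ^ p} = {x | T ≤ |u x|} := by
      ext x
      exact Real.rpow_le_rpow_iff hT0.le (abs_nonneg _) hp
    have := (hint p le_rfl).measure_norm_ge_lt_top (Real.rpow_pos_of_pos hT0 p)
    rw [← h2]
    refine ne_of_lt (lt_of_le_of_lt (measure_mono fun x hx => ?_) this)
    simp only [Set.mem_ofPred_eq] at hx ⊢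
    rwa [Real.norm_of_nonneg (by positivity)]
  have hlim : Tendsto (fun n : ℕ => Real.exp (-(χ ^ n))) atTop (𝓝 0) :=
    Real.tendsto_exp_neg_atTop_nhds_zero.comp (tendsto_pow_atTop_atTop_of_one_lt hχ)
  have h0 : ν.real {x | T ≤ |u x|} ≤ 0 := ge_of_tendsto' hlim hmeas
  have h1 : ν {x | T ≤ |u x|} = 0 := by
    have h2 : ν.real {x | T ≤ |u x|} = 0 := le_antisymm h0 measureReal_nonneg
    rwa [measureReal_eq_zero_iff hfin] at h2
  rw [ae_iff]
  refine measure_mono_null (fun x hx => ?_) h1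
  simp only [Set.mem_ofPred_eq, not_le] at hx ⊢
  exact hx.le

/-! ### The Sobolev inequality of exponent one -/

/-- The Gagliardo–Nirenberg–Sobolev inequality for test functions passes to `W_0^{1,p}` by Fatou
along an almost everywhere convergent approximation. The exponent 1 suffices for the iteration
whatever `p` is, and `C` depends neither on `p` nor on the radius. -/
theorem exists_sobolev_one (hN : 2 ≤ N) : ∃ C : ℝ, 0 ≤ C ∧ ∀ (p : ℝ) (k : ℝ) (w : RN N → ℝ), 1 ≤ p →
    MemW0 p (Metric.ball 0 k) w →
    eLpNorm w (ENNReal.ofReal (N / (N - 1))) volume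
      ≤ ENNReal.ofReal C * ∫⁻ x in Metric.ball 0 k, ‖weakGrad w x‖ₑ := by
  have hN1 : (1 : ℝ) < N := by exact_mod_cast hN
  set χ : NNReal := Real.toNNReal ((N : ℝ) / (N - 1)) with hχ
  have hχ' : (χ : ℝ≥0∞) = ENNReal.ofReal (N / (N - 1)) := rfl
  have hconj : NNReal.HolderConjugate (Module.finrank ℝ (RN N)) χ := by
    rw [finrank_euclideanSpace_fin, ← NNReal.holderConjugate_coe_iff, hχ, Real.coe_toNNReal _
      (div_nonneg (by linarith) (by linarith))]
    have := Real.HolderConjugate.conjExponent hN1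
    simpa [Real.conjExponent] using this
  set C := eLpNormLESNormFDerivOneConst (volume : Measure (RN N)) χ with hC
  refine ⟨C, C.2, fun p k w hp hw => ?_⟩
  have hp0 : 0 < p := by linarith
  have hp1 : (1 : ℝ≥0∞) ≤ ENNReal.ofReal p := by
    rw [← ENNReal.ofReal_one]; exact ENNReal.ofReal_le_ofReal hp
  obtain ⟨φ, h1, h2, -, t2, hae⟩ := hw.exists_seq hp0
  rw [ENNReal.ofReal_coe_nnreal, ← hχ']
  set I := ∫⁻ x in Metric.ball 0 k, ‖weakGrad w x‖ₑ with hI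
  -- The Hölder factor from `L^p` to `L^1` on the ball. It multiplies only an error tending to zero,
  -- so finiteness is all that matters and it does not enter the constant.
  set M : ℝ≥0∞ := volume (Metric.ball (0 : RN N) k) ^
    (1 / (1 : ℝ≥0∞).toReal - 1 / (ENNReal.ofReal p).toReal) with hM
  have hMfin : M ≠ ⊤ := by
    refine ENNReal.rpow_ne_top_of_nonneg ?_ measure_ball_lt_top.ne
    rw [ENNReal.toReal_one, ENNReal.toReal_ofReal hp0.le, sub_nonneg]
    exact one_div_le_one_div_of_le one_pos hp
  have hb : ∀ n, eLpNorm (φ n) χ volume ≤ C * (I + eLpNorm (fun x => weakGrad w x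
      - gradient (φ n) x) (ENNReal.ofReal p) volume * M) := fun n => by
    refine (eLpNorm_le_eLpNorm_fderiv_one volume (h1 n).contDiff_one (h1 n).2 hconj).trans ?_
    refine mul_le_mul_right ?_ _
    have e1 : eLpNorm (fderiv ℝ (φ n)) 1 volume
        = ∫⁻ x in Metric.ball 0 k, ‖gradient (φ n) x‖ₑ := by
      rw [eLpNorm_one_eq_lintegral_enorm]
      have e2 : ∀ x, ‖fderiv ℝ (φ n) x‖ₑ = ‖gradient (φ n) x‖ₑ := fun x => by
        rw [← ofReal_norm, ← ofReal_norm, norm_gradient_eq]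
      simp_rw [e2]
      rw [setLIntegral_eq_of_support_subset]
      intro x hx
      by_contra hx'
      refine hx ?_
      simp only
      rw [gradient_eq_zero_of_notMem_tsupport (fun h => hx' (h2 n h)), enorm_zero]
    rw [e1]
    calc ∫⁻ x in Metric.ball 0 k, ‖gradient (φ n) x‖ₑ
        ≤ ∫⁻ x in Metric.ball 0 k, (‖weakGrad w x‖ₑ + ‖weakGrad w x - gradient (φ n) x‖ₑ) := by
          refine lintegral_mono fun x => ?_
          have : gradient (φ n) x = weakGrad w x - (weakGrad w x - gradient (φ n) x) := by abel
          conv_lhs => rw [this]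
          exact enorm_sub_le
      _ = I + ∫⁻ x in Metric.ball 0 k, ‖weakGrad w x - gradient (φ n) x‖ₑ :=
          lintegral_add_left' hw.1.2.2.1.enorm.restrict _
      _ ≤ _ := by
          refine add_le_add le_rfl ?_
          have hm : AEStronglyMeasurable (fun x => weakGrad w x - gradient (φ n) x) volume :=
            hw.1.2.2.1.sub (h1 n).continuous_gradient.aestronglyMeasurable
          have := eLpNorm_le_eLpNorm_mul_rpow_measure_univ hp1
            (hm.restrict (s := Metric.ball 0 k))
          rw [eLpNorm_one_eq_lintegral_enorm, Measure.restrict_apply_univ] at this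
          refine this.trans ?_
          gcongr
          exact Measure.restrict_le_self
  have hlim : Tendsto (fun n => C * (I + eLpNorm (fun x => weakGrad w x
      - gradient (φ n) x) (ENNReal.ofReal p) volume * M)) atTop (𝓝 (C * (I + 0 * M))) :=
    ENNReal.Tendsto.const_mul (tendsto_const_nhds.add
      (ENNReal.Tendsto.mul_const t2 (Or.inr hMfin))) (Or.inr ENNReal.coe_ne_top)
  rw [zero_mul, add_zero] at hlim
  refine (Lp.eLpNorm_lim_le_liminf_eLpNorm (fun n => (h1 n).continuous.aestronglyMeasurable)
    w hae).trans ?_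
  rw [← hlim.liminf_eq]
  exact liminf_le_liminf (Eventually.of_forall hb)

end QuasilinearSchrodinger

namespace QuasilinearSchrodinger

variable {N : ℕ}

/-! ### Regularised powers -/

/-- The weight `(t² + ε)^{s/2}`, a smooth substitute for `|t|^s`. -/
noncomputable def regWeight (ε s t : ℝ) : ℝ := (t ^ 2 + ε) ^ (s / 2)

/-- The smooth odd function `t (t² + ε)^{s/2}`, a substitute for `t |t|^s`. -/
noncomputable def regPow (ε s t : ℝ) : ℝ := t * regWeight ε s t

section Reg

variable {ε s : ℝ}

theorem regWeight_pos (hε : 0 < ε) (s t : ℝ) : 0 < regWeight ε s t :=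
  Real.rpow_pos_of_pos (by positivity) _

theorem contDiff_regWeight (hε : 0 < ε) (s : ℝ) : ContDiff ℝ ∞ (regWeight ε s) := by
  rw [contDiff_iff_contDiffAt]
  intro t
  have h1 : ContDiffAt ℝ ∞ (fun t : ℝ => t ^ 2 + ε) t :=
    ((contDiff_id.pow 2).add contDiff_const).contDiffAt
  exact h1.rpow_const_of_ne (by positivity)

theorem contDiff_regPow (hε : 0 < ε) (s : ℝ) : ContDiff ℝ ∞ (regPow ε s) :=
  contDiff_id.mul (contDiff_regWeight hε s)

theorem regPow_zero (ε s : ℝ) : regPow ε s 0 = 0 := by simp [regPow]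

theorem abs_rpow_le_regWeight (hε : 0 < ε) (hs : 0 ≤ s) (t : ℝ) : |t| ^ s ≤ regWeight ε s t := by
  have : |t| ^ s = (t ^ 2) ^ (s / 2) := by
    rw [← sq_abs, ← Real.rpow_natCast, ← Real.rpow_mul (abs_nonneg _)]; congr 1; push_cast; ring
  rw [this]
  exact Real.rpow_le_rpow (by positivity) (by linarith) (by positivity)

theorem regWeight_zero (s t : ℝ) : regWeight 0 s t = |t| ^ s := by
  rw [regWeight, add_zero, ← sq_abs, ← Real.rpow_natCast, ← Real.rpow_mul (abs_nonneg _)]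
  congr 1; push_cast; ring

theorem regWeight_le (hε : 0 < ε) (hε1 : ε ≤ 1) (hs : 0 ≤ s) {t T : ℝ} (ht : |t| ≤ T) :
    regWeight ε s t ≤ (T ^ 2 + 1) ^ (s / 2) := by
  refine Real.rpow_le_rpow (by positivity) ?_ (by positivity)
  have := (sq_abs t).symm.le.trans (pow_le_pow_left₀ (abs_nonneg t) ht 2)
  linarith

theorem abs_regWeight (hε : 0 < ε) (s t : ℝ) : |regWeight ε s t| = regWeight ε s t :=
  abs_of_pos (regWeight_pos hε s t)

theorem abs_regPow (hε : 0 < ε) (s t : ℝ) : |regPow ε s t| = |t| * regWeight ε s t := by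
  rw [regPow, abs_mul, abs_regWeight hε]

theorem regWeight_add (hε : 0 < ε) (r s t : ℝ) :
    regWeight ε (r + s) t = regWeight ε r t * regWeight ε s t := by
  rw [regWeight, regWeight, regWeight, ← Real.rpow_add (by positivity)]; congr 1; ring

theorem regWeight_rpow (hε : 0 < ε) (s r t : ℝ) :
    regWeight ε s t ^ r = regWeight ε (s * r) t := by
  rw [regWeight, regWeight, ← Real.rpow_mul (by positivity)]; congr 1; ring

/-- The sign of the excess `r` lets the energy estimate discard it; its upper bound gives the factor
`1 + s` in the gradient of `regPow`. -/
theorem exists_deriv_regPow (hε : 0 < ε) (hs : 0 ≤ s) (t : ℝ) : ∃ r : ℝ, 0 ≤ r ∧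
    r ≤ s * regWeight ε s t ∧ deriv (regPow ε s) t = regWeight ε s t + r := by
  have hpos : 0 < t ^ 2 + ε := by positivity
  have h1 : HasDerivAt (fun t : ℝ => t ^ 2 + ε) (2 * t) t := by
    simpa using ((hasDerivAt_id t).pow 2).add_const ε
  have h2 : HasDerivAt (regWeight ε s) (2 * t * (s / 2) * (t ^ 2 + ε) ^ (s / 2 - 1)) t :=
    h1.rpow_const (Or.inl hpos.ne')
  have h3 : HasDerivAt (regPow ε s)
      (1 * regWeight ε s t + t * (2 * t * (s / 2) * (t ^ 2 + ε) ^ (s / 2 - 1))) t :=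
    (hasDerivAt_id t).mul h2
  have e : regWeight ε s t = (t ^ 2 + ε) ^ (s / 2 - 1) * (t ^ 2 + ε) := by
    rw [regWeight, ← Real.rpow_add_one hpos.ne']; congr 1; ring
  have hq : 0 ≤ (t ^ 2 + ε) ^ (s / 2 - 1) := by positivity
  refine ⟨s * (t ^ 2 * (t ^ 2 + ε) ^ (s / 2 - 1)), by positivity, ?_, ?_⟩
  · refine mul_le_mul_of_nonneg_left ?_ hs
    rw [e]
    nlinarith [mul_nonneg hq hε.le]
  · rw [h3.deriv]; ring

theorem tendsto_regWeight (hs : 0 ≤ s) (t : ℝ) :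
    Tendsto (fun n : ℕ => regWeight (1 / ((n : ℝ) + 1)) s t) atTop (𝓝 (|t| ^ s)) := by
  rw [← regWeight_zero s]
  have h1 : Tendsto (fun n : ℕ => t ^ 2 + 1 / ((n : ℝ) + 1)) atTop (𝓝 (t ^ 2 + 0)) :=
    tendsto_const_nhds.add tendsto_one_div_add_atTop_nhds_zero_nat
  exact h1.rpow_const (Or.inr (by positivity))

end Reg

/-! ### Standing assumptions -/

/-- The part of the assumptions on `V`, `A`, `g` which makes `J` and `dJ` well defined. -/
structure Admissible (p q a₁ a₂ : ℝ) (V : RN N → ℝ) (A g : RN N → ℝ → ℝ) : Prop where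
  one_lt : 1 < p
  measV : AEMeasurable V
  nonnegV : ∀ᵐ x, 0 ≤ V x
  locBddV : ∀ ρ : ℝ, 0 < ρ → ∃ C : ℝ, 0 < C ∧ ∀ᵐ x, ‖x‖ ≤ ρ → V x ≤ C
  caraA : IsCaratheodory 1 A
  bddA : ∀ ρ : ℝ, 0 < ρ →
      (∃ C : ℝ, ∀ᵐ x, ∀ t : ℝ, |t| ≤ ρ → |A x t| ≤ C) ∧
      (∃ C : ℝ, ∀ᵐ x, ∀ t : ℝ, |t| ≤ ρ → |partialT A x t| ≤ C)
  caraG : IsCaratheodory 0 g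
  a₁_nonneg : 0 ≤ a₁
  a₂_nonneg : 0 ≤ a₂
  le_q : p ≤ q
  growth : ∀ᵐ x, ∀ t : ℝ, |g x t| ≤ a₁ * |t| ^ (p - 1) + a₂ * |t| ^ (q - 1)

theorem integrable_bdd_mul {α : Type*} [MeasurableSpace α] {ν : Measure α} {c f : α → ℝ} {C : ℝ}
    (hc : AEMeasurable c ν) (hC : ∀ᵐ x ∂ν, |c x| ≤ C) (hf : Integrable f ν) :
    Integrable (fun x => c x * f x) ν :=
  hf.bdd_mul hc.aestronglyMeasurable hC

theorem integrable_abs_rpow_of_bounded {α : Type*} [MeasurableSpace α] {ν : Measure α} {u : α → ℝ}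
    {p e T : ℝ} (hp : 0 < p) (he : p ≤ e) (hu : MemLp u (ENNReal.ofReal p) ν)
    (hT : ∀ᵐ x ∂ν, |u x| ≤ T) : Integrable (fun x => |u x| ^ e) ν := by
  have h1 := integrable_norm_rpow hp hu
  have hm : AEMeasurable (fun x => |u x| ^ (e - p)) ν := by
    have := hu.1.aemeasurable
    fun_prop
  have h2 : ∀ᵐ x ∂ν, |(fun x => |u x| ^ (e - p)) x| ≤ T ^ (e - p) := by
    filter_upwards [hT] with x hx
    rw [abs_of_nonneg (by positivity)]
    exact Real.rpow_le_rpow (abs_nonneg _) hx (by linarith)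
  refine (integrable_bdd_mul hm h2 h1).congr (Eventually.of_forall fun x => ?_)
  simp only [Real.norm_eq_abs]
  rw [← Real.rpow_add_of_nonneg (abs_nonneg _) (by linarith) hp.le, sub_add_cancel]

namespace Admissible

variable {p q a₁ a₂ : ℝ} {V : RN N → ℝ} {A g : RN N → ℝ → ℝ}

theorem pos (H : Admissible p q a₁ a₂ V A g) : 0 < p := by linarith [H.one_lt]

theorem exists_bound_A (H : Admissible p q a₁ a₂ V A g) (T : ℝ) :
    ∃ C : ℝ, 0 ≤ C ∧ ∀ᵐ x, ∀ t : ℝ, |t| ≤ T → |A x t| ≤ C ∧ |partialT A x t| ≤ C := by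
  obtain ⟨⟨C, hC⟩, ⟨D, hD⟩⟩ := H.bddA (|T| + 1) (by positivity)
  refine ⟨max (max C D) 0, le_max_right _ _, ?_⟩
  filter_upwards [hC, hD] with x h1 h2 t ht
  have ht' : |t| ≤ |T| + 1 := by linarith [le_abs_self T]
  exact ⟨(h1 t ht').trans ((le_max_left _ _).trans (le_max_left _ _)),
    (h2 t ht').trans ((le_max_right _ _).trans (le_max_left _ _))⟩

/-- On a bounded range the `q`-growth reduces to `p`-growth, since `|t|^{q-1} ≤ T^{q-p}|t|^{p-1}`.
For bounded `u`, all `g`-terms can therefore be handled in `L^p`. -/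
theorem exists_bound_g (H : Admissible p q a₁ a₂ V A g) (T : ℝ) :
    ∃ C : ℝ, 0 ≤ C ∧ ∀ᵐ x, ∀ t : ℝ, |t| ≤ T → |g x t| ≤ C * |t| ^ (p - 1) := by
  have hp := H.one_lt
  have h1 := H.a₁_nonneg
  have h2 := H.a₂_nonneg
  have hpq := H.le_q
  refine ⟨a₁ + a₂ * |T| ^ (q - p), by positivity, ?_⟩
  filter_upwards [H.growth] with x hx t ht
  refine (hx t).trans ?_
  have e : |t| ^ (q - 1) = |t| ^ (q - p) * |t| ^ (p - 1) := by
    rw [← Real.rpow_add_of_nonneg (abs_nonneg _) (by linarith) (by linarith)]; congr 1; ring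
  have h3 : |t| ^ (q - p) ≤ |T| ^ (q - p) :=
    Real.rpow_le_rpow (abs_nonneg _) (ht.trans (le_abs_self T)) (by linarith)
  rw [e, add_mul, mul_assoc]
  gcongr

/-- Bounded measurable coefficients `A(x,u)` and `A_t(x,u)`. -/
theorem aemeasurable_A (H : Admissible p q a₁ a₂ V A g) {u : RN N → ℝ} (hu : AEMeasurable u) :
    AEMeasurable fun x => A x (u x) := H.caraA.of_one.aemeasurable_comp hu

theorem aemeasurable_At (H : Admissible p q a₁ a₂ V A g) {u : RN N → ℝ} (hu : AEMeasurable u) :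
    AEMeasurable fun x => partialT A x (u x) := H.caraA.partialT.aemeasurable_comp hu

theorem aemeasurable_g (H : Admissible p q a₁ a₂ V A g) {u : RN N → ℝ} (hu : AEMeasurable u) :
    AEMeasurable fun x => g x (u x) := H.caraG.aemeasurable_comp hu

theorem exists_bound_A_comp (H : Admissible p q a₁ a₂ V A g) (T : ℝ) : ∃ C : ℝ, 0 ≤ C ∧
    ∀ u : RN N → ℝ, (∀ᵐ x, |u x| ≤ T) →
      (∀ᵐ x, |A x (u x)| ≤ C) ∧ ∀ᵐ x, |partialT A x (u x)| ≤ C := by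
  obtain ⟨C, hC0, hC⟩ := H.exists_bound_A T
  refine ⟨C, hC0, fun u hu => ⟨?_, ?_⟩⟩
  · filter_upwards [hC, hu] with x h1 h2 using (h1 _ h2).1
  · filter_upwards [hC, hu] with x h1 h2 using (h1 _ h2).2

theorem integrable_inner (H : Admissible p q a₁ a₂ V A g) {u v : RN N → ℝ} {T : ℝ}
    (hu : MemW p u) (hT : ∀ᵐ x, |u x| ≤ T) (hv : MemW p v) :
    Integrable fun x => A x (u x) * inner ℝ (pMap p (weakGrad u x)) (weakGrad v x) := by
  obtain ⟨C, -, hC⟩ := H.exists_bound_A_comp T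
  refine integrable_bdd_mul (H.aemeasurable_A hu.1.1.aemeasurable) (hC u hT).1 ?_
  refine (integrable_rpow_sub_one_mul H.one_lt hu.2.2 hv.2.2).mono'
    (((continuous_pMap H.one_lt).comp_aestronglyMeasurable hu.2.2.1).inner hv.2.2.1)
    (Eventually.of_forall fun x => ?_)
  exact inner_pMap_le H.one_lt _ _

theorem integrable_partialT (H : Admissible p q a₁ a₂ V A g) {u v : RN N → ℝ} {T S : ℝ}
    (hu : MemW p u) (hT : ∀ᵐ x, |u x| ≤ T) (hv : AEMeasurable v) (hS : ∀ᵐ x, |v x| ≤ S) :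
    Integrable fun x => partialT A x (u x) * v x * ‖weakGrad u x‖ ^ p := by
  obtain ⟨C, hC0, hC⟩ := H.exists_bound_A_comp T
  refine integrable_bdd_mul (C := C * S) ((H.aemeasurable_At hu.1.1.aemeasurable).mul hv) ?_
    (integrable_norm_rpow H.pos hu.2.2)
  filter_upwards [(hC u hT).2, hS] with x h1 h2
  rw [abs_mul]
  exact mul_le_mul h1 h2 (abs_nonneg _) hC0

theorem integrable_weight (H : Admissible p q a₁ a₂ V A g) {u v : RN N → ℝ}
    (hu : MemWV p V u) (hv : MemWV p V v) :
    Integrable fun x => V x * |u x| ^ (p - 2) * u x * v x := by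
  have hum := hu.1.1.1.aemeasurable
  have hvm := hv.1.1.1.aemeasurable
  have hVm := H.measV
  refine (hu.2.add hv.2).mono' (by fun_prop) ?_
  filter_upwards [H.nonnegV] with x hx
  have e : V x * |u x| ^ (p - 2) * u x * v x = V x * inner ℝ (pMap p (u x)) (v x) := by
    rw [pMap, real_inner_smul_left, Real.norm_eq_abs]
    simp [mul_assoc, mul_comm (v x)]
  rw [e, norm_mul, Real.norm_of_nonneg hx, Real.norm_eq_abs]
  have h1 := inner_pMap_le H.one_lt (u x) (v x)
  have h2 := rpow_sub_one_mul_le H.one_lt (norm_nonneg (u x)) (norm_nonneg (v x))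
  rw [Real.norm_eq_abs, Real.norm_eq_abs] at h1 h2
  simp only [Pi.add_apply]
  rw [← mul_add]
  exact mul_le_mul_of_nonneg_left (h1.trans h2) hx

theorem integrable_g (H : Admissible p q a₁ a₂ V A g) {u v : RN N → ℝ} {T : ℝ}
    (hu : MemLp u (ENNReal.ofReal p)) (hT : ∀ᵐ x, |u x| ≤ T) (hv : MemLp v (ENNReal.ofReal p)) :
    Integrable fun x => g x (u x) * v x := by
  obtain ⟨C, hC0, hC⟩ := H.exists_bound_g T
  refine ((integrable_rpow_sub_one_mul H.one_lt hu hv).const_mul C).mono'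
    ((H.aemeasurable_g hu.1.aemeasurable).mul hv.1.aemeasurable).aestronglyMeasurable ?_
  filter_upwards [hC, hT] with x h1 h2
  rw [norm_mul, ← mul_assoc]
  exact mul_le_mul_of_nonneg_right (h1 _ h2) (norm_nonneg _)

theorem dJ_eq (p : ℝ) (V : RN N → ℝ) (A g : RN N → ℝ → ℝ) (u v : RN N → ℝ) :
    dJ p A V g u v = (∫ x, A x (u x) * inner ℝ (pMap p (weakGrad u x)) (weakGrad v x))
    + (1 / p) * (∫ x, partialT A x (u x) * v x * ‖weakGrad u x‖ ^ p)
    + (∫ x, V x * |u x| ^ (p - 2) * u x * v x) - ∫ x, g x (u x) * v x := by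
  simp only [dJ, pMap, real_inner_smul_left, mul_assoc]

/-! ### The energy estimate -/

theorem memXOn_regPow (H : Admissible p q a₁ a₂ V A g) {k : ℝ} {u : RN N → ℝ}
    (hu : MemXOn p V (Metric.ball 0 k) u) {s ε : ℝ} (hε : 0 < ε) (hε1 : ε ≤ 1) (hs : 0 ≤ s) :
    MemXOn p V (Metric.ball 0 k) (fun x => regPow ε s (u x)) ∧
      weakGrad (fun x => regPow ε s (u x)) =ᵐ[volume]
        fun x => deriv (regPow ε s) (u x) • weakGrad u x := by
  obtain ⟨T, hT0, hT⟩ := hu.2.exists_bound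
  have hF := contDiff_regPow hε s
  obtain ⟨h1, h2⟩ := hu.1.comp_of_bounded H.one_lt.le hT hF (regPow_zero ε s)
  have hum := hu.2.1.1.1.1.aemeasurable
  have hm : AEMeasurable (fun x => regPow ε s (u x)) :=
    hF.continuous.measurable.comp_aemeasurable hum
  have hb : ∀ᵐ x, |regPow ε s (u x)| ≤ (T ^ 2 + 1) ^ (s / 2) * |u x| := by
    filter_upwards [hT] with x hx
    rw [abs_regPow hε, mul_comm]
    exact mul_le_mul_of_nonneg_right (regWeight_le hε hε1 hs hx) (abs_nonneg _)
  refine ⟨⟨h2, ⟨h2.1, integrable_weight_rpow_of_le H.pos H.measV hu.2.1.2 hm (by positivity) hb⟩,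
    ?_⟩, h1.weakGrad_ae_eq⟩
  refine memLp_top_of_bound hm.aestronglyMeasurable ((T ^ 2 + 1) ^ (s / 2) * T) ?_
  filter_upwards [hb, hT] with x h1 h2
  exact h1.trans (by gcongr)

/-- The test function `u (u² + ε)^{s/2}` stays in `X_{B_k}` since `u` is bounded. In the tested
equation the two principal terms combine to the weight times `(A + A_t u / p)|∇u|^p`, bounded below
by (h4) and (h2); the potential term has a good sign and (g1) bounds the right side. No bound on `u`
enters the constants. -/
theorem energy_estimate (H : Admissible p q a₁ a₂ V A g) {α₀ α₂ : ℝ}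
    (hA2 : ∀ᵐ x, ∀ t : ℝ, α₀ ≤ A x t) (hα₂ : 0 < α₂)
    (hA4 : ∀ᵐ x, ∀ t : ℝ, α₂ * A x t ≤ p * A x t + partialT A x t * t) (hα₀ : 0 < α₀)
    {k : ℝ} {u : RN N → ℝ} (hu : MemXOn p V (Metric.ball 0 k) u)
    (hcrit : ∀ v, MemXOn p V (Metric.ball 0 k) v → dJ p A V g u v = 0)
    {s ε : ℝ} (hε : 0 < ε) (hε1 : ε ≤ 1) (hs : 0 ≤ s) :
    α₂ / p * α₀ * ∫ x, regWeight ε s (u x) * ‖weakGrad u x‖ ^ p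
      ≤ ∫ x, regWeight ε s (u x) * (a₁ * |u x| ^ p + a₂ * |u x| ^ q) := by
  obtain ⟨T, hT0, hT⟩ := hu.2.exists_bound
  have hp := H.pos
  obtain ⟨hv, hvg⟩ := H.memXOn_regPow hu hε hε1 hs
  obtain ⟨S, -, hS⟩ := hv.2.exists_bound
  have hum := hu.2.1.1.1.1.aemeasurable
  have hwm : AEMeasurable (fun x => regWeight ε s (u x)) :=
    (contDiff_regWeight hε s).continuous.measurable.comp_aemeasurable hum
  have hwb : ∀ᵐ x, |regWeight ε s (u x)| ≤ (T ^ 2 + 1) ^ (s / 2) := by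
    filter_upwards [hT] with x hx
    rw [abs_regWeight hε]
    exact regWeight_le hε hε1 hs hx
  have key := hcrit _ hv
  rw [dJ_eq] at key
  have i1 := H.integrable_inner hu.2.1.1 hT hv.1.1
  have i2 := H.integrable_partialT hu.2.1.1 hT hv.2.1.1.1.1.aemeasurable hS
  have i4 := H.integrable_g hu.2.1.1.1 hT hv.2.1.1.1
  have i5 : Integrable fun x => regWeight ε s (u x) * ‖weakGrad u x‖ ^ p :=
    integrable_bdd_mul hwm hwb (integrable_norm_rpow hp hu.2.1.1.2.2)
  have i6 : Integrable fun x => regWeight ε s (u x) * (a₁ * |u x| ^ p + a₂ * |u x| ^ q) :=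
    integrable_bdd_mul hwm hwb
      (((integrable_abs_rpow_of_bounded hp le_rfl hu.2.1.1.1 hT).const_mul _).add
        ((integrable_abs_rpow_of_bounded hp H.le_q hu.2.1.1.1 hT).const_mul _))
  have t3 : 0 ≤ ∫ x, V x * |u x| ^ (p - 2) * u x * regPow ε s (u x) := by
    refine integral_nonneg_of_ae ?_
    filter_upwards [H.nonnegV] with x hx
    have : V x * |u x| ^ (p - 2) * u x * regPow ε s (u x)
        = V x * |u x| ^ (p - 2) * (u x) ^ 2 * regWeight ε s (u x) := by rw [regPow]; ring
    rw [this]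
    have := (regWeight_pos hε s (u x)).le
    simp only [Pi.zero_apply]
    positivity
  have t4 : ∫ x, g x (u x) * regPow ε s (u x)
      ≤ ∫ x, regWeight ε s (u x) * (a₁ * |u x| ^ p + a₂ * |u x| ^ q) := by
    refine integral_mono_ae i4 i6 ?_
    filter_upwards [H.growth] with x hx
    have hw := (regWeight_pos hε s (u x)).le
    have e : ∀ r : ℝ, 0 < r → |u x| ^ (r - 1) * |u x| = |u x| ^ r := fun r hr => by
      rcases (abs_nonneg (u x)).eq_or_lt with h | h
      · rw [← h, mul_zero, Real.zero_rpow hr.ne']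
      · rw [← Real.rpow_add_one h.ne', sub_add_cancel]
    have hq : 0 < q := by linarith [H.le_q]
    calc g x (u x) * regPow ε s (u x) ≤ |g x (u x)| * (|u x| * regWeight ε s (u x)) := by
          rw [← abs_regPow hε, ← abs_mul]; exact le_abs_self _
      _ ≤ (a₁ * |u x| ^ (p - 1) + a₂ * |u x| ^ (q - 1)) * (|u x| * regWeight ε s (u x)) := by
          gcongr
          exact hx _
      _ = _ := by rw [← e p hp, ← e q hq]; ring
  have t12 : α₂ / p * α₀ * ∫ x, regWeight ε s (u x) * ‖weakGrad u x‖ ^ p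
      ≤ (∫ x, A x (u x) * inner ℝ (pMap p (weakGrad u x))
          (weakGrad (fun x => regPow ε s (u x)) x))
        + (1 / p) * ∫ x, partialT A x (u x) * regPow ε s (u x) * ‖weakGrad u x‖ ^ p := by
    rw [← integral_const_mul, ← integral_const_mul, ← integral_add i1 (i2.const_mul _)]
    refine integral_mono_ae (i5.const_mul _) (i1.add (i2.const_mul _)) ?_
    filter_upwards [hA2, hA4, hvg] with x h2 h4 hg
    have hA0 : α₀ ≤ A x (u x) := h2 _
    have hw := (regWeight_pos hε s (u x)).le
    obtain ⟨r, hr0, -, hr⟩ := exists_deriv_regPow hε hs (u x)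
    rw [hg, inner_smul_right, inner_pMap_self H.one_lt, hr, regPow]
    have h5 : α₂ / p * α₀ ≤ A x (u x) + 1 / p * (partialT A x (u x) * u x) := by
      have := h4 (u x)
      have h6 : α₂ * α₀ ≤ p * A x (u x) + partialT A x (u x) * u x :=
        (mul_le_mul_of_nonneg_left hA0 hα₂.le).trans this
      have e1 : α₂ / p * α₀ = 1 / p * (α₂ * α₀) := by ring
      have e2 : A x (u x) + 1 / p * (partialT A x (u x) * u x)
          = 1 / p * (p * A x (u x) + partialT A x (u x) * u x) := by field_simp
      rw [e1, e2]
      exact mul_le_mul_of_nonneg_left h6 (by positivity)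
    have hn : 0 ≤ ‖weakGrad u x‖ ^ p := by positivity
    have h7 := mul_le_mul_of_nonneg_right h5 (mul_nonneg hw hn)
    -- The contribution of the derivative falling on the weight is nonnegative and is dropped.
    have h8 : 0 ≤ A x (u x) * r * ‖weakGrad u x‖ ^ p :=
      mul_nonneg (mul_nonneg (hα₀.le.trans hA0) hr0) hn
    calc _ ≤ _ := h7
      _ ≤ (A x (u x) + 1 / p * (partialT A x (u x) * u x))
          * (regWeight ε s (u x) * ‖weakGrad u x‖ ^ p) + A x (u x) * r * ‖weakGrad u x‖ ^ p := by
        linarith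
      _ = _ := by ring
  linarith

end Admissible

end QuasilinearSchrodinger

/-! ### Reverse Hölder inequality and uniform bounds for critical points on balls. -/

namespace QuasilinearSchrodinger

variable {N : ℕ}

namespace Admissible

variable {p q a₁ a₂ : ℝ} {V : RN N → ℝ} {A g : RN N → ℝ → ℝ}

/-- The inequality obtained from the energy estimate and the Sobolev inequality, before the
regularisation is removed. -/
theorem exists_reverse_holder_reg (H : Admissible p q a₁ a₂ V A g) (hN : 2 ≤ N) {α₀ α₂ : ℝ}
    (hA2 : ∀ᵐ x, ∀ t : ℝ, α₀ ≤ A x t) (hα₂ : 0 < α₂)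
    (hA4 : ∀ᵐ x, ∀ t : ℝ, α₂ * A x t ≤ p * A x t + partialT A x t * t) (hα₀ : 0 < α₀) :
    ∃ C : ℝ, 0 ≤ C ∧ ∀ (k : ℝ) (u : RN N → ℝ), MemXOn p V (Metric.ball 0 k) u →
      (∀ v, MemXOn p V (Metric.ball 0 k) v → dJ p A V g u v = 0) →
      ∀ s ε : ℝ, 0 ≤ s → 0 < ε → ε ≤ 1 →
      (∫ x, |u x| ^ ((N : ℝ) / (N - 1) * (1 + s + q - q / p)))
        ≤ (C * (1 + s + q - q / p) *
          ((∫ x, regWeight ε s (u x) * (a₁ * |u x| ^ p + a₂ * |u x| ^ q)) / (α₂ / p * α₀)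
            + ∫ x in Metric.ball 0 k, regWeight ε (q + s) (u x))) ^ ((N : ℝ) / (N - 1)) := by
  obtain ⟨C, hC0, hC⟩ := exists_sobolev_one hN
  refine ⟨C, hC0, fun k u hu hcrit s ε hs hε hε1 => ?_⟩
  have hp := H.pos
  have hp1 := H.one_lt
  have hq : p ≤ q := H.le_q
  have hq0 : 0 < q := by linarith
  have hN1 : (1 : ℝ) < N := by exact_mod_cast hN
  set χ : ℝ := (N : ℝ) / (N - 1) with hχ
  have hχ1 : 1 < χ := by rw [hχ, one_lt_div (by linarith)]; linarith
  have hχ0 : 0 < χ := by linarith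
  obtain ⟨T, hT0, hT⟩ := hu.2.exists_bound
  -- The power is chosen so that the weight of exponent `r` is the product of those of exponents
  -- `(q+s)(p-1)/p` and `s/p`. Young's inequality then splits the gradient of `regPow ε r u` into
  -- the energy term and a term of exponent `q + s`.
  set r : ℝ := s + q - q / p with hr
  have hr0 : 0 ≤ r := by
    have : q / p ≤ q := div_le_self (by linarith) hp1.le
    linarith
  have er : 1 + s + q - q / p = 1 + r := by rw [hr]; ring
  rw [er]
  have energy := H.energy_estimate hA2 hα₂ hA4 hα₀ hu hcrit hε hε1 hs
  obtain ⟨hv, hvg⟩ := H.memXOn_regPow hu hε hε1 hr0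
  have hum := hu.2.1.1.1.1.aemeasurable
  have hwm : ∀ e, AEMeasurable (fun x => regWeight ε e (u x)) := fun e =>
    (contDiff_regWeight hε e).continuous.measurable.comp_aemeasurable hum
  have hwb : ∀ e, 0 ≤ e → ∀ᵐ x, |regWeight ε e (u x)| ≤ (T ^ 2 + 1) ^ (e / 2) := fun e he => by
    filter_upwards [hT] with x hx
    rw [abs_regWeight hε]
    exact regWeight_le hε hε1 he hx
  have i5 : Integrable fun x => regWeight ε s (u x) * ‖weakGrad u x‖ ^ p :=
    integrable_bdd_mul (hwm s) (hwb s hs) (integrable_norm_rpow hp hu.2.1.1.2.2)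
  -- For `ε > 0` the weight does not vanish where `u = 0`, so it is integrated over the ball only.
  have i6 : IntegrableOn (fun x => regWeight ε (q + s) (u x)) (Metric.ball 0 k) :=
    Measure.integrableOn_of_bounded measure_ball_lt_top.ne (hwm _).aestronglyMeasurable
      (M := (T ^ 2 + 1) ^ ((q + s) / 2)) (ae_restrict_of_ae (hwb _ (by linarith)))
  set κ := α₂ / p * α₀ with hκ
  have hκ0 : 0 < κ := by positivity
  set I1 := ∫ x, regWeight ε s (u x) * ‖weakGrad u x‖ ^ p with hI1
  set I2 := ∫ x in Metric.ball 0 k, regWeight ε (q + s) (u x) with hI2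
  have hI2n : 0 ≤ I2 := integral_nonneg fun x => (regWeight_pos hε _ _).le
  have hI1n : 0 ≤ I1 := integral_nonneg fun x =>
    mul_nonneg (regWeight_pos hε _ _).le (by positivity)
  have hgrad : ∫⁻ x in Metric.ball 0 k, ‖weakGrad (fun x => regPow ε r (u x)) x‖ₑ
      ≤ ENNReal.ofReal ((1 + r) * (I1 + I2)) := by
    have hpt : ∀ᵐ x, ‖weakGrad (fun x => regPow ε r (u x)) x‖
        ≤ (1 + r) * (regWeight ε s (u x) * ‖weakGrad u x‖ ^ p + regWeight ε (q + s) (u x)) := by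
      filter_upwards [hvg] with x hx
      obtain ⟨ρ, hρ0, hρ1, hρ⟩ := exists_deriv_regPow hε hr0 (u x)
      have hw := regWeight_pos hε r (u x)
      rw [hx, norm_smul, hρ, Real.norm_of_nonneg (by positivity)]
      have h1 : regWeight ε r (u x) + ρ ≤ (1 + r) * regWeight ε r (u x) := by linarith
      refine (mul_le_mul_of_nonneg_right h1 (norm_nonneg _)).trans ?_
      rw [mul_assoc]
      refine mul_le_mul_of_nonneg_left ?_ (by linarith)
      have h2 := rpow_sub_one_mul_le hp1 (regWeight_pos hε ((q + s) / p) (u x)).le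
        (mul_nonneg (regWeight_pos hε (s / p) (u x)).le (norm_nonneg (weakGrad u x)))
      rw [Real.mul_rpow (regWeight_pos hε _ _).le (norm_nonneg _), regWeight_rpow hε,
        regWeight_rpow hε, regWeight_rpow hε, div_mul_cancel₀ _ hp.ne', div_mul_cancel₀ _ hp.ne',
        ← mul_assoc, ← regWeight_add hε] at h2
      have e : (q + s) / p * (p - 1) + s / p = r := by rw [hr]; field_simp; ring
      rw [e] at h2
      linarith
    rw [hI1, hI2]
    have e1 : ∫ x in Metric.ball 0 k, (regWeight ε s (u x) * ‖weakGrad u x‖ ^ p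
        + regWeight ε (q + s) (u x)) ≤ I1 + I2 := by
      rw [integral_add i5.integrableOn i6]
      refine add_le_add ?_ le_rfl
      exact setIntegral_le_integral i5 (Eventually.of_forall fun x =>
        mul_nonneg (regWeight_pos hε _ _).le (by positivity))
    have e2 : ∫⁻ x in Metric.ball 0 k, ‖weakGrad (fun x => regPow ε r (u x)) x‖ₑ
        ≤ ∫⁻ x in Metric.ball 0 k, ENNReal.ofReal ((1 + r) * (regWeight ε s (u x)
          * ‖weakGrad u x‖ ^ p + regWeight ε (q + s) (u x))) := by
      refine lintegral_mono_ae (ae_restrict_of_ae ?_)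
      filter_upwards [hpt] with x hx
      rw [← ofReal_norm]
      exact ENNReal.ofReal_le_ofReal hx
    refine e2.trans ?_
    rw [← ofReal_integral_eq_lintegral_ofReal]
    · refine ENNReal.ofReal_le_ofReal ?_
      rw [integral_const_mul]
      exact mul_le_mul_of_nonneg_left e1 (by linarith)
    · exact (i5.integrableOn.add i6).const_mul _
    · refine Eventually.of_forall fun x => ?_
      have h1 := (regWeight_pos hε s (u x)).le
      have h2 := (regWeight_pos hε (q + s) (u x)).le
      simp only [Pi.zero_apply]
      positivity
  have sob := (hC p k _ hp1.le hv.1).trans (mul_le_mul_right hgrad _)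
  rw [← ENNReal.ofReal_mul hC0] at sob
  have hvχ : MemLp (fun x => regPow ε r (u x)) (ENNReal.ofReal χ) := by
    refine ⟨hv.2.1.1.1.1, lt_of_le_of_lt sob ENNReal.ofReal_lt_top⟩
  rw [eLpNorm_ofReal_eq hχ0 hvχ, ENNReal.ofReal_le_ofReal_iff (by positivity)] at sob
  have hvint := integrable_norm_rpow hχ0 hvχ
  have hle : ∀ x, |u x| ^ (χ * (1 + r)) ≤ ‖regPow ε r (u x)‖ ^ χ := fun x => by
    rw [mul_comm χ, Real.rpow_mul (abs_nonneg _)]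
    refine Real.rpow_le_rpow (by positivity) ?_ hχ0.le
    rw [Real.norm_eq_abs, abs_regPow hε]
    rcases (abs_nonneg (u x)).eq_or_lt with h | h
    · rw [← h, zero_mul, Real.zero_rpow (by linarith)]
    · rw [Real.rpow_add h, Real.rpow_one]
      exact mul_le_mul_of_nonneg_left (abs_rpow_le_regWeight hε hr0 _) h.le
  have huint : Integrable fun x => |u x| ^ (χ * (1 + r)) := by
    refine hvint.mono' (hum.abs.pow_const _).aestronglyMeasurable (Eventually.of_forall fun x => ?_)
    rw [Real.norm_of_nonneg (by positivity)]
    exact hle x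
  have h9 := integral_mono huint hvint hle
  refine h9.trans ?_
  have h10 : ∫ x, ‖regPow ε r (u x)‖ ^ χ
      = ((∫ x, ‖regPow ε r (u x)‖ ^ χ) ^ (1 / χ)) ^ χ := by
    rw [← Real.rpow_mul (integral_norm_rpow_nonneg _), one_div_mul_cancel hχ0.ne', Real.rpow_one]
  rw [h10]
  refine Real.rpow_le_rpow (Real.rpow_nonneg (integral_norm_rpow_nonneg _) _) ?_ hχ0.le
  refine sob.trans ?_
  rw [mul_assoc]
  refine mul_le_mul_of_nonneg_left ?_ hC0
  refine mul_le_mul_of_nonneg_left ?_ (by linarith)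
  refine add_le_add ?_ le_rfl
  rw [le_div_iff₀ hκ0, mul_comm]
  exact energy

/-- Dominated convergence lets `ε → 0` in the regularised inequality. The boundedness of `u` is used
only qualitatively, to dominate, and in the limit the integral over the ball is bounded by the one
over the whole space, so `K` depends neither on `k` nor on `u`. -/
theorem exists_reverse_holder (H : Admissible p q a₁ a₂ V A g) (hN : 2 ≤ N) {α₀ α₂ : ℝ}
    (hA2 : ∀ᵐ x, ∀ t : ℝ, α₀ ≤ A x t) (hα₂ : 0 < α₂)
    (hA4 : ∀ᵐ x, ∀ t : ℝ, α₂ * A x t ≤ p * A x t + partialT A x t * t) (hα₀ : 0 < α₀) :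
    ∃ K : ℝ, 1 ≤ K ∧ ∀ (k : ℝ) (u : RN N → ℝ), MemXOn p V (Metric.ball 0 k) u →
      (∀ v, MemXOn p V (Metric.ball 0 k) v → dJ p A V g u v = 0) →
      ∀ s : ℝ, 0 ≤ s → (∫ x, |u x| ^ ((N : ℝ) / (N - 1) * (1 + s + q - q / p)))
        ≤ (K * (1 + s) * ((∫ x, |u x| ^ (p + s)) + ∫ x, |u x| ^ (q + s)))
          ^ ((N : ℝ) / (N - 1)) := by
  obtain ⟨C, hC0, hC⟩ := H.exists_reverse_holder_reg hN hA2 hα₂ hA4 hα₀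
  have hp := H.pos
  have hp1 := H.one_lt
  have hq : p ≤ q := H.le_q
  have hq0 : 0 < q := by linarith
  have ha1 := H.a₁_nonneg
  have ha2 := H.a₂_nonneg
  have hN1 : (1 : ℝ) < N := by exact_mod_cast hN
  set χ : ℝ := (N : ℝ) / (N - 1) with hχ
  have hχ0 : 0 < χ := div_pos (by linarith) (by linarith)
  set κ := α₂ / p * α₀ with hκ
  have hκ0 : 0 < κ := by positivity
  refine ⟨C * (1 + q) * ((a₁ + a₂) / κ + 1) + 1, by
    have : 0 ≤ C * (1 + q) * ((a₁ + a₂) / κ + 1) := by positivity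
    linarith, fun k u hu hcrit s hs => ?_⟩
  obtain ⟨T, hT0, hT⟩ := hu.2.exists_bound
  have hum := hu.2.1.1.1.1.aemeasurable
  set ε : ℕ → ℝ := fun n => 1 / ((n : ℝ) + 1) with hε
  have hε0 : ∀ n, 0 < ε n := fun n => by simp only [hε]; positivity
  have hε1 : ∀ n, ε n ≤ 1 := fun n => by
    simp only [hε]
    rw [div_le_one (by positivity)]
    have : (0 : ℝ) ≤ n := Nat.cast_nonneg n
    linarith
  have hwm : ∀ n e, AEMeasurable (fun x => regWeight (ε n) e (u x)) := fun n e =>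
    (contDiff_regWeight (hε0 n) e).continuous.measurable.comp_aemeasurable hum
  have hwb : ∀ n e, 0 ≤ e → ∀ᵐ x, |regWeight (ε n) e (u x)| ≤ (T ^ 2 + 1) ^ (e / 2) :=
    fun n e he => by
      filter_upwards [hT] with x hx
      rw [abs_regWeight (hε0 n)]
      exact regWeight_le (hε0 n) (hε1 n) he hx
  have hint : ∀ e, p ≤ e → Integrable (fun x => |u x| ^ e) := fun e he =>
    integrable_abs_rpow_of_bounded hp he hu.2.1.1.1 hT
  have ib : Integrable fun x => a₁ * |u x| ^ p + a₂ * |u x| ^ q :=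
    ((hint p le_rfl).const_mul _).add ((hint q hq).const_mul _)
  have l1 : Tendsto (fun n => ∫ x, regWeight (ε n) s (u x) * (a₁ * |u x| ^ p + a₂ * |u x| ^ q))
      atTop (𝓝 (∫ x, |u x| ^ s * (a₁ * |u x| ^ p + a₂ * |u x| ^ q))) := by
    refine tendsto_integral_of_dominated_convergence
      (fun x => (T ^ 2 + 1) ^ (s / 2) * (a₁ * |u x| ^ p + a₂ * |u x| ^ q))
      (fun n => (integrable_bdd_mul (hwm n s) (hwb n s hs) ib).1) (ib.const_mul _) (fun n => ?_) ?_
    · filter_upwards [hwb n s hs] with x hx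
      rw [norm_mul, Real.norm_of_nonneg (by positivity : 0 ≤ a₁ * |u x| ^ p + a₂ * |u x| ^ q)]
      exact mul_le_mul_of_nonneg_right hx (by positivity)
    · exact Eventually.of_forall fun x => (tendsto_regWeight hs (u x)).mul_const _
  have l2 : Tendsto (fun n => ∫ x in Metric.ball 0 k, regWeight (ε n) (q + s) (u x))
      atTop (𝓝 (∫ x in Metric.ball 0 k, |u x| ^ (q + s))) := by
    refine tendsto_integral_of_dominated_convergence (fun _ => (T ^ 2 + 1) ^ ((q + s) / 2))
      (fun n => (hwm n _).aestronglyMeasurable.restrict)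
      (integrableOn_const measure_ball_lt_top.ne) (fun n => ?_) ?_
    · exact ae_restrict_of_ae (hwb n _ (by linarith))
    · exact Eventually.of_forall fun x => tendsto_regWeight (by linarith) (u x)
  have l3 := (((l1.div_const κ).add l2).const_mul (C * (1 + s + q - q / p))).rpow_const
    (p := χ) (Or.inr hχ0.le)
  have l4 := ge_of_tendsto' l3 fun n => hC k u hu hcrit s (ε n) hs (hε0 n) (hε1 n)
  refine l4.trans ?_
  have hqp : q / p ≤ q := div_le_self (by linarith) hp1.le
  have hqp0 : 0 ≤ q / p := by positivity
  have n0 : ∀ e : ℝ, 0 ≤ ∫ x, |u x| ^ e := fun e => integral_nonneg fun x => by positivity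
  have n1 := n0 (p + s)
  have n2 := n0 (q + s)
  have e1 : ∫ x, |u x| ^ s * (a₁ * |u x| ^ p + a₂ * |u x| ^ q)
      = a₁ * (∫ x, |u x| ^ (p + s)) + a₂ * ∫ x, |u x| ^ (q + s) := by
    rw [← integral_const_mul, ← integral_const_mul, ← integral_add
      ((hint _ (by linarith)).const_mul _) ((hint _ (by linarith)).const_mul _)]
    refine integral_congr_ae (Eventually.of_forall fun x => ?_)
    simp only
    rw [Real.rpow_add_of_nonneg (abs_nonneg _) hp.le hs,
      Real.rpow_add_of_nonneg (abs_nonneg _) (by linarith) hs]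
    ring
  have e2 : ∫ x in Metric.ball 0 k, |u x| ^ (q + s) ≤ ∫ x, |u x| ^ (q + s) :=
    setIntegral_le_integral (hint _ (by linarith)) (Eventually.of_forall fun x => by positivity)
  have n3 : 0 ≤ ∫ x in Metric.ball 0 k, |u x| ^ (q + s) :=
    integral_nonneg fun x => by positivity
  have n5 : 0 ≤ 1 + s + q - q / p := by linarith
  refine Real.rpow_le_rpow ?_ ?_ hχ0.le
  · rw [e1]
    exact mul_nonneg (mul_nonneg hC0 n5) (by positivity)
  · rw [e1]
    set X := ∫ x, |u x| ^ (p + s)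
    set Y := ∫ x, |u x| ^ (q + s)
    have b1 : 1 + s + q - q / p ≤ (1 + q) * (1 + s) := by nlinarith
    have b2 : (a₁ * X + a₂ * Y) / κ + ∫ x in Metric.ball 0 k, |u x| ^ (q + s)
        ≤ ((a₁ + a₂) / κ + 1) * (X + Y) := by
      have c1 : (a₁ * X + a₂ * Y) / κ ≤ (a₁ + a₂) * (X + Y) / κ := by
        refine div_le_div_of_nonneg_right ?_ hκ0.le
        nlinarith [mul_nonneg ha1 n2, mul_nonneg ha2 n1]
      have c2 : ((a₁ + a₂) / κ + 1) * (X + Y) = (a₁ + a₂) * (X + Y) / κ + (X + Y) := by ring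
      rw [c2]
      linarith
    calc C * (1 + s + q - q / p) * ((a₁ * X + a₂ * Y) / κ
          + ∫ x in Metric.ball 0 k, |u x| ^ (q + s))
        ≤ C * ((1 + q) * (1 + s)) * (((a₁ + a₂) / κ + 1) * (X + Y)) := by gcongr
      _ = (C * (1 + q) * ((a₁ + a₂) / κ + 1)) * (1 + s) * (X + Y) := by ring
      _ ≤ _ := by
        gcongr
        linarith

/-- Subcriticality in the form used by the iteration: the fixed point `(q/p - 1)N` of the exponent
recursion is below `q`. -/
theorem lt_of_lt_criticalExponent {N : ℕ} (hN : 2 ≤ N) {p q : ℝ} (hp : 1 < p) (hpq : p ≤ q)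
    (hq : (q : EReal) < criticalExponent N p) : (q / p - 1) * N < q := by
  have hN1 : (0 : ℝ) < N := by exact_mod_cast (by omega : 0 < N)
  have hp0 : 0 < p := by linarith
  by_contra hcon
  rw [not_lt] at hcon
  have h1 : q * p ≤ (q - p) * N := by
    have : (q / p - 1) * N = (q - p) * N / p := by field_simp
    rw [this, le_div_iff₀ hp0] at hcon
    exact hcon
  unfold criticalExponent at hq
  split_ifs at hq with h
  · rw [EReal.coe_lt_coe_iff, lt_div_iff₀ (by linarith)] at hq
    nlinarith
  · rw [not_lt] at h
    nlinarith

/-- Uniform `L^∞` bound for critical points on balls, in terms of their `L^p` and `L^q` norms. -/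
theorem exists_uniform_bound (H : Admissible p q a₁ a₂ V A g) (hN : 2 ≤ N) {α₀ α₂ : ℝ}
    (hA2 : ∀ᵐ x, ∀ t : ℝ, α₀ ≤ A x t) (hα₂ : 0 < α₂)
    (hA4 : ∀ᵐ x, ∀ t : ℝ, α₂ * A x t ≤ p * A x t + partialT A x t * t) (hα₀ : 0 < α₀)
    (hq : (q : EReal) < criticalExponent N p) {B : ℝ} (hB : 0 ≤ B) :
    ∃ T : ℝ, 0 ≤ T ∧ ∀ (k : ℝ) (u : RN N → ℝ), MemXOn p V (Metric.ball 0 k) u →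
      (∀ v, MemXOn p V (Metric.ball 0 k) v → dJ p A V g u v = 0) →
      (∫ x, |u x| ^ p) ≤ B → (∫ x, |u x| ^ q) ≤ B → ∀ᵐ x, |u x| ≤ T := by
  obtain ⟨K, hK1, hK⟩ := H.exists_reverse_holder hN hA2 hα₂ hA4 hα₀
  have hN1 : (1 : ℝ) < N := by exact_mod_cast hN
  have hp := H.pos
  have hpq := H.le_q
  have hqN := lt_of_lt_criticalExponent hN H.one_lt hpq hq
  have hχ : 1 < (N : ℝ) / (N - 1) := by rw [one_lt_div (by linarith)]; linarith
  have hqp : 0 ≤ (q / p - 1) * N := by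
    have : 1 ≤ q / p := by rwa [one_le_div hp]
    exact mul_nonneg (by linarith) (by linarith)
  have hN0 : (N : ℝ) - 1 ≠ 0 := by linarith
  -- `f₀` is the distance from the starting exponent `q` to the fixed point of `e ↦ χ(1 + e - q/p)`,
  -- which is `(q/p - 1)N` since `χ/(χ - 1) = N`.
  obtain ⟨T, hT0, hT⟩ := exists_bound_of_reverse_holder (ν := (volume : Measure (RN N)))
    (f₀ := q - (q / p - 1) * N) hχ hK1 hB hp hpq (by linarith) (by linarith)
    (by field_simp; ring)
  refine ⟨T, hT0, fun k u hu hcrit h1 h2 => ?_⟩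
  obtain ⟨S, -, hS⟩ := hu.2.exists_bound
  exact hT u (fun e he => integrable_abs_rpow_of_bounded hp he hu.2.1.1.1 hS) h1 h2
    (hK k u hu hcrit)

/-- Uniform bound on the gradients of critical points on balls. -/
theorem gradient_bound (H : Admissible p q a₁ a₂ V A g) {α₀ α₂ : ℝ}
    (hA2 : ∀ᵐ x, ∀ t : ℝ, α₀ ≤ A x t) (hα₂ : 0 < α₂)
    (hA4 : ∀ᵐ x, ∀ t : ℝ, α₂ * A x t ≤ p * A x t + partialT A x t * t) (hα₀ : 0 < α₀)
    {B : ℝ} {k : ℝ} {u : RN N → ℝ} (hu : MemXOn p V (Metric.ball 0 k) u)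
    (hcrit : ∀ v, MemXOn p V (Metric.ball 0 k) v → dJ p A V g u v = 0)
    (h1 : (∫ x, |u x| ^ p) ≤ B) (h2 : (∫ x, |u x| ^ q) ≤ B) :
    ∫ x, ‖weakGrad u x‖ ^ p ≤ (a₁ + a₂) * B / (α₂ / p * α₀) := by
  have hp := H.pos
  obtain ⟨S, -, hS⟩ := hu.2.exists_bound
  have hκ0 : 0 < α₂ / p * α₀ := by positivity
  -- With `s = 0` the weight is identically 1, and `ε = 1` is an arbitrary admissible value.
  have key := H.energy_estimate hA2 hα₂ hA4 hα₀ hu hcrit one_pos le_rfl le_rfl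
  have e : ∀ t, regWeight 1 0 t = 1 := fun t => by simp [regWeight]
  simp_rw [e, one_mul] at key
  rw [integral_add ((integrable_abs_rpow_of_bounded hp le_rfl hu.2.1.1.1 hS).const_mul _)
    ((integrable_abs_rpow_of_bounded hp H.le_q hu.2.1.1.1 hS).const_mul _), integral_const_mul,
    integral_const_mul] at key
  rw [le_div_iff₀ hκ0, mul_comm]
  have := mul_le_mul_of_nonneg_left h1 H.a₁_nonneg
  have := mul_le_mul_of_nonneg_left h2 H.a₂_nonneg
  linarith

end Admissible

end QuasilinearSchrodinger

namespace QuasilinearSchrodinger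

variable {N : ℕ}

/-! ### Compositions and localisation in `X` -/

theorem MemX.comp_of_bounded {p : ℝ} (hp : 1 ≤ p) {V u : RN N → ℝ} (hV : AEMeasurable V)
    (hu : MemX p V u) {F : ℝ → ℝ} (hF : ContDiff ℝ ∞ F) (hF0 : F 0 = 0) :
    MemX p V (fun x => F (u x)) ∧
      weakGrad (fun x => F (u x)) =ᵐ[volume] fun x => deriv F (u x) • weakGrad u x := by
  obtain ⟨T, hT0, hT⟩ := hu.exists_bound
  obtain ⟨h1, h2⟩ := hu.1.1.comp_of_bounded hp hT hF hF0
  obtain ⟨F', f1, f2, f3, f4⟩ := exists_compactSupport_eqOn hF hF0 T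
  obtain ⟨K, hK⟩ := ContDiff.lipschitzWith_of_hasCompactSupport f2 f1 (by simp)
  have hb : ∀ᵐ x, |F (u x)| ≤ K * |u x| := by
    filter_upwards [hT] with x hx
    have := hK.dist_le_mul (u x) 0
    rw [f3, dist_zero_right, dist_zero_right, (f4 _ hx).1] at this
    exact this
  have hm : AEMeasurable (fun x => F (u x)) :=
    hF.continuous.measurable.comp_aemeasurable hu.1.1.1.1.aemeasurable
  refine ⟨⟨⟨h2, integrable_weight_rpow_of_le (by linarith) hV hu.1.2 hm K.2 hb⟩, ?_⟩,
    h1.weakGrad_ae_eq⟩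
  exact hu.2.of_le_mul hm.aestronglyMeasurable hb

/-- This makes every compactly supported element of `X` an admissible test function for `u_k` once
`k` is large. -/
theorem MemX.memXOn_ball {p : ℝ} (hp : 1 ≤ p) {V u : RN N → ℝ} (hu : MemX p V u) {R k : ℝ}
    (hRk : R < k) (hR : ∀ᵐ x, x ∉ Metric.closedBall (0 : RN N) R → u x = 0) :
    MemXOn p V (Metric.ball 0 k) u :=
  ⟨hu.1.1.memW0_ball hp hRk hR, hu⟩

/-- A smooth odd function with `ψ' - c |ψ| ≥ 1/2` where `c² = 4 λ`. -/
noncomputable def expPow (l t : ℝ) : ℝ := t * Real.exp (l * t ^ 2)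

theorem contDiff_expPow (l : ℝ) : ContDiff ℝ ∞ (expPow l) :=
  contDiff_id.mul ((contDiff_const.mul (contDiff_id.pow 2)).exp)

theorem deriv_expPow (l t : ℝ) :
    deriv (expPow l) t = (1 + 2 * l * t ^ 2) * Real.exp (l * t ^ 2) := by
  have h1 : HasDerivAt (fun t : ℝ => l * t ^ 2) (l * (2 * t)) t := by
    simpa using ((hasDerivAt_id t).pow 2).const_mul l
  have h2 : HasDerivAt (expPow l)
      (1 * Real.exp (l * t ^ 2) + t * (Real.exp (l * t ^ 2) * (l * (2 * t)))) t :=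
    (hasDerivAt_id t).mul h1.exp
  rw [h2.deriv]; ring

/-- With `y = c|t|` the bracket in front of the exponential is `1 - y + y²/2`, which is at least
`1/2` because `(y - 1)² ≥ 0`. -/
theorem half_le_deriv_expPow_sub (c t : ℝ) :
    1 / 2 ≤ deriv (expPow (c ^ 2 / 4)) t - c * |expPow (c ^ 2 / 4) t| := by
  have hc : 0 ≤ c ^ 2 / 4 * t ^ 2 := by positivity
  have he : 1 ≤ Real.exp (c ^ 2 / 4 * t ^ 2) := Real.one_le_exp hc
  rw [deriv_expPow, expPow, abs_mul, abs_of_pos (Real.exp_pos _)]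
  have h1 : 1 / 2 ≤ 1 + 2 * (c ^ 2 / 4) * t ^ 2 - c * |t| := by
    have := sq_nonneg (c * |t| - 1)
    have h2 : (c * |t|) ^ 2 = c ^ 2 * t ^ 2 := by rw [mul_pow, sq_abs]
    nlinarith
  nlinarith

theorem deriv_expPow_zero (l : ℝ) : deriv (expPow l) 0 = 1 := by rw [deriv_expPow]; simp

theorem expPow_zero (l : ℝ) : expPow l 0 = 0 := by simp [expPow]

theorem Continuous.exists_abs_le_of_abs_le {f : ℝ → ℝ} (hf : Continuous f) (T : ℝ) :
    ∃ C : ℝ, 0 ≤ C ∧ ∀ t, |t| ≤ T → |f t| ≤ C := by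
  obtain ⟨C, hC⟩ := (isCompact_closedBall (0 : ℝ) T).exists_bound_of_continuousOn hf.continuousOn
  refine ⟨max C 0, le_max_right _ _, fun t ht => (hC t ?_).trans (le_max_left _ _)⟩
  rwa [mem_closedBall_zero_iff]

/-! ### Weak convergence of gradients -/

theorem integral_gradient_rpow_le_normV {p : ℝ} (hp : 0 < p) {V u : RN N → ℝ}
    (hV : ∀ᵐ x, 0 ≤ V x) : (∫ x, ‖weakGrad u x‖ ^ p) ^ (1 / p) ≤ normV p V u := by
  refine Real.rpow_le_rpow (integral_norm_rpow_nonneg _) ?_ (by positivity)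
  have : 0 ≤ ∫ x, V x * |u x| ^ p := by
    refine integral_nonneg_of_ae ?_
    filter_upwards [hV] with x hx
    simp only [Pi.zero_apply]
    positivity
  linarith

/-- These are the only functionals on which the weak convergence hypothesis is evaluated;
boundedness is Hölder's inequality. -/
theorem isDualWV_inner {p : ℝ} (hp : 1 < p) {V : RN N → ℝ} (hV : ∀ᵐ x, 0 ≤ V x)
    {c : RN N → ℝ} {C : ℝ} (hc : AEMeasurable c) (hcC : ∀ᵐ x, |c x| ≤ C) (hC : 0 ≤ C)
    {f : RN N → RN N} (hf : MemLp f (ENNReal.ofReal p)) :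
    IsDualWV p V (fun w => ∫ x, c x * inner ℝ (pMap p (f x)) (weakGrad w x)) := by
  have hint : ∀ w, MemW p w → Integrable fun x => c x * inner ℝ (pMap p (f x)) (weakGrad w x) :=
    fun w hw => by
      refine integrable_bdd_mul hc hcC ?_
      refine (integrable_rpow_sub_one_mul hp hf hw.2.2).mono'
        (((continuous_pMap hp).comp_aestronglyMeasurable hf.1).inner hw.2.2.1)
        (Eventually.of_forall fun x => ?_)
      exact inner_pMap_le hp _ _
  refine ⟨fun u v hu hv => ?_, fun a u hu => ?_,
    C * (∫ x, ‖f x‖ ^ p) ^ ((p - 1) / p), fun u hu => ?_⟩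
  · simp only
    rw [← integral_add (hint u hu.1) (hint v hv.1)]
    refine integral_congr_ae ?_
    filter_upwards [hu.1.weakGrad_add hv.1] with x hx
    rw [hx, Pi.add_apply, inner_add_right, mul_add]
  · simp only
    rw [← integral_const_mul]
    refine integral_congr_ae ?_
    filter_upwards [hu.1.weakGrad_smul a] with x hx
    rw [hx, Pi.smul_apply, inner_smul_right, mul_left_comm]
  · simp only
    rw [← Real.norm_eq_abs]
    refine (norm_integral_le_integral_norm _).trans ?_
    have h1 : ∫ x, ‖c x * inner ℝ (pMap p (f x)) (weakGrad u x)‖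
        ≤ ∫ x, C * (‖f x‖ ^ (p - 1) * ‖weakGrad u x‖) := by
      refine integral_mono_ae (hint u hu.1).norm
        ((integrable_rpow_sub_one_mul hp hf hu.1.2.2).const_mul C) ?_
      filter_upwards [hcC] with x hx
      rw [norm_mul]
      exact mul_le_mul hx (inner_pMap_le hp _ _) (norm_nonneg _) hC
    refine h1.trans ?_
    rw [integral_const_mul, mul_assoc]
    refine mul_le_mul_of_nonneg_left ?_ hC
    refine (integral_rpow_sub_one_mul_le hp hf hu.1.2.2).trans ?_
    exact mul_le_mul_of_nonneg_left (integral_gradient_rpow_le_normV (by linarith) hV)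
      (Real.rpow_nonneg (integral_norm_rpow_nonneg _) _)

theorem tendsto_zero_of_abs_integral_le {α : Type*} [MeasurableSpace α] {ν : Measure α}
    {f h : ℕ → α → ℝ} (hfi : ∀ j, Integrable (h j) ν) (hfh : ∀ j, ∀ᵐ x ∂ν, |f j x| ≤ h j x)
    (hh : Tendsto (fun j => ∫ x, h j x ∂ν) atTop (𝓝 0)) :
    Tendsto (fun j => ∫ x, f j x ∂ν) atTop (𝓝 0) := by
  refine squeeze_zero_norm (fun j => ?_) hh
  exact norm_integral_le_of_norm_le (hfi j) (hfh j)

end QuasilinearSchrodinger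

namespace QuasilinearSchrodinger

variable {N : ℕ}

/-! ### Local strong convergence of the gradients -/

section Abstract

variable {α E : Type*} [MeasurableSpace α] {ν : Measure α} [NormedAddCommGroup E]
  [InnerProductSpace ℝ E]

theorem integrable_inner_pMap {p : ℝ} (hp : 1 < p) {f h : α → E}
    (hf : MemLp f (ENNReal.ofReal p) ν) (hh : MemLp h (ENNReal.ofReal p) ν) :
    Integrable (fun x => inner ℝ (pMap p (f x)) (h x)) ν :=
  (integrable_rpow_sub_one_mul hp hf hh).mono'
    (((continuous_pMap hp).comp_aestronglyMeasurable hf.1).inner hh.1)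
    (Eventually.of_forall fun _ => inner_pMap_le hp _ _)

theorem integrable_inner_pMap_sub {p : ℝ} (hp : 1 < p) {f h : α → E}
    (hf : MemLp f (ENNReal.ofReal p) ν) (hh : MemLp h (ENNReal.ofReal p) ν) :
    Integrable (fun x => inner ℝ (pMap p (f x) - pMap p (h x)) (f x - h x)) ν := by
  simp_rw [inner_sub_left]
  exact (integrable_inner_pMap hp hf (hf.sub hh)).sub (integrable_inner_pMap hp hh (hf.sub hh))

theorem tendsto_integral_coeff_mul {c : ℕ → α → ℝ} {C : ℝ} (hcm : ∀ j, AEMeasurable (c j) ν)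
    (hcC : ∀ j, ∀ᵐ x ∂ν, |c j x| ≤ C) (hc : ∀ᵐ x ∂ν, Tendsto (fun j => c j x) atTop (𝓝 0))
    {h : α → ℝ} (hh : Integrable h ν) :
    Tendsto (fun j => ∫ x, c j x * h x ∂ν) atTop (𝓝 0) := by
  have key := tendsto_integral_of_dominated_convergence (μ := ν) (F := fun j x => c j x * h x)
    (f := fun _ => 0) (fun x => C * |h x|) (fun j => (hcm j).aestronglyMeasurable.mul hh.1)
    (hh.abs.const_mul C)
    (fun j => by
      filter_upwards [hcC j] with x hx
      rw [norm_mul]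
      exact mul_le_mul_of_nonneg_right hx (abs_nonneg _))
    (by
      filter_upwards [hc] with x hx
      simpa using hx.mul_const (h x))
  simpa using key

/-- Convergence of the monotonicity integral upgrades to `L^p` convergence through
`exists_norm_sub_rpow_le`: its `ε`-term is uniformly small by the bounds on the norms. -/
theorem tendsto_integral_mul_norm_sub_rpow [FiniteDimensional ℝ E] {p : ℝ} (hp : 1 < p) {η : α → ℝ}
    (hηm : AEMeasurable η ν) (hη : ∀ x, 0 ≤ η x ∧ η x ≤ 1) {f : ℕ → α → E} {f' : α → E} {B : ℝ}
    (hf : ∀ j, MemLp (f j) (ENNReal.ofReal p) ν) (hf' : MemLp f' (ENNReal.ofReal p) ν)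
    (hB : ∀ j, ∫ x, ‖f j x‖ ^ p ∂ν ≤ B)
    (hD : Tendsto (fun j => ∫ x, η x * inner ℝ (pMap p (f j x) - pMap p (f' x)) (f j x - f' x) ∂ν)
      atTop (𝓝 0)) :
    Tendsto (fun j => ∫ x, η x * ‖f j x - f' x‖ ^ p ∂ν) atTop (𝓝 0) := by
  have hp0 : 0 < p := by linarith
  have hη1 : ∀ᵐ x ∂ν, |η x| ≤ 1 := Eventually.of_forall fun x => by
    rw [abs_of_nonneg (hη x).1]; exact (hη x).2
  have hnn : ∀ j, 0 ≤ ∫ x, η x * ‖f j x - f' x‖ ^ p ∂ν := fun j =>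
    integral_nonneg fun x => mul_nonneg (hη x).1 (Real.rpow_nonneg (norm_nonneg _) _)
  have hB0 : 0 ≤ B := (integral_norm_rpow_nonneg _).trans (hB 0)
  set B' := B + ∫ x, ‖f' x‖ ^ p ∂ν with hB'
  have hB'0 : 0 ≤ B' := add_nonneg hB0 (integral_norm_rpow_nonneg _)
  rw [Metric.tendsto_atTop]
  intro ε hε
  have hε' : 0 < ε / (2 * (B' + 1)) := by positivity
  obtain ⟨C, hC0, hC⟩ := exists_norm_sub_rpow_le E hp hε'
  have hlim : Tendsto (fun j => C *
      ∫ x, η x * inner ℝ (pMap p (f j x) - pMap p (f' x)) (f j x - f' x) ∂ν) atTop (𝓝 0) := by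
    simpa using hD.const_mul C
  obtain ⟨j0, hj0⟩ := (Metric.tendsto_atTop.1 hlim) (ε / 2) (by positivity)
  refine ⟨j0, fun j hj => ?_⟩
  rw [Real.dist_eq, sub_zero, abs_of_nonneg (hnn j)]
  have hI := integrable_norm_rpow hp0 (hf j)
  have hI' := integrable_norm_rpow hp0 hf'
  have hsum : Integrable (fun x => ‖f j x‖ ^ p + ‖f' x‖ ^ p) ν := hI.add hI'
  have hDi := integrable_bdd_mul hηm hη1 (integrable_inner_pMap_sub hp (hf j) hf')
  have h1 : ∫ x, η x * ‖f j x - f' x‖ ^ p ∂ν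
      ≤ ∫ x, (ε / (2 * (B' + 1)) * (‖f j x‖ ^ p + ‖f' x‖ ^ p)
        + C * (η x * inner ℝ (pMap p (f j x) - pMap p (f' x)) (f j x - f' x))) ∂ν := by
    refine integral_mono
      (integrable_bdd_mul hηm hη1 (integrable_norm_rpow hp0 ((hf j).sub hf')))
      ((hsum.const_mul _).add (hDi.const_mul C)) fun x => ?_
    have h2 := mul_le_mul_of_nonneg_left (hC (f j x) (f' x)) (hη x).1
    have h3 : 0 ≤ ε / (2 * (B' + 1)) * (‖f j x‖ ^ p + ‖f' x‖ ^ p) := by positivity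
    have h4 := mul_le_mul_of_nonneg_right (hη x).2 h3
    simp only
    linarith
  have h5 := hj0 j hj
  rw [Real.dist_eq, sub_zero] at h5
  replace h5 := (abs_lt.1 h5).2
  rw [integral_add (hsum.const_mul _) (hDi.const_mul C), integral_const_mul,
    integral_const_mul] at h1
  have h6 : ∫ x, (‖f j x‖ ^ p + ‖f' x‖ ^ p) ∂ν ≤ B' := by
    rw [integral_add hI hI']
    linarith [hB j]
  have h7 : ε / (2 * (B' + 1)) * ∫ x, (‖f j x‖ ^ p + ‖f' x‖ ^ p) ∂ν ≤ ε / 2 := by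
    refine (mul_le_mul_of_nonneg_left h6 hε'.le).trans ?_
    rw [div_mul_eq_mul_div, div_le_div_iff₀ (by positivity) (by positivity)]
    nlinarith
  linarith

end Abstract

/-- The pointwise estimate behind the almost everywhere convergence of gradients, for the test
function `η ψ(w - u)` with `a = ∇w`, `b = ∇u`, `e = ∇η`, `s = ψ(w - u)` and `d = ψ'(w - u)`. -/
theorem coercivity_pointwise {E : Type*} [NormedAddCommGroup E] [InnerProductSpace ℝ E]
    {p α₀ C A At η s d : ℝ} (hp : 1 < p) (hα₀ : 0 < α₀) (hA : α₀ ≤ A) (hAt : |At| ≤ C)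
    (hη : 0 ≤ η) (hd : 1 / 2 ≤ d - C / (p * α₀) * |s|) (a b e : E) :
    α₀ / 2 * (η * inner ℝ (pMap p a - pMap p b) (a - b))
      ≤ A * inner ℝ (pMap p a) (η • d • (a - b) + s • e) + 1 / p * (At * (η * s) * ‖a‖ ^ p)
        - A * η * (d - C / (p * α₀) * |s|) * inner ℝ (pMap p b) (a - b)
        + C / (p * α₀) * η * A * |s| * inner ℝ (pMap p a) b
        - A * s * inner ℝ (pMap p a) e := by
  have hp0 : 0 < p := by linarith
  have hC : 0 ≤ C := (abs_nonneg _).trans hAt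
  set c := C / (p * α₀) with hc
  have hc0 : 0 ≤ c := by positivity
  have hcC : C / p = c * α₀ := by rw [hc]; field_simp
  have hD := inner_pMap_sub_nonneg hp a b
  -- The bound on `At` is converted into a multiple of `A` using `C / p = c α₀ ≤ c A`; this is what
  -- fixes the value of `c`.
  have h1 : -(c * η * A * |s| * ‖a‖ ^ p) ≤ 1 / p * (At * (η * s) * ‖a‖ ^ p) := by
    have h2 : -(C * (η * |s|)) ≤ At * (η * s) := by
      have : |At * (η * s)| ≤ C * (η * |s|) := by
        rw [abs_mul, abs_mul, abs_of_nonneg hη]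
        exact mul_le_mul_of_nonneg_right hAt (by positivity)
      exact (abs_le.1 this).1
    have h3 : 0 ≤ ‖a‖ ^ p / p := by positivity
    have h4 := mul_le_mul_of_nonneg_right h2 h3
    have h5 : 0 ≤ c * η * |s| * ‖a‖ ^ p := by positivity
    have h6 := mul_le_mul_of_nonneg_left hA h5
    have h7 : C * (η * |s|) * (‖a‖ ^ p / p) = c * η * |s| * ‖a‖ ^ p * α₀ := by
      rw [show C * (η * |s|) * (‖a‖ ^ p / p) = C / p * (η * |s|) * ‖a‖ ^ p by ring, hcC]; ring
    have h8 : 1 / p * (At * (η * s) * ‖a‖ ^ p) = At * (η * s) * (‖a‖ ^ p / p) := by ring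
    rw [h8]
    linarith
  have h9 : A * η * (d - c * |s|) * inner ℝ (pMap p a - pMap p b) (a - b)
      ≥ α₀ / 2 * (η * inner ℝ (pMap p a - pMap p b) (a - b)) := by
    have h10 : α₀ / 2 ≤ A * (d - c * |s|) := by nlinarith
    have h11 : 0 ≤ η * inner ℝ (pMap p a - pMap p b) (a - b) := mul_nonneg hη hD
    nlinarith [mul_le_mul_of_nonneg_right h10 h11]
  refine h9.le.trans ?_
  -- The first part merges with the principal term, replacing `d` by `d - c|s|`; the second is a
  -- remainder carrying the vanishing factor `s`.
  have h12 : ‖a‖ ^ p = inner ℝ (pMap p a) (a - b) + inner ℝ (pMap p a) b := by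
    rw [← inner_add_right, sub_add_cancel, inner_pMap_self hp]
  rw [h12] at h1
  rw [inner_add_right, inner_smul_right, inner_smul_right, inner_smul_right, inner_sub_left, h12]
  linarith

/-- If `c_j` is bounded and converges almost everywhere, and `w_j ⇀ u`, then
`∫ c_j ⟨|f|^{p-2} f, ∇w_j - ∇u⟩ → 0`. -/
theorem WeakTendstoWV.tendsto_integral_inner {p : ℝ} (hp : 1 < p) {V : RN N → ℝ}
    (hV : ∀ᵐ x, 0 ≤ V x) {w : ℕ → RN N → ℝ} {u : RN N → ℝ} (hw : WeakTendstoWV p V w u)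
    (hwW : ∀ j, MemW p (w j)) (huW : MemW p u) {B : ℝ}
    (hB : ∀ j, ∫ x, ‖weakGrad (w j) x - weakGrad u x‖ ^ p ≤ B)
    {c : ℕ → RN N → ℝ} {c' : RN N → ℝ} {C : ℝ} (hC : 0 ≤ C) (hcm : ∀ j, AEMeasurable (c j))
    (hcm' : AEMeasurable c') (hcC : ∀ j, ∀ᵐ x, |c j x| ≤ C) (hcC' : ∀ᵐ x, |c' x| ≤ C)
    (hc : ∀ᵐ x, Tendsto (fun j => c j x) atTop (𝓝 (c' x))) {f : RN N → RN N}
    (hf : MemLp f (ENNReal.ofReal p)) :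
    Tendsto (fun j => ∫ x, c j x * inner ℝ (pMap p (f x)) (weakGrad (w j) x - weakGrad u x))
      atTop (𝓝 0) := by
  have hsub : ∀ j, MemLp (fun x => weakGrad (w j) x - weakGrad u x) (ENNReal.ofReal p) :=
    fun j => (hwW j).2.2.sub huW.2.2
  have hm : ∀ j, AEMeasurable fun x => c j x - c' x := fun j => (hcm j).sub hcm'
  have hb : ∀ j, ∀ᵐ x, |c j x - c' x| ≤ 2 * C := fun j => by
    filter_upwards [hcC j, hcC'] with x h1 h2
    exact (abs_sub _ _).trans (by linarith)
  -- The coefficient is split as `(c_j - c') + c'`: the first part vanishes by Hölder and dominated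
  -- convergence, the second by weak convergence against a fixed functional.
  have h1 : Tendsto (fun j => ∫ x, (c j x - c' x) *
      inner ℝ (pMap p (f x)) (weakGrad (w j) x - weakGrad u x)) atTop (𝓝 0) := by
    refine tendsto_zero_of_abs_integral_le
      (h := fun j x => |c j x - c' x| * (‖f x‖ ^ (p - 1) * ‖weakGrad (w j) x - weakGrad u x‖))
      (fun j => ?_) (fun j => Eventually.of_forall fun x => ?_)
      (tendsto_integral_coeff_mul_mul hp hm hb ?_ hf hsub hB)
    · exact integrable_bdd_mul (hm j).abs (by simpa using hb j)
        (integrable_rpow_sub_one_mul hp hf (hsub j))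
    · rw [abs_mul]
      exact mul_le_mul_of_nonneg_left (inner_pMap_le hp _ _) (abs_nonneg _)
    · filter_upwards [hc] with x hx
      simpa using hx.sub_const (c' x)
  have h2 := hw _ (isDualWV_inner hp hV hcm' hcC' hC hf)
  have h3 := h1.add (h2.sub_const (∫ x, c' x * inner ℝ (pMap p (f x)) (weakGrad u x)))
  rw [sub_self, add_zero] at h3
  refine h3.congr fun j => ?_
  have i1 := integrable_bdd_mul (hm j) (hb j) (integrable_inner_pMap hp hf (hsub j))
  have i2 := integrable_bdd_mul hcm' hcC' (integrable_inner_pMap hp hf (hwW j).2.2)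
  have i3 := integrable_bdd_mul hcm' hcC' (integrable_inner_pMap hp hf huW.2.2)
  rw [← integral_sub i2 i3]
  have i4 := integral_add i1 (i2.sub i3)
  simp only [Pi.sub_apply] at i4
  rw [← i4]
  refine integral_congr_ae (Eventually.of_forall fun x => ?_)
  simp only [inner_sub_right]
  ring

end QuasilinearSchrodinger

/-! ### Bounded sequences of local critical points and their lower order terms. -/

namespace QuasilinearSchrodinger

variable {N : ℕ} {p q a₁ a₂ : ℝ} {V : RN N → ℝ} {A g : RN N → ℝ → ℝ}

/-- A sequence bounded in `X` and converging weakly and almost everywhere, whose members are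
eventually critical in the direction of every compactly supported element of `X`. -/
structure BoundedCriticalSeq (p : ℝ) (V : RN N → ℝ) (A g : RN N → ℝ → ℝ) (w : ℕ → RN N → ℝ)
    (u : RN N → ℝ) (T B : ℝ) : Prop where
  nonneg : 0 ≤ T
  memX : ∀ j, MemX p V (w j)
  bdd : ∀ j, ∀ᵐ x, |w j x| ≤ T
  grad_le : ∀ j, ∫ x, ‖weakGrad (w j) x‖ ^ p ≤ B
  memX_lim : MemX p V u
  bdd_lim : ∀ᵐ x, |u x| ≤ T
  ae_tendsto : ∀ᵐ x, Tendsto (fun j => w j x) atTop (𝓝 (u x))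
  weak : WeakTendstoWV p V w u
  crit : ∀ R : ℝ, ∀ᶠ j in atTop, ∀ v, MemX p V v →
    (∀ᵐ x, x ∉ Metric.closedBall (0 : RN N) R → v x = 0) → dJ p A V g (w j) v = 0

namespace BoundedCriticalSeq

variable {w : ℕ → RN N → ℝ} {u : RN N → ℝ} {T B : ℝ}

theorem aemeasurable (S : BoundedCriticalSeq p V A g w u T B) (j : ℕ) : AEMeasurable (w j) :=
  (S.memX j).1.1.1.1.aemeasurable

theorem aemeasurable_lim (S : BoundedCriticalSeq p V A g w u T B) : AEMeasurable u :=
  S.memX_lim.1.1.1.1.aemeasurable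

theorem exists_bound_grad_sub (S : BoundedCriticalSeq p V A g w u T B)
    (H : Admissible p q a₁ a₂ V A g) :
    ∃ B', ∀ j, ∫ x, ‖weakGrad (w j) x - weakGrad u x‖ ^ p ≤ B' := by
  have hu := integrable_norm_rpow H.pos S.memX_lim.1.1.2.2
  refine ⟨2 ^ p * (B + ∫ x, ‖weakGrad u x‖ ^ p), fun j => ?_⟩
  have hw := integrable_norm_rpow H.pos (S.memX j).1.1.2.2
  calc ∫ x, ‖weakGrad (w j) x - weakGrad u x‖ ^ p
      ≤ ∫ x, 2 ^ p * (‖weakGrad (w j) x‖ ^ p + ‖weakGrad u x‖ ^ p) := by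
        refine integral_mono (integrable_norm_rpow H.pos
          ((S.memX j).1.1.2.2.sub S.memX_lim.1.1.2.2)) ((hw.add hu).const_mul _) fun x => ?_
        refine (Real.rpow_le_rpow (norm_nonneg _) (norm_sub_le _ _) H.pos.le).trans ?_
        exact add_rpow_le_two_rpow_mul H.pos (norm_nonneg _) (norm_nonneg _)
    _ ≤ _ := by
        rw [integral_const_mul, integral_add hw hu]
        have := S.grad_le j
        gcongr

theorem tendsto_A (S : BoundedCriticalSeq p V A g w u T B) (H : Admissible p q a₁ a₂ V A g) :
    ∀ᵐ x, Tendsto (fun j => A x (w j x)) atTop (𝓝 (A x (u x))) := by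
  filter_upwards [H.caraA.of_one.ae_continuous, S.ae_tendsto] with x h1 h2
  exact (h1.tendsto _).comp h2

theorem tendsto_partialT (S : BoundedCriticalSeq p V A g w u T B)
    (H : Admissible p q a₁ a₂ V A g) :
    ∀ᵐ x, Tendsto (fun j => partialT A x (w j x)) atTop (𝓝 (partialT A x (u x))) := by
  filter_upwards [H.caraA.partialT.ae_continuous, S.ae_tendsto] with x h1 h2
  exact (h1.tendsto _).comp h2

theorem tendsto_g (S : BoundedCriticalSeq p V A g w u T B) (H : Admissible p q a₁ a₂ V A g) :
    ∀ᵐ x, Tendsto (fun j => g x (w j x)) atTop (𝓝 (g x (u x))) := by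
  filter_upwards [H.caraG.ae_continuous, S.ae_tendsto] with x h1 h2
  exact (h1.tendsto _).comp h2

end BoundedCriticalSeq

theorem IsTestFunction.exists_bound_weight {η : RN N → ℝ} (hη : IsTestFunction η)
    (H : Admissible p q a₁ a₂ V A g) : ∃ C : ℝ, 0 ≤ C ∧ ∀ᵐ x, η x ≠ 0 → |V x| ≤ C := by
  obtain ⟨R, hR⟩ := hη.2.isCompact.isBounded.subset_closedBall (0 : RN N)
  obtain ⟨C, hC0, hC⟩ := H.locBddV (|R| + 1) (by positivity)
  refine ⟨C, hC0.le, ?_⟩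
  filter_upwards [hC, H.nonnegV] with x hx h0 hηx
  have h1 := hR (subset_tsupport η hηx)
  rw [mem_closedBall_zero_iff] at h1
  rw [abs_of_nonneg h0]
  exact hx (h1.trans ((le_abs_self R).trans (by linarith)))

/-- Lower order terms tested against bounded functions `η s_j` with `s_j → 0` vanish. -/
theorem BoundedCriticalSeq.tendsto_lower_order {w : ℕ → RN N → ℝ} {u : RN N → ℝ} {T B : ℝ}
    (S : BoundedCriticalSeq p V A g w u T B) (H : Admissible p q a₁ a₂ V A g)
    {η : RN N → ℝ} (hη : IsTestFunction η) {s : ℕ → RN N → ℝ} {C : ℝ}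
    (hsm : ∀ j, AEMeasurable (s j)) (hsC : ∀ j, ∀ᵐ x, |s j x| ≤ C)
    (hs : ∀ᵐ x, Tendsto (fun j => s j x) atTop (𝓝 0)) :
    Tendsto (fun j => ∫ x, V x * |w j x| ^ (p - 2) * w j x * (η x * s j x)) atTop (𝓝 0) ∧
      Tendsto (fun j => ∫ x, g x (w j x) * (η x * s j x)) atTop (𝓝 0) := by
  have hp1 : 0 < p - 1 := by linarith [H.one_lt]
  obtain ⟨K, hK0, hK⟩ := hη.exists_bound_weight H
  obtain ⟨D, hD0, hD⟩ := H.exists_bound_g T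
  have hηi : Integrable fun x => |η x| :=
    (hη.continuous.integrable_of_hasCompactSupport hη.2).abs
  have base : ∀ L : ℝ, Tendsto (fun j => ∫ x, |s j x| * (L * |η x|)) atTop (𝓝 0) := fun L =>
    tendsto_integral_coeff_mul (fun j => (hsm j).abs) (by simpa using hsC)
      (by filter_upwards [hs] with x hx using by simpa using hx.abs) (hηi.const_mul L)
  have hint : ∀ (L : ℝ) (j), Integrable fun x => |s j x| * (L * |η x|) := fun L j =>
    integrable_bdd_mul (hsm j).abs (by simpa using hsC j) (hηi.const_mul L)
  have hpow : ∀ {t : ℝ}, |t| ≤ T → |t| ^ (p - 1) ≤ T ^ (p - 1) := fun ht =>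
    Real.rpow_le_rpow (abs_nonneg _) ht hp1.le
  have hT0 := Real.rpow_nonneg S.nonneg (p - 1)
  refine ⟨tendsto_zero_of_abs_integral_le (hint (K * T ^ (p - 1))) (fun j => ?_) (base _),
    tendsto_zero_of_abs_integral_le (hint (D * T ^ (p - 1))) (fun j => ?_) (base _)⟩
  · filter_upwards [hK, S.bdd j] with x h1 h2
    by_cases hx : η x = 0
    · simp [hx]
    · have h3 : |(|w j x| ^ (p - 2) * w j x)| ≤ T ^ (p - 1) := by
        have := norm_pMap H.one_lt (w j x)
        rw [pMap, Real.norm_eq_abs, Real.norm_eq_abs, smul_eq_mul] at this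
        rw [this]
        exact hpow h2
      rw [mul_assoc (V x), abs_mul, abs_mul (V x), abs_mul (η x)]
      calc |V x| * |(|w j x| ^ (p - 2) * w j x)| * (|η x| * |s j x|)
          ≤ K * T ^ (p - 1) * (|η x| * |s j x|) := by
            refine mul_le_mul_of_nonneg_right ?_ (by positivity)
            exact mul_le_mul (h1 hx) h3 (abs_nonneg _) hK0
        _ = _ := by ring
  · filter_upwards [hD, S.bdd j] with x h1 h2
    rw [abs_mul, abs_mul (η x)]
    calc |g x (w j x)| * (|η x| * |s j x|)
        ≤ D * T ^ (p - 1) * (|η x| * |s j x|) := by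
          refine mul_le_mul_of_nonneg_right ((h1 _ h2).trans ?_) (by positivity)
          exact mul_le_mul_of_nonneg_left (hpow h2) hD0
      _ = _ := by ring

end QuasilinearSchrodinger

/-! ### The exponential test function and convergence of the gradients. -/

namespace QuasilinearSchrodinger

variable {N : ℕ} {p q a₁ a₂ : ℝ} {V : RN N → ℝ} {A g : RN N → ℝ → ℝ}

theorem integral_le_of_ae_le_combination {α : Type*} [MeasurableSpace α] {ν : Measure α}
    {f₀ f₁ f₂ f₃ f₄ f₅ : α → ℝ} {b c : ℝ} (h₀ : Integrable f₀ ν) (h₁ : Integrable f₁ ν)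
    (h₂ : Integrable f₂ ν) (h₃ : Integrable f₃ ν) (h₄ : Integrable f₄ ν) (h₅ : Integrable f₅ ν)
    (h : ∀ᵐ x ∂ν, b * f₀ x ≤ f₁ x + c * f₂ x - f₃ x + f₄ x - f₅ x) :
    b * ∫ x, f₀ x ∂ν ≤ (∫ x, f₁ x ∂ν) + c * (∫ x, f₂ x ∂ν) - (∫ x, f₃ x ∂ν) + (∫ x, f₄ x ∂ν)
      - ∫ x, f₅ x ∂ν := by
  have h12 : Integrable (fun x => f₁ x + c * f₂ x) ν := h₁.add (h₂.const_mul c)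
  have h123 : Integrable (fun x => f₁ x + c * f₂ x - f₃ x) ν := h12.sub h₃
  have h1234 : Integrable (fun x => f₁ x + c * f₂ x - f₃ x + f₄ x) ν := h123.add h₄
  have key := integral_mono_ae (h₀.const_mul b) (h1234.sub h₅) h
  simp only [Pi.sub_apply] at key
  rwa [integral_const_mul, integral_sub h1234 h₅, integral_add h123 h₄, integral_sub h12 h₃,
    integral_add h₁ (h₂.const_mul c), integral_const_mul] at key

namespace BoundedCriticalSeq

variable {w : ℕ → RN N → ℝ} {u : RN N → ℝ} {T B : ℝ}

/-- The equation for `w_j` is tested with `η ψ(w_j - u)`. By `coercivity_pointwise` the monotonicity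
integral is at most the two principal terms of the equation plus three remainders. The equation
replaces the principal terms by lower order ones, and everything on the right tends to zero. -/
theorem tendsto_integral_cutoff (S : BoundedCriticalSeq p V A g w u T B)
    (H : Admissible p q a₁ a₂ V A g) {α₀ : ℝ} (hα₀ : 0 < α₀)
    (hA2 : ∀ᵐ x, ∀ t : ℝ, α₀ ≤ A x t) {η : RN N → ℝ} (hη : IsTestFunction η)
    (hη01 : ∀ x, 0 ≤ η x ∧ η x ≤ 1) :
    Tendsto (fun j => ∫ x, η x * inner ℝ (pMap p (weakGrad (w j) x) - pMap p (weakGrad u x))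
      (weakGrad (w j) x - weakGrad u x)) atTop (𝓝 0) := by
  have hp := H.one_lt
  have hp0 := H.pos
  obtain ⟨R, hR⟩ := hη.2.isCompact.isBounded.subset_closedBall (0 : RN N)
  have hηR : ∀ x, x ∉ Metric.closedBall (0 : RN N) R → η x = 0 := fun x hx =>
    image_eq_zero_of_notMem_tsupport fun h => hx (hR h)
  obtain ⟨C, hC0, hC⟩ := H.exists_bound_A_comp T
  have hAu := S.aemeasurable_lim
  -- The size of the `A_t`-term relative to the coercive one; the exponent `c² / 4` in `ψ` is tuned
  -- to it.
  set c := C / (p * α₀) with hc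
  have hc0 : 0 ≤ c := by positivity
  set ψ := expPow (c ^ 2 / 4) with hψ
  have hψs : ContDiff ℝ ∞ ψ := contDiff_expPow _
  have hψ' : Continuous (deriv ψ) := hψs.continuous_deriv (by simp)
  obtain ⟨Cs, hCs0, hCs⟩ := hψs.continuous.exists_abs_le_of_abs_le (2 * T)
  obtain ⟨Cd, hCd0, hCd⟩ := hψ'.exists_abs_le_of_abs_le (2 * T)
  have hz : ∀ j, ∀ᵐ x, |w j x - u x| ≤ 2 * T := fun j => by
    filter_upwards [S.bdd j, S.bdd_lim] with x h1 h2
    exact (abs_sub _ _).trans (by linarith)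
  have hzm : ∀ j, AEMeasurable fun x => w j x - u x := fun j => (S.aemeasurable j).sub hAu
  set s : ℕ → RN N → ℝ := fun j x => ψ (w j x - u x) with hs
  set d : ℕ → RN N → ℝ := fun j x => deriv ψ (w j x - u x) with hd
  have hsm : ∀ j, AEMeasurable (s j) := fun j => hψs.continuous.measurable.comp_aemeasurable (hzm j)
  have hdm : ∀ j, AEMeasurable (d j) := fun j => hψ'.measurable.comp_aemeasurable (hzm j)
  have hsC : ∀ j, ∀ᵐ x, |s j x| ≤ Cs := fun j => by
    filter_upwards [hz j] with x hx using hCs _ hx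
  have hdC : ∀ j, ∀ᵐ x, |d j x| ≤ Cd := fun j => by
    filter_upwards [hz j] with x hx using hCd _ hx
  have hzt : ∀ᵐ x, Tendsto (fun j => w j x - u x) atTop (𝓝 0) := by
    filter_upwards [S.ae_tendsto] with x hx
    simpa using hx.sub_const (u x)
  have hst : ∀ᵐ x, Tendsto (fun j => s j x) atTop (𝓝 0) := by
    filter_upwards [hzt] with x hx
    have h0 := (hψs.continuous.tendsto 0).comp hx
    rwa [show ψ 0 = 0 from expPow_zero _] at h0
  have hdt : ∀ᵐ x, Tendsto (fun j => d j x) atTop (𝓝 1) := by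
    filter_upwards [hzt] with x hx
    have h0 := (hψ'.tendsto 0).comp hx
    rwa [deriv_expPow_zero] at h0
  have hηm : AEMeasurable η := hη.continuous.aemeasurable
  have hη1 : ∀ x, |η x| ≤ 1 := fun x => by rw [abs_of_nonneg (hη01 x).1]; exact (hη01 x).2
  have hAm : ∀ j, AEMeasurable fun x => A x (w j x) := fun j => H.aemeasurable_A (S.aemeasurable j)
  -- the test functions
  have hzX : ∀ j, MemX p V (w j - u) := fun j => (S.memX j).sub hp0 H.measV S.memX_lim
  have hvX : ∀ j, MemX p V (fun x => η x * s j x) := fun j =>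
    ((hzX j).comp_of_bounded hp.le H.measV hψs (expPow_zero _)).1.mul_test hp0 H.measV hη
  have hvg : ∀ j, weakGrad (fun x => η x * s j x) =ᵐ[volume] fun x =>
      η x • d j x • (weakGrad (w j) x - weakGrad u x) + s j x • gradient η x := fun j => by
    obtain ⟨h1, h2⟩ := (hzX j).comp_of_bounded hp.le H.measV hψs (expPow_zero _)
    filter_upwards [h1.1.1.weakGrad_mul_test hη, h2,
      (S.memX j).1.1.weakGrad_sub S.memX_lim.1.1] with x e1 e2 e3
    refine e1.trans ?_
    rw [e2, e3]
    rfl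
  have hgw : ∀ j, MemLp (weakGrad (w j)) (ENNReal.ofReal p) := fun j => (S.memX j).1.1.2.2
  have hgu : MemLp (weakGrad u) (ENNReal.ofReal p) := S.memX_lim.1.1.2.2
  have hgη : MemLp (gradient η) (ENNReal.ofReal p) := hη.memLp_gradient _
  obtain ⟨B', hB'⟩ := S.exists_bound_grad_sub H
  -- the remainders
  have hAC : ∀ j, ∀ᵐ x, |A x (w j x)| ≤ C := fun j => (hC _ (S.bdd j)).1
  have c1m : ∀ j, AEMeasurable fun x => A x (w j x) * η x * (d j x - c * |s j x|) := fun j =>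
    ((hAm j).mul hηm).mul ((hdm j).sub ((hsm j).abs.const_mul c))
  have c1C : ∀ j, ∀ᵐ x, |A x (w j x) * η x * (d j x - c * |s j x|)| ≤ C * (Cd + c * Cs + 1) :=
    fun j => by
      filter_upwards [hAC j, hsC j, hdC j] with x h1 h2 h3
      rw [abs_mul, abs_mul]
      have h4 : |(d j x - c * |s j x|)| ≤ Cd + c * Cs + 1 := by
        refine (abs_sub _ _).trans ?_
        rw [abs_mul, abs_abs, abs_of_nonneg hc0]
        nlinarith
      have h5 : |A x (w j x)| * |η x| ≤ C := by
        have := mul_le_mul h1 (hη1 x) (abs_nonneg _) hC0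
        linarith
      exact mul_le_mul h5 h4 (abs_nonneg _) hC0
  have c2m : ∀ j, AEMeasurable fun x => c * η x * A x (w j x) * |s j x| := fun j =>
    ((hηm.const_mul c).mul (hAm j)).mul (hsm j).abs
  have c2C : ∀ j, ∀ᵐ x, |(c * η x * A x (w j x) * |s j x|)| ≤ c * C * Cs := fun j => by
    filter_upwards [hAC j, hsC j] with x h1 h2
    rw [abs_mul, abs_mul, abs_mul, abs_abs, abs_of_nonneg hc0]
    have h3 : c * |η x| * |A x (w j x)| ≤ c * C := by
      have := mul_le_mul (hη1 x) h1 (abs_nonneg _) zero_le_one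
      rw [mul_assoc]
      exact mul_le_mul_of_nonneg_left (by linarith) hc0
    exact mul_le_mul h3 h2 (abs_nonneg _) (by positivity)
  have c3m : ∀ j, AEMeasurable fun x => A x (w j x) * s j x := fun j => (hAm j).mul (hsm j)
  have c3C : ∀ j, ∀ᵐ x, |A x (w j x) * s j x| ≤ C * Cs := fun j => by
    filter_upwards [hAC j, hsC j] with x h1 h2
    rw [abs_mul]
    exact mul_le_mul h1 h2 (abs_nonneg _) hC0
  -- The only remainder that uses weak convergence of gradients. Its coefficient tends to `A(x,u)η`
  -- since `d_j → 1` and `s_j → 0`. In the other two, the coefficient contains `s_j` and tends to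
  -- zero.
  have hR1 : Tendsto (fun j => ∫ x, A x (w j x) * η x * (d j x - c * |s j x|) *
      inner ℝ (pMap p (weakGrad u x)) (weakGrad (w j) x - weakGrad u x)) atTop (𝓝 0) := by
    refine S.weak.tendsto_integral_inner hp H.nonnegV (fun j => (S.memX j).1.1) S.memX_lim.1.1 hB'
      (C := C * (Cd + c * Cs + 1)) (c' := fun x => A x (u x) * η x) (by positivity) c1m
      ((H.aemeasurable_A hAu).mul hηm) c1C ?_ ?_ hgu
    · filter_upwards [(hC _ S.bdd_lim).1] with x h1
      rw [abs_mul]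
      refine mul_le_mul h1 ((hη1 x).trans ?_) (abs_nonneg _) hC0
      have : 0 ≤ Cd + c * Cs := by positivity
      linarith
    · filter_upwards [S.tendsto_A H, hst, hdt] with x h1 h2 h3
      have := (h1.mul_const (η x)).mul (h3.sub (h2.abs.const_mul c))
      simpa using this
  have hR2 : Tendsto (fun j => ∫ x, c * η x * A x (w j x) * |s j x| *
      inner ℝ (pMap p (weakGrad (w j) x)) (weakGrad u x)) atTop (𝓝 0) := by
    refine tendsto_zero_of_abs_integral_le (h := fun j x => |(c * η x * A x (w j x) * |s j x|)| *
        (‖weakGrad (w j) x‖ ^ (p - 1) * ‖weakGrad u x‖)) (fun j => ?_)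
      (fun j => Eventually.of_forall fun x => ?_)
      (tendsto_integral_coeff_mul_rpow_mul hp c2m c2C ?_ hgu hgw S.grad_le)
    · exact integrable_bdd_mul (c2m j).abs (by simpa only [abs_abs] using c2C j)
        (integrable_rpow_sub_one_mul hp (hgw j) hgu)
    · rw [abs_mul]
      exact mul_le_mul_of_nonneg_left (inner_pMap_le hp _ _) (abs_nonneg _)
    · filter_upwards [S.tendsto_A H, hst] with x h1 h2
      simpa using (h1.const_mul (c * η x)).mul h2.abs
  have hR3 : Tendsto (fun j => ∫ x, A x (w j x) * s j x *
      inner ℝ (pMap p (weakGrad (w j) x)) (gradient η x)) atTop (𝓝 0) := by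
    refine tendsto_zero_of_abs_integral_le (h := fun j x => |A x (w j x) * s j x| *
        (‖weakGrad (w j) x‖ ^ (p - 1) * ‖gradient η x‖)) (fun j => ?_)
      (fun j => Eventually.of_forall fun x => ?_)
      (tendsto_integral_coeff_mul_rpow_mul hp c3m c3C ?_ hgη hgw S.grad_le)
    · exact integrable_bdd_mul (c3m j).abs (by simpa only [abs_abs] using c3C j)
        (integrable_rpow_sub_one_mul hp (hgw j) hgη)
    · rw [abs_mul]
      exact mul_le_mul_of_nonneg_left (inner_pMap_le hp _ _) (abs_nonneg _)
    · filter_upwards [S.tendsto_A H, hst] with x h1 h2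
      simpa using h1.mul h2
  obtain ⟨hL1, hL2⟩ := S.tendsto_lower_order H hη hsm hsC hst
  -- the integrated inequality
  have hDi : ∀ j, Integrable fun x => η x * inner ℝ (pMap p (weakGrad (w j) x)
      - pMap p (weakGrad u x)) (weakGrad (w j) x - weakGrad u x) := fun j =>
    integrable_bdd_mul hηm (Eventually.of_forall hη1) (integrable_inner_pMap_sub hp (hgw j) hgu)
  have hvb : ∀ j, ∀ᵐ x, |η x * s j x| ≤ 1 * Cs := fun j => by
    filter_upwards [hsC j] with x hx
    rw [abs_mul]
    exact mul_le_mul (hη1 x) hx (abs_nonneg _) zero_le_one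
  have hineq := fun j => integral_le_of_ae_le_combination (b := α₀ / 2) (c := 1 / p) (hDi j)
    (H.integrable_inner (S.memX j).1.1 (S.bdd j) (hvX j).1.1)
    (H.integrable_partialT (S.memX j).1.1 (S.bdd j) (hηm.mul (hsm j)) (hvb j))
    (integrable_bdd_mul (c1m j) (c1C j) (integrable_inner_pMap hp hgu ((hgw j).sub hgu)))
    (integrable_bdd_mul (c2m j) (c2C j) (integrable_inner_pMap hp (hgw j) hgu))
    (integrable_bdd_mul (c3m j) (c3C j) (integrable_inner_pMap hp (hgw j) hgη))
    (by
      filter_upwards [hvg j, hA2, (hC _ (S.bdd j)).2] with x e1 e2 e3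
      rw [e1]
      exact coercivity_pointwise hp hα₀ (e2 _) e3 (hη01 x).1 (half_le_deriv_expPow_sub c _) _ _ _)
  have hlim := ((((hL2.sub hL1).sub hR1).add hR2).sub hR3).const_mul (2 / α₀)
  simp only [sub_zero, add_zero, mul_zero] at hlim
  refine squeeze_zero' (Eventually.of_forall fun j => integral_nonneg fun x =>
    mul_nonneg (hη01 x).1 (inner_pMap_sub_nonneg hp _ _)) ?_ hlim
  -- The test function lives where `η` does, so it is admissible for all large `j`.
  filter_upwards [S.crit R] with j hj
  have e := hj _ (hvX j) (Eventually.of_forall fun x hx => by rw [hηR x hx, zero_mul])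
  rw [Admissible.dJ_eq] at e
  have h := hineq j
  rw [← le_div_iff₀' (by positivity)] at h
  refine h.trans (le_of_eq ?_)
  have e' : ∀ X : ℝ, X / (α₀ / 2) = 2 / α₀ * X := fun X => by field_simp
  rw [e']
  congr 1
  simp only [Pi.sub_apply, Pi.mul_apply]
  linarith

/-- Local strong convergence of the gradients. -/
theorem tendsto_gradient_ball (S : BoundedCriticalSeq p V A g w u T B)
    (H : Admissible p q a₁ a₂ V A g) {α₀ : ℝ} (hα₀ : 0 < α₀)
    (hA2 : ∀ᵐ x, ∀ t : ℝ, α₀ ≤ A x t) (R : ℝ) :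
    Tendsto (fun j => ∫ x in Metric.closedBall (0 : RN N) R,
      ‖weakGrad (w j) x - weakGrad u x‖ ^ p) atTop (𝓝 0) := by
  obtain ⟨η, hη, hη01, hη1, -⟩ := exists_isTestFunction_cutoff (N := N) R
  have h1 := tendsto_integral_mul_norm_sub_rpow H.one_lt hη.continuous.aemeasurable hη01
    (fun j => (S.memX j).1.1.2.2) S.memX_lim.1.1.2.2 S.grad_le
    (S.tendsto_integral_cutoff H hα₀ hA2 hη hη01)
  refine squeeze_zero (fun j => integral_norm_rpow_nonneg _) (fun j => ?_) h1
  have hi : Integrable fun x => η x * ‖weakGrad (w j) x - weakGrad u x‖ ^ p :=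
    integrable_bdd_mul (C := 1) hη.continuous.aemeasurable (Eventually.of_forall fun x => by
      rw [abs_of_nonneg (hη01 x).1]; exact (hη01 x).2)
      (integrable_norm_rpow H.pos ((S.memX j).1.1.2.2.sub S.memX_lim.1.1.2.2))
  calc ∫ x in Metric.closedBall (0 : RN N) R, ‖weakGrad (w j) x - weakGrad u x‖ ^ p
      = ∫ x in Metric.closedBall (0 : RN N) R, η x * ‖weakGrad (w j) x - weakGrad u x‖ ^ p :=
        setIntegral_congr_fun Metric.isClosed_closedBall.measurableSet fun x hx => by
          simp only [(hη1 x hx).1, one_mul]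
    _ ≤ _ := setIntegral_le_integral hi (Eventually.of_forall fun x =>
        mul_nonneg (hη01 x).1 (Real.rpow_nonneg (norm_nonneg _) _))

end BoundedCriticalSeq

end QuasilinearSchrodinger

namespace QuasilinearSchrodinger

variable {N : ℕ} {p q a₁ a₂ : ℝ} {V : RN N → ℝ} {A g : RN N → ℝ → ℝ}

/-! ### The limit equation -/

theorem tendsto_zero_of_forall_eps {X Y : ℕ → ℝ} {K : ℝ} (hY : Tendsto Y atTop (𝓝 0))
    (h : ∀ ε : ℝ, 0 < ε → ∃ C : ℝ, ∀ j, |X j| ≤ ε * K + C * Y j) : Tendsto X atTop (𝓝 0) := by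
  rw [Metric.tendsto_atTop]
  intro ε hε
  have hε' : 0 < ε / (2 * (|K| + 1)) := by positivity
  obtain ⟨C, hC⟩ := h _ hε'
  have h1 : Tendsto (fun j => C * Y j) atTop (𝓝 0) := by simpa using hY.const_mul C
  obtain ⟨j0, hj0⟩ := (Metric.tendsto_atTop.1 h1) (ε / 2) (by positivity)
  refine ⟨j0, fun j hj => ?_⟩
  have h2 := hj0 j hj
  rw [Real.dist_eq, sub_zero] at h2 ⊢
  have h3 := (abs_lt.1 h2).2
  have h4 : ε / (2 * (|K| + 1)) * K ≤ ε / 2 := by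
    refine (mul_le_mul_of_nonneg_left (le_abs_self K) hε'.le).trans ?_
    rw [div_mul_eq_mul_div, div_le_div_iff₀ (by positivity) (by positivity)]
    nlinarith [abs_nonneg K]
  linarith [hC j]

section Abstract

variable {α E : Type*} [MeasurableSpace α] {ν : Measure α} [NormedAddCommGroup E]
  [InnerProductSpace ℝ E]

theorem tendsto_integral_mul_of_bounded {c : ℕ → α → ℝ} {c' : α → ℝ} {C : ℝ}
    (hcm : ∀ j, AEMeasurable (c j) ν) (hcC : ∀ j, ∀ᵐ x ∂ν, |c j x| ≤ C)
    (hc : ∀ᵐ x ∂ν, Tendsto (fun j => c j x) atTop (𝓝 (c' x))) {h : α → ℝ} (hh : Integrable h ν) :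
    Tendsto (fun j => ∫ x, c j x * h x ∂ν) atTop (𝓝 (∫ x, c' x * h x ∂ν)) :=
  tendsto_integral_of_dominated_convergence (fun x => C * |h x|)
    (fun j => (hcm j).aestronglyMeasurable.mul hh.1) (hh.abs.const_mul C)
    (fun j => by
      filter_upwards [hcC j] with x hx
      rw [norm_mul]
      exact mul_le_mul_of_nonneg_right hx (abs_nonneg _))
    (by
      filter_upwards [hc] with x hx
      exact hx.mul_const (h x))

/-- The increment of `pMap` is bounded by `ε‖f'‖^{p-1} + D‖f_j - f'‖^{p-1}`; paired with `h`, the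
second part is controlled by Hölder, whence the power `(p - 1)/p` of the vanishing integral. The
remaining factor converges by domination. -/
theorem tendsto_integral_inner_pMap [FiniteDimensional ℝ E] {p : ℝ} (hp : 1 < p)
    {c : ℕ → α → ℝ} {c' : α → ℝ} {C : ℝ} (hC : 0 ≤ C)
    (hcm : ∀ j, AEMeasurable (c j) ν) (hcC : ∀ j, ∀ᵐ x ∂ν, |c j x| ≤ C)
    (hc : ∀ᵐ x ∂ν, Tendsto (fun j => c j x) atTop (𝓝 (c' x))) {f : ℕ → α → E} {f' h : α → E}
    (hf : ∀ j, MemLp (f j) (ENNReal.ofReal p) ν) (hf' : MemLp f' (ENNReal.ofReal p) ν)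
    (hh : MemLp h (ENNReal.ofReal p) ν)
    (hlim : Tendsto (fun j => ∫ x, ‖f j x - f' x‖ ^ p ∂ν) atTop (𝓝 0)) :
    Tendsto (fun j => ∫ x, c j x * inner ℝ (pMap p (f j x)) (h x) ∂ν) atTop
      (𝓝 (∫ x, c' x * inner ℝ (pMap p (f' x)) (h x) ∂ν)) := by
  have hp1 : 0 < (p - 1) / p := div_pos (by linarith) (by linarith)
  have h1 := tendsto_integral_mul_of_bounded hcm hcC hc (integrable_inner_pMap hp hf' hh)
  have hY : Tendsto (fun j => (∫ x, ‖f j x - f' x‖ ^ p ∂ν) ^ ((p - 1) / p)) atTop (𝓝 0) := by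
    have := hlim.rpow_const (p := (p - 1) / p) (Or.inr hp1.le)
    rwa [Real.zero_rpow hp1.ne'] at this
  have h2 : Tendsto (fun j => ∫ x, c j x * inner ℝ (pMap p (f j x) - pMap p (f' x)) (h x) ∂ν)
      atTop (𝓝 0) := by
    refine tendsto_zero_of_forall_eps (K := C * ∫ x, ‖f' x‖ ^ (p - 1) * ‖h x‖ ∂ν) hY
      fun ε hε => ?_
    obtain ⟨D, hD0, hD⟩ := exists_norm_pMap_sub_le (E := E) hp hε
    refine ⟨C * D * (∫ x, ‖h x‖ ^ p ∂ν) ^ (1 / p), fun j => ?_⟩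
    have i1 := (integrable_rpow_sub_one_mul hp hf' hh).const_mul (C * ε)
    have i2 := (integrable_rpow_sub_one_mul hp ((hf j).sub hf') hh).const_mul (C * D)
    have h3 := norm_integral_le_of_norm_le
      (f := fun x => c j x * inner ℝ (pMap p (f j x) - pMap p (f' x)) (h x)) (i1.add i2) (by
        filter_upwards [hcC j] with x hx
        have h4 := hD (f' x) (f j x - f' x)
        rw [add_sub_cancel] at h4
        rw [norm_mul]
        refine (mul_le_mul hx ((norm_inner_le_norm _ _).trans
          (mul_le_mul_of_nonneg_right h4 (norm_nonneg _))) (norm_nonneg _) hC).trans (le_of_eq ?_)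
        simp only [Pi.add_apply, Pi.sub_apply]
        ring)
    simp only [Pi.add_apply] at h3
    rw [integral_add i1 i2, integral_const_mul, integral_const_mul] at h3
    have h5 := mul_le_mul_of_nonneg_left
      (integral_rpow_sub_one_mul_le hp ((hf j).sub hf') hh) (mul_nonneg hC hD0)
    simp only [Pi.sub_apply] at h3 h5
    rw [Real.norm_eq_abs] at h3
    linarith
  have h3 := h2.add h1
  rw [zero_add] at h3
  refine h3.congr fun j => ?_
  have i3 := integrable_bdd_mul (hcm j) (hcC j) (integrable_inner_pMap hp (hf j) hh)
  have i4 := integrable_bdd_mul (hcm j) (hcC j) (integrable_inner_pMap hp hf' hh)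
  simp_rw [inner_sub_left, mul_sub]
  rw [integral_sub i3 i4, sub_add_cancel]

theorem tendsto_integral_mul_norm_rpow [FiniteDimensional ℝ E] {p : ℝ} (hp : 0 < p)
    {c : ℕ → α → ℝ} {c' : α → ℝ} {C : ℝ} (hC : 0 ≤ C)
    (hcm : ∀ j, AEMeasurable (c j) ν) (hcC : ∀ j, ∀ᵐ x ∂ν, |c j x| ≤ C)
    (hc : ∀ᵐ x ∂ν, Tendsto (fun j => c j x) atTop (𝓝 (c' x))) {f : ℕ → α → E} {f' : α → E}
    (hf : ∀ j, MemLp (f j) (ENNReal.ofReal p) ν) (hf' : MemLp f' (ENNReal.ofReal p) ν)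
    (hlim : Tendsto (fun j => ∫ x, ‖f j x - f' x‖ ^ p ∂ν) atTop (𝓝 0)) :
    Tendsto (fun j => ∫ x, c j x * ‖f j x‖ ^ p ∂ν) atTop (𝓝 (∫ x, c' x * ‖f' x‖ ^ p ∂ν)) := by
  have h1 := tendsto_integral_mul_of_bounded hcm hcC hc (integrable_norm_rpow hp hf')
  have h2 : Tendsto (fun j => ∫ x, c j x * (‖f j x‖ ^ p - ‖f' x‖ ^ p) ∂ν) atTop (𝓝 0) := by
    refine tendsto_zero_of_forall_eps (K := C * ∫ x, ‖f' x‖ ^ p ∂ν) hlim fun ε hε => ?_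
    obtain ⟨D, hD0, hD⟩ := exists_abs_norm_rpow_sub_le E hp hε
    refine ⟨C * D, fun j => ?_⟩
    have i1 := (integrable_norm_rpow hp hf').const_mul (C * ε)
    have i2 := (integrable_norm_rpow hp ((hf j).sub hf')).const_mul (C * D)
    have h3 := norm_integral_le_of_norm_le
      (f := fun x => c j x * (‖f j x‖ ^ p - ‖f' x‖ ^ p)) (i1.add i2) (by
        filter_upwards [hcC j] with x hx
        have h4 := hD (f' x) (f j x - f' x)
        rw [add_sub_cancel] at h4
        rw [norm_mul]
        refine (mul_le_mul hx h4 (abs_nonneg _) hC).trans (le_of_eq ?_)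
        simp only [Pi.add_apply, Pi.sub_apply]
        ring)
    simp only [Pi.add_apply] at h3
    rw [integral_add i1 i2, integral_const_mul, integral_const_mul] at h3
    simp only [Pi.sub_apply] at h3
    rw [Real.norm_eq_abs] at h3
    linarith
  have h3 := h2.add h1
  rw [zero_add] at h3
  refine h3.congr fun j => ?_
  have i3 := integrable_bdd_mul (hcm j) (hcC j) (integrable_norm_rpow hp (hf j))
  have i4 := integrable_bdd_mul (hcm j) (hcC j) (integrable_norm_rpow hp hf')
  simp_rw [mul_sub]
  rw [integral_sub i3 i4, sub_add_cancel]

end Abstract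

/-- The weak gradient vanishes almost everywhere away from the support. -/
theorem MemW.weakGrad_eq_zero_off_ball {u : RN N → ℝ} (hu : MemW p u) {R : ℝ}
    (hR : ∀ᵐ x, x ∉ Metric.closedBall (0 : RN N) R → u x = 0) :
    ∀ᵐ x, x ∉ Metric.closedBall (0 : RN N) (|R| + 2) → weakGrad u x = 0 := by
  obtain ⟨η, hη, -, hη1, hη0⟩ := exists_isTestFunction_cutoff (N := N) R
  have h1 : (fun x => η x * u x) =ᵐ[volume] u := by
    filter_upwards [hR] with x hx
    by_cases hxR : x ∈ Metric.closedBall (0 : RN N) R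
    · rw [(hη1 x hxR).1, one_mul]
    · rw [hx hxR, mul_zero]
  have h2 := ((hu.2.1.mul_test hη).congr h1 EventuallyEq.rfl).weakGrad_ae_eq
  filter_upwards [h2] with x hx hxR
  rw [hx, (hη0 x hxR).1, (hη0 x hxR).2, zero_smul, smul_zero, add_zero]

theorem abs_pMap_le {t T : ℝ} (hp : 1 < p) (ht : |t| ≤ T) : |pMap p t| ≤ T ^ (p - 1) := by
  have := norm_pMap hp t
  rw [Real.norm_eq_abs, Real.norm_eq_abs] at this
  rw [this]
  exact Real.rpow_le_rpow (abs_nonneg _) ht (by linarith)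

/-- All four integrals live on a fixed ball, where the gradients converge strongly in `L^p`, the
zero order coefficients are bounded and converge almost everywhere, and `V` is bounded. So each one
passes to the limit. -/
theorem BoundedCriticalSeq.dJ_eq_zero_of_compactSupport {w : ℕ → RN N → ℝ} {u : RN N → ℝ}
    {T B : ℝ} (S : BoundedCriticalSeq p V A g w u T B)
    (H : Admissible p q a₁ a₂ V A g) {α₀ : ℝ} (hα₀ : 0 < α₀)
    (hA2 : ∀ᵐ x, ∀ t : ℝ, α₀ ≤ A x t) {v : RN N → ℝ} (hv : MemX p V v) {R : ℝ}
    (hR : ∀ᵐ x, x ∉ Metric.closedBall (0 : RN N) R → v x = 0) : dJ p A V g u v = 0 := by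
  have hp := H.one_lt
  obtain ⟨C, hC0, hC⟩ := H.exists_bound_A_comp T
  obtain ⟨D, hD0, hD⟩ := H.exists_bound_g T
  obtain ⟨M, hM0, hM⟩ := hv.exists_bound
  have hvm : AEMeasurable v := hv.1.1.1.1.aemeasurable
  -- The enlarged radius is the one outside which `weakGrad_eq_zero_off_ball` makes the gradient of
  -- `v` vanish.
  set K := Metric.closedBall (0 : RN N) (|R| + 2) with hK
  set ν := (volume : Measure (RN N)).restrict K with hν
  have hvK : ∀ᵐ x, x ∉ K → v x = 0 := by
    filter_upwards [hR] with x hx hxK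
    refine hx fun hxR => hxK (Metric.closedBall_subset_closedBall ?_ hxR)
    linarith [le_abs_self R]
  have hgK := hv.1.1.weakGrad_eq_zero_off_ball hR
  have : IsFiniteMeasure ν := ⟨by
    rw [hν, Measure.restrict_apply_univ]
    exact (isCompact_closedBall _ _).measure_lt_top⟩
  have hvi : Integrable v ν := by
    refine Integrable.of_bound hvm.aestronglyMeasurable.restrict M ?_
    exact ae_restrict_of_ae hM
  obtain ⟨L, hL0, hL⟩ := H.locBddV (|R| + 2) (by positivity)
  have hVvi : Integrable (fun x => V x * v x) ν := by
    refine Integrable.of_bound (H.measV.mul hvm).aestronglyMeasurable.restrict (L * M) ?_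
    rw [hν, ae_restrict_iff' Metric.isClosed_closedBall.measurableSet]
    filter_upwards [hL, hM, H.nonnegV] with x h1 h2 h3 hx
    rw [mem_closedBall_zero_iff] at hx
    rw [norm_mul]
    refine mul_le_mul ?_ h2 (norm_nonneg _) hL0.le
    rw [Real.norm_eq_abs, abs_of_nonneg h3]
    exact h1 hx
  have hgw : ∀ j, MemLp (weakGrad (w j)) (ENNReal.ofReal p) ν := fun j =>
    (S.memX j).1.1.2.2.restrict K
  have hgu : MemLp (weakGrad u) (ENNReal.ofReal p) ν := S.memX_lim.1.1.2.2.restrict K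
  have hgv : MemLp (weakGrad v) (ENNReal.ofReal p) ν := hv.1.1.2.2.restrict K
  have hlim := S.tendsto_gradient_ball H hα₀ hA2 (|R| + 2)
  have l1 := tendsto_integral_inner_pMap (ν := ν) hp hC0
    (fun j => (H.aemeasurable_A (S.aemeasurable j)).restrict)
    (fun j => ae_restrict_of_ae (hC _ (S.bdd j)).1) (ae_restrict_of_ae (S.tendsto_A H))
    hgw hgu hgv hlim
  have l2 := tendsto_integral_mul_norm_rpow (ν := ν) H.pos (mul_nonneg hC0 hM0)
    (c := fun j x => partialT A x (w j x) * v x) (c' := fun x => partialT A x (u x) * v x)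
    (fun j => ((H.aemeasurable_At (S.aemeasurable j)).mul hvm).restrict)
    (fun j => ae_restrict_of_ae (by
      filter_upwards [(hC _ (S.bdd j)).2, hM] with x h1 h2
      rw [abs_mul]
      exact mul_le_mul h1 h2 (abs_nonneg _) hC0))
    (ae_restrict_of_ae (by
      filter_upwards [S.tendsto_partialT H] with x hx using hx.mul_const (v x))) hgw hgu hlim
  have l3 := tendsto_integral_mul_of_bounded (ν := ν) (C := T ^ (p - 1))
    (c := fun j x => pMap p (w j x)) (c' := fun x => pMap p (u x))
    (fun j => ((continuous_pMap hp).measurable.comp_aemeasurable (S.aemeasurable j)).restrict)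
    (fun j => ae_restrict_of_ae (by
      filter_upwards [S.bdd j] with x hx using abs_pMap_le hp hx))
    (ae_restrict_of_ae (by
      filter_upwards [S.ae_tendsto] with x hx using ((continuous_pMap hp).tendsto _).comp hx)) hVvi
  have l4 := tendsto_integral_mul_of_bounded (ν := ν) (C := D * T ^ (p - 1))
    (c := fun j x => g x (w j x)) (c' := fun x => g x (u x))
    (fun j => (H.aemeasurable_g (S.aemeasurable j)).restrict)
    (fun j => ae_restrict_of_ae (by
      filter_upwards [S.bdd j, hD] with x h1 h2
      exact (h2 _ h1).trans (mul_le_mul_of_nonneg_left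
        (Real.rpow_le_rpow (abs_nonneg _) h1 (by linarith)) hD0)))
    (ae_restrict_of_ae (S.tendsto_g H)) hvi
  have hdJ : ∀ z : RN N → ℝ, dJ p A V g z v =
      (∫ x, A x (z x) * inner ℝ (pMap p (weakGrad z x)) (weakGrad v x) ∂ν)
      + (1 / p) * (∫ x, partialT A x (z x) * v x * ‖weakGrad z x‖ ^ p ∂ν)
      + (∫ x, pMap p (z x) * (V x * v x) ∂ν) - ∫ x, g x (z x) * v x ∂ν := fun z => by
    rw [Admissible.dJ_eq, hν, setIntegral_eq_integral_of_ae_compl_eq_zero,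
      setIntegral_eq_integral_of_ae_compl_eq_zero, setIntegral_eq_integral_of_ae_compl_eq_zero,
      setIntegral_eq_integral_of_ae_compl_eq_zero]
    · congr 2
      refine integral_congr_ae (Eventually.of_forall fun x => ?_)
      simp only [pMap, smul_eq_mul, Real.norm_eq_abs]
      ring
    · filter_upwards [hvK] with x hx hxK
      rw [hx hxK, mul_zero]
    · filter_upwards [hvK] with x hx hxK
      rw [hx hxK, mul_zero, mul_zero]
    · filter_upwards [hvK] with x hx hxK
      rw [hx hxK, mul_zero, zero_mul]
    · filter_upwards [hgK] with x hx hxK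
      rw [hx hxK, inner_zero_right, mul_zero]
  have l5 := ((l1.add (l2.const_mul (1 / p))).add l3).sub l4
  rw [← hdJ u] at l5
  refine tendsto_nhds_unique l5 (tendsto_const_nhds.congr' ?_)
  filter_upwards [S.crit R] with j hj
  rw [← hdJ (w j), hj v hv hR]

/-- A functional `dJ(u)` vanishing on the compactly supported elements of `X` vanishes on `X`. -/
theorem Admissible.dJ_eq_zero_of_forall_compactSupport (H : Admissible p q a₁ a₂ V A g)
    {u : RN N → ℝ} (hu : MemX p V u)
    (h0 : ∀ (R : ℝ) (v : RN N → ℝ), MemX p V v →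
      (∀ᵐ x, x ∉ Metric.closedBall (0 : RN N) R → v x = 0) → dJ p A V g u v = 0)
    {v : RN N → ℝ} (hv : MemX p V v) : dJ p A V g u v = 0 := by
  have hp := H.one_lt
  obtain ⟨T, hT0, hT⟩ := hu.exists_bound
  obtain ⟨M, hM0, hM⟩ := hv.exists_bound
  obtain ⟨C, hC0, hC⟩ := H.exists_bound_A_comp T
  obtain ⟨η, hη, hη01, hη1, hη0⟩ := exists_isTestFunction_cutoff (N := N) 1
  obtain ⟨D, hD0, hD⟩ := hη.exists_bound_gradient
  set r : ℕ → ℝ := fun n => 1 / ((n : ℝ) + 1) with hr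
  have hr0 : ∀ n, 0 < r n := fun n => by simp only [hr]; positivity
  have hr1 : ∀ n, r n ≤ 1 := fun n => by
    simp only [hr]
    rw [div_le_one (by positivity)]
    linarith [Nat.cast_nonneg (α := ℝ) n]
  have hrt : Tendsto r atTop (𝓝 0) := tendsto_one_div_add_atTop_nhds_zero_nat
  -- Dilated cutoffs: their gradients are bounded uniformly in `n`, and at each point `ζ n = 1` with
  -- zero gradient for large `n`. Hence the integrals for `ζ n v` converge by domination.
  set ζ : ℕ → RN N → ℝ := fun n x => η (r n • x) with hζ
  have hζt : ∀ n, IsTestFunction (ζ n) := fun n =>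
    ⟨hη.1.comp (contDiff_const_smul (r n)), hη.2.comp_homeomorph
      (Homeomorph.smulOfNeZero (r n) (hr0 n).ne')⟩
  have hζg : ∀ n x, gradient (ζ n) x = r n • gradient η (r n • x) := fun n x => by
    have h1 : HasFDerivAt (ζ n) ((fderiv ℝ η (r n • x)).comp
        (r n • ContinuousLinearMap.id ℝ (RN N))) x :=
      (hη.differentiableAt _).hasFDerivAt.comp x ((hasFDerivAt_id x).const_smul (r n))
    rw [gradient, h1.fderiv, gradient, ContinuousLinearMap.comp_smul,
      ContinuousLinearMap.comp_id, map_smul]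
  have hζ1 : ∀ n x, |ζ n x| ≤ 1 := fun n x => by
    rw [abs_of_nonneg (hη01 _).1]; exact (hη01 _).2
  have hζlim : ∀ x, ∀ᶠ n in atTop, ζ n x = 1 ∧ gradient (ζ n) x = 0 := fun x => by
    have h1 : Tendsto (fun n => ‖r n • x‖) atTop (𝓝 0) := by
      simpa using (hrt.smul_const x).norm
    filter_upwards [h1.eventually_lt_const (zero_lt_one)] with n hn
    have h2 := hη1 (r n • x) (by rw [mem_closedBall_zero_iff]; exact hn.le)
    exact ⟨h2.1, by rw [hζg, h2.2, smul_zero]⟩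
  have hζc : ∀ x, Tendsto (fun n => ζ n x) atTop (𝓝 1) := fun x =>
    tendsto_const_nhds.congr' (by filter_upwards [hζlim x] with n hn using hn.1.symm)
  have hζm : ∀ n, AEMeasurable (ζ n) := fun n => (hζt n).continuous.aemeasurable
  have base : ∀ {h : RN N → ℝ}, Integrable h →
      Tendsto (fun n => ∫ x, ζ n x * h x) atTop (𝓝 (∫ x, h x)) := fun {h} hh => by
    have := tendsto_integral_mul_of_bounded (c' := fun _ => 1) hζm
      (fun n => Eventually.of_forall (hζ1 n)) (Eventually.of_forall hζc) hh
    simpa using this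
  have hum : AEMeasurable u := hu.1.1.1.1.aemeasurable
  have l1 : Tendsto (fun n => ∫ x, A x (u x) * inner ℝ (pMap p (weakGrad u x))
      (weakGrad (fun x => ζ n x * v x) x)) atTop
      (𝓝 (∫ x, A x (u x) * inner ℝ (pMap p (weakGrad u x)) (weakGrad v x))) := by
    refine tendsto_integral_of_dominated_convergence
      (fun x => C * (‖weakGrad u x‖ ^ (p - 1) * ‖weakGrad v x‖
        + D * (‖weakGrad u x‖ ^ (p - 1) * ‖v x‖)))
      (fun n => (H.integrable_inner hu.1.1 hT (hv.1.1.mul_test (hζt n))).1)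
      (((integrable_rpow_sub_one_mul hp hu.1.1.2.2 hv.1.1.2.2).add
        ((integrable_rpow_sub_one_mul hp hu.1.1.2.2 hv.1.1.1).const_mul D)).const_mul C)
      (fun n => ?_) ?_
    · filter_upwards [hv.1.1.weakGrad_mul_test (hζt n), (hC _ hT).1] with x h1 h2
      rw [h1, norm_mul]
      refine mul_le_mul h2 ((inner_pMap_le hp _ _).trans ?_) (norm_nonneg _) hC0
      have h3 : ‖ζ n x • weakGrad v x + v x • gradient (ζ n) x‖
          ≤ ‖weakGrad v x‖ + D * ‖v x‖ := by
        refine (norm_add_le _ _).trans (add_le_add ?_ ?_)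
        · rw [norm_smul]
          exact mul_le_of_le_one_left (norm_nonneg _) (hζ1 n x)
        · rw [norm_smul, mul_comm]
          refine mul_le_mul_of_nonneg_right ?_ (norm_nonneg _)
          rw [hζg, norm_smul, Real.norm_eq_abs, abs_of_pos (hr0 n)]
          exact (mul_le_mul (hr1 n) (hD _) (norm_nonneg _) zero_le_one).trans (one_mul D).le
      refine (mul_le_mul_of_nonneg_left h3 (Real.rpow_nonneg (norm_nonneg _) _)).trans
        (le_of_eq ?_)
      ring
    · filter_upwards [ae_all_iff.2 fun n => hv.1.1.weakGrad_mul_test (hζt n)] with x hx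
      refine tendsto_const_nhds.congr' ?_
      filter_upwards [hζlim x] with n hn
      rw [hx n, hn.1, hn.2, one_smul, smul_zero, add_zero]
  have l2 := base (H.integrable_partialT hu.1.1 hT hv.1.1.1.1.aemeasurable hM)
  have l3 := base (H.integrable_weight hu.1 hv.1)
  have l4 := base (H.integrable_g hu.1.1.1 hT hv.1.1.1)
  have l5 := ((l1.add (l2.const_mul (1 / p))).add l3).sub l4
  rw [← Admissible.dJ_eq] at l5
  refine tendsto_nhds_unique l5 (tendsto_const_nhds.congr fun n => ?_)
  -- `η` vanishes outside radius `|1| + 2 = 3`, so `ζ n` vanishes outside radius `3 / r n`.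
  have h1 := h0 (3 / r n) _ (hv.mul_test H.pos H.measV (hζt n)) (Eventually.of_forall fun x hx => by
    have h2 : r n • x ∉ Metric.closedBall (0 : RN N) (|1| + 2) := by
      rw [mem_closedBall_zero_iff, not_le] at hx ⊢
      rw [norm_smul, Real.norm_eq_abs, abs_of_pos (hr0 n)]
      rw [div_lt_iff₀ (hr0 n)] at hx
      rw [abs_one]
      linarith
    simp only [hζ, (hη0 _ h2).1, zero_mul])
  rw [Admissible.dJ_eq] at h1
  rw [← h1]
  congr 1
  · congr 1
    · congr 2
      refine integral_congr_ae (Eventually.of_forall fun x => ?_)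
      simp only
      ring
    · refine integral_congr_ae (Eventually.of_forall fun x => ?_)
      simp only
      ring
  · refine integral_congr_ae (Eventually.of_forall fun x => ?_)
    simp only
    ring

end QuasilinearSchrodinger

namespace QuasilinearSchrodinger

variable {N : ℕ} {p q a₁ a₂ : ℝ} {V : RN N → ℝ} {A g : RN N → ℝ → ℝ}

/-! ### The differential is a bounded linear functional -/

theorem integral_weight_nonneg (hV : ∀ᵐ x, 0 ≤ V x) (u : RN N → ℝ) :
    0 ≤ ∫ x, V x * |u x| ^ p := by
  refine integral_nonneg_of_ae ?_
  filter_upwards [hV] with x hx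
  simp only [Pi.zero_apply]
  positivity

theorem normV_nonneg (hV : ∀ᵐ x, 0 ≤ V x) (u : RN N → ℝ) : 0 ≤ normV p V u :=
  Real.rpow_nonneg (add_nonneg (integral_norm_rpow_nonneg _) (integral_weight_nonneg hV u)) _

theorem normV_le_normX (u : RN N → ℝ) : normV p V u ≤ normX p V u :=
  le_add_of_nonneg_right ENNReal.toReal_nonneg

theorem normX_nonneg (hV : ∀ᵐ x, 0 ≤ V x) (u : RN N → ℝ) : 0 ≤ normX p V u :=
  (normV_nonneg hV u).trans (normV_le_normX u)

theorem MemX.ae_abs_le_normX (hV : ∀ᵐ x, 0 ≤ V x) {u : RN N → ℝ} (hu : MemX p V u) :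
    ∀ᵐ x, |u x| ≤ normX p V u := by
  filter_upwards [hu.ae_abs_le] with x hx
  exact hx.trans (le_add_of_nonneg_left (normV_nonneg hV u))

theorem integral_weight_rpow_le_normV (hp : 0 < p) (hV : ∀ᵐ x, 0 ≤ V x) (u : RN N → ℝ) :
    (∫ x, V x * |u x| ^ p) ^ (1 / p) ≤ normV p V u :=
  Real.rpow_le_rpow (integral_weight_nonneg hV u)
    (le_add_of_nonneg_left (integral_norm_rpow_nonneg _)) (by positivity)

/-- `V^{1/p} u`, which belongs to `L^p` for `u ∈ W_V^{1,p}`. -/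
noncomputable def weighted (p : ℝ) (V u : RN N → ℝ) (x : RN N) : ℝ := V x ^ (1 / p) * u x

theorem abs_weighted_rpow (hp : 0 < p) {x : RN N} (hV : 0 ≤ V x) (u : RN N → ℝ) :
    ‖weighted p V u x‖ ^ p = V x * |u x| ^ p := by
  rw [weighted, Real.norm_eq_abs, abs_mul, abs_of_nonneg (Real.rpow_nonneg hV _),
    Real.mul_rpow (Real.rpow_nonneg hV _) (abs_nonneg _), ← Real.rpow_mul hV,
    one_div_mul_cancel hp.ne', Real.rpow_one]

theorem abs_weighted_rpow_sub_one_mul (hp : 1 < p) {x : RN N} (hV : 0 ≤ V x) (u v : RN N → ℝ) :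
    ‖weighted p V u x‖ ^ (p - 1) * ‖weighted p V v x‖ = V x * (|u x| ^ (p - 1) * |v x|) := by
  have hp0 : 0 < p := by linarith
  have h1 := Real.rpow_nonneg hV (1 / p)
  rw [weighted, weighted, Real.norm_eq_abs, Real.norm_eq_abs, abs_mul, abs_mul, abs_of_nonneg h1,
    Real.mul_rpow h1 (abs_nonneg _), ← Real.rpow_mul hV]
  have h2 : V x ^ (1 / p * (p - 1)) * V x ^ (1 / p) = V x := by
    rw [← Real.rpow_add_of_nonneg hV (mul_nonneg (by positivity) (by linarith)) (by positivity),
      show 1 / p * (p - 1) + 1 / p = 1 by field_simp; ring, Real.rpow_one]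
  rw [show V x ^ (1 / p * (p - 1)) * |u x| ^ (p - 1) * (V x ^ (1 / p) * |v x|)
    = V x ^ (1 / p * (p - 1)) * V x ^ (1 / p) * (|u x| ^ (p - 1) * |v x|) by ring, h2]

theorem MemWV.memLp_weighted (hp : 0 < p) (hVm : AEMeasurable V) (hV : ∀ᵐ x, 0 ≤ V x)
    {u : RN N → ℝ} (hu : MemWV p V u) : MemLp (weighted p V u) (ENNReal.ofReal p) := by
  refine memLp_of_integrable_norm_rpow hp
    ((hVm.pow_const _).mul hu.1.1.1.aemeasurable).aestronglyMeasurable (hu.2.congr ?_)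
  filter_upwards [hV] with x hx
  exact (abs_weighted_rpow hp hx u).symm

theorem integrable_weight_mul (hp : 1 < p) (hVm : AEMeasurable V) (hV : ∀ᵐ x, 0 ≤ V x)
    {u v : RN N → ℝ} (hu : MemWV p V u) (hv : MemWV p V v) :
    Integrable fun x => V x * (|u x| ^ (p - 1) * |v x|) := by
  have hp0 : 0 < p := by linarith
  refine (integrable_rpow_sub_one_mul hp (hu.memLp_weighted hp0 hVm hV)
    (hv.memLp_weighted hp0 hVm hV)).congr ?_
  filter_upwards [hV] with x hx using abs_weighted_rpow_sub_one_mul hp hx u v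

theorem integral_weight_mul_le (hp : 1 < p) (hVm : AEMeasurable V) (hV : ∀ᵐ x, 0 ≤ V x)
    {u v : RN N → ℝ} (hu : MemWV p V u) (hv : MemWV p V v) :
    ∫ x, V x * (|u x| ^ (p - 1) * |v x|)
      ≤ (∫ x, V x * |u x| ^ p) ^ ((p - 1) / p) * (∫ x, V x * |v x| ^ p) ^ (1 / p) := by
  have hp0 : 0 < p := by linarith
  have h := integral_rpow_sub_one_mul_le hp (hu.memLp_weighted hp0 hVm hV)
    (hv.memLp_weighted hp0 hVm hV)
  have e1 : ∀ z : RN N → ℝ, ∫ x, ‖weighted p V z x‖ ^ p = ∫ x, V x * |z x| ^ p := fun z =>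
    integral_congr_ae (by filter_upwards [hV] with x hx using abs_weighted_rpow hp0 hx z)
  have e2 : ∫ x, ‖weighted p V u x‖ ^ (p - 1) * ‖weighted p V v x‖
      = ∫ x, V x * (|u x| ^ (p - 1) * |v x|) :=
    integral_congr_ae (by
      filter_upwards [hV] with x hx using abs_weighted_rpow_sub_one_mul hp hx u v)
  rwa [e1, e1, e2] at h

namespace Admissible

theorem dJ_add (H : Admissible p q a₁ a₂ V A g) {u v w : RN N → ℝ} (hu : MemX p V u)
    (hv : MemX p V v) (hw : MemX p V w) :
    dJ p A V g u (v + w) = dJ p A V g u v + dJ p A V g u w := by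
  obtain ⟨T, -, hT⟩ := hu.exists_bound
  obtain ⟨M, -, hM⟩ := hv.exists_bound
  obtain ⟨M', -, hM'⟩ := hw.exists_bound
  have e1 : ∫ x, A x (u x) * inner ℝ (pMap p (weakGrad u x)) (weakGrad (v + w) x)
      = (∫ x, A x (u x) * inner ℝ (pMap p (weakGrad u x)) (weakGrad v x))
        + ∫ x, A x (u x) * inner ℝ (pMap p (weakGrad u x)) (weakGrad w x) := by
    rw [← integral_add (H.integrable_inner hu.1.1 hT hv.1.1) (H.integrable_inner hu.1.1 hT hw.1.1)]
    refine integral_congr_ae ?_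
    filter_upwards [hv.1.1.weakGrad_add hw.1.1] with x hx
    rw [hx, Pi.add_apply, inner_add_right, mul_add]
  have e2 := integral_add
    (H.integrable_partialT hu.1.1 hT hv.1.1.1.1.aemeasurable hM)
    (H.integrable_partialT hu.1.1 hT hw.1.1.1.1.aemeasurable hM')
  have e3 := integral_add (H.integrable_weight hu.1 hv.1) (H.integrable_weight hu.1 hw.1)
  have e4 := integral_add (H.integrable_g hu.1.1.1 hT hv.1.1.1) (H.integrable_g hu.1.1.1 hT hw.1.1.1)
  rw [dJ_eq, dJ_eq, dJ_eq, e1]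
  simp only [Pi.add_apply, mul_add, add_mul] at e2 e3 e4 ⊢
  rw [e2, e3, e4]
  ring

theorem dJ_smul {u v : RN N → ℝ} (c : ℝ) (hv : MemX p V v) :
    dJ p A V g u (c • v) = c * dJ p A V g u v := by
  have e1 : ∫ x, A x (u x) * inner ℝ (pMap p (weakGrad u x)) (weakGrad (c • v) x)
      = c * ∫ x, A x (u x) * inner ℝ (pMap p (weakGrad u x)) (weakGrad v x) := by
    rw [← integral_const_mul]
    refine integral_congr_ae ?_
    filter_upwards [hv.1.1.weakGrad_smul c] with x hx
    rw [hx, Pi.smul_apply, inner_smul_right, mul_left_comm]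
  have e2 : ∀ f h : RN N → ℝ, ∫ x, f x * (c • v) x * h x = c * ∫ x, f x * v x * h x :=
    fun f h => by
      rw [← integral_const_mul]
      refine integral_congr_ae (Eventually.of_forall fun x => ?_)
      simp only [Pi.smul_apply, smul_eq_mul]
      ring
  have e3 : ∀ f : RN N → ℝ, ∫ x, f x * (c • v) x = c * ∫ x, f x * v x := fun f => by
    rw [← integral_const_mul]
    refine integral_congr_ae (Eventually.of_forall fun x => ?_)
    simp only [Pi.smul_apply, smul_eq_mul]
    ring
  rw [dJ_eq, dJ_eq, e1, e2, e3, e3]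
  ring

/-- Only the `A_t`-term needs the `L^∞` part of the norm. The other terms are bounded by `normV`
through Hölder, the one with `g` after the embedding into `L^p`. -/
theorem exists_bound_dJ (H : Admissible p q a₁ a₂ V A g) {τ : ℝ} (hτ0 : 0 ≤ τ)
    (hτ : ∀ u, MemWV p V u → (∫ x, |u x| ^ p) ^ (1 / p) ≤ τ * normV p V u)
    {u : RN N → ℝ} (hu : MemX p V u) :
    ∃ C : ℝ, ∀ v, MemX p V v → |dJ p A V g u v| ≤ C * normX p V v := by
  have hp := H.one_lt
  obtain ⟨T, hT0, hT⟩ := hu.exists_bound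
  obtain ⟨C, hC0, hC⟩ := H.exists_bound_A_comp T
  obtain ⟨D, hD0, hD⟩ := H.exists_bound_g T
  set K₁ := (∫ x, ‖weakGrad u x‖ ^ p) ^ ((p - 1) / p) with hK₁
  set K₂ := ∫ x, ‖weakGrad u x‖ ^ p with hK₂
  set K₃ := (∫ x, V x * |u x| ^ p) ^ ((p - 1) / p) with hK₃
  set K₄ := (∫ x, |u x| ^ p) ^ ((p - 1) / p) with hK₄
  have hK₁0 : 0 ≤ K₁ := Real.rpow_nonneg (integral_norm_rpow_nonneg _) _
  have hK₂0 : 0 ≤ K₂ := integral_norm_rpow_nonneg _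
  have hK₃0 : 0 ≤ K₃ := Real.rpow_nonneg (integral_weight_nonneg H.nonnegV u) _
  have hK₄0 : 0 ≤ K₄ := Real.rpow_nonneg (integral_nonneg fun x => Real.rpow_nonneg (abs_nonneg _) _) _
  refine ⟨C * K₁ + 1 / p * (C * K₂) + K₃ + D * (K₄ * τ), fun v hv => ?_⟩
  have hVX := normV_le_normX (p := p) (V := V) v
  have hX0 := normX_nonneg (p := p) H.nonnegV v
  have b1 : |∫ x, A x (u x) * inner ℝ (pMap p (weakGrad u x)) (weakGrad v x)|
      ≤ C * K₁ * normX p V v := by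
    have h1 := norm_integral_le_of_norm_le
      (f := fun x => A x (u x) * inner ℝ (pMap p (weakGrad u x)) (weakGrad v x))
      ((integrable_rpow_sub_one_mul hp hu.1.1.2.2 hv.1.1.2.2).const_mul C) (by
        filter_upwards [(hC _ hT).1] with x hx
        rw [norm_mul]
        exact mul_le_mul hx (inner_pMap_le hp _ _) (norm_nonneg _) hC0)
    refine h1.trans ?_
    rw [integral_const_mul, mul_assoc]
    refine mul_le_mul_of_nonneg_left ((integral_rpow_sub_one_mul_le hp hu.1.1.2.2
      hv.1.1.2.2).trans ?_) hC0
    exact mul_le_mul_of_nonneg_left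
      ((integral_gradient_rpow_le_normV H.pos H.nonnegV).trans hVX) hK₁0
  have b2 : |∫ x, partialT A x (u x) * v x * ‖weakGrad u x‖ ^ p| ≤ C * K₂ * normX p V v := by
    have h1 := norm_integral_le_of_norm_le
      (f := fun x => partialT A x (u x) * v x * ‖weakGrad u x‖ ^ p)
      ((integrable_norm_rpow H.pos hu.1.1.2.2).const_mul (C * normX p V v)) (by
        filter_upwards [(hC _ hT).2, hv.ae_abs_le_normX H.nonnegV] with x h1 h2
        rw [norm_mul, norm_mul, Real.norm_of_nonneg (Real.rpow_nonneg (norm_nonneg _) _)]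
        exact mul_le_mul_of_nonneg_right (mul_le_mul h1 h2 (abs_nonneg _) hC0)
          (Real.rpow_nonneg (norm_nonneg _) _))
    refine h1.trans (le_of_eq ?_)
    rw [integral_const_mul]
    ring
  have b3 : |∫ x, V x * |u x| ^ (p - 2) * u x * v x| ≤ K₃ * normX p V v := by
    have h1 := norm_integral_le_of_norm_le (f := fun x => V x * |u x| ^ (p - 2) * u x * v x)
      (integrable_weight_mul hp H.measV H.nonnegV hu.1 hv.1) (by
        filter_upwards [H.nonnegV] with x hx
        have h2 := norm_pMap hp (u x)
        rw [pMap, Real.norm_eq_abs, Real.norm_eq_abs, smul_eq_mul] at h2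
        rw [mul_assoc (V x), Real.norm_eq_abs, abs_mul, abs_mul, h2, abs_of_nonneg hx, mul_assoc])
    refine h1.trans ((integral_weight_mul_le hp H.measV H.nonnegV hu.1 hv.1).trans ?_)
    exact mul_le_mul_of_nonneg_left
      ((integral_weight_rpow_le_normV H.pos H.nonnegV v).trans hVX) hK₃0
  have b4 : |∫ x, g x (u x) * v x| ≤ D * (K₄ * τ) * normX p V v := by
    have h1 := norm_integral_le_of_norm_le (f := fun x => g x (u x) * v x)
      ((integrable_rpow_sub_one_mul hp hu.1.1.1 hv.1.1.1).const_mul D) (by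
        filter_upwards [hD, hT] with x h1 h2
        rw [norm_mul, ← mul_assoc]
        exact mul_le_mul_of_nonneg_right (h1 _ h2) (norm_nonneg _))
    refine h1.trans ?_
    rw [integral_const_mul, mul_assoc]
    refine mul_le_mul_of_nonneg_left ((integral_rpow_sub_one_mul_le hp hu.1.1.1
      hv.1.1.1).trans ?_) hD0
    rw [mul_assoc]
    refine mul_le_mul_of_nonneg_left ?_ hK₄0
    exact (hτ v hv.1).trans (mul_le_mul_of_nonneg_left hVX hτ0)
  rw [dJ_eq]
  have hp1 : 0 ≤ 1 / p := by have := H.pos; positivity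
  have b2' := mul_le_mul_of_nonneg_left b2 hp1
  rw [← abs_of_nonneg hp1, ← abs_mul, abs_of_nonneg hp1] at b2'
  rw [abs_le] at b1 b2' b3 b4 ⊢
  constructor <;> linarith [b1.1, b1.2, b2'.1, b2'.2, b3.1, b3.2, b4.1, b4.2]

end Admissible

end QuasilinearSchrodinger

namespace QuasilinearSchrodinger

variable {N : ℕ} {p q a₁ a₂ : ℝ} {V : RN N → ℝ} {A g : RN N → ℝ → ℝ}

/-! ### Fréchet differentiability -/

theorem isLittleO_of_forall_eps {X Y s : ℕ → ℝ} {K : ℝ} (hY : Tendsto Y atTop (𝓝 0))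
    (hs : ∀ j, 0 ≤ s j)
    (h : ∀ ε : ℝ, 0 < ε → ∃ C : ℝ, ∀ j, |X j| ≤ (ε * K + C * Y j) * s j) : X =o[atTop] s := by
  refine Asymptotics.isLittleO_iff_exists_eq_mul.2 ?_
  refine ⟨fun j => X j / s j, tendsto_zero_of_forall_eps (K := |K|)
    (by simpa using hY.abs) fun ε hε => ?_, Eventually.of_forall fun j => ?_⟩
  · obtain ⟨C, hC⟩ := h ε hε
    refine ⟨|C|, fun j => ?_⟩
    have h1 : ε * K + C * Y j ≤ ε * |K| + |C| * |Y j| := by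
      rw [← abs_mul]
      exact add_le_add (mul_le_mul_of_nonneg_left (le_abs_self K) hε.le) (le_abs_self _)
    rcases (hs j).eq_or_lt with h0 | h0
    · rw [← h0, div_zero, abs_zero]; positivity
    · rw [abs_div, abs_of_pos h0, div_le_iff₀ h0]
      exact (hC j).trans (mul_le_mul_of_nonneg_right h1 h0.le)
  · rcases (hs j).eq_or_lt with h0 | h0
    -- Where `s j = 0` the quotient takes the value 0, so `X j = 0` must be read off from the
    -- estimate itself.
    · obtain ⟨C, hC⟩ := h 1 one_pos
      have h2 := hC j
      rw [← h0, mul_zero] at h2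
      simp [abs_nonpos_iff.1 h2]
    · simp only [Pi.mul_apply]
      rw [div_mul_cancel₀ _ h0.ne']

theorem isLittleO_of_abs_le_mul {X Y s : ℕ → ℝ} (hY : Tendsto Y atTop (𝓝 0))
    (hs : ∀ j, 0 ≤ s j) (h : ∀ j, |X j| ≤ Y j * s j) : X =o[atTop] s :=
  isLittleO_of_forall_eps (K := 0) hY hs fun _ _ => ⟨1, fun j => by simpa using h j⟩

theorem abs_sub_le_of_hasDerivAt {F F' : ℝ → ℝ} (hF : ∀ t, HasDerivAt F (F' t) t) {C M : ℝ}
    (hC : ∀ t, |t| ≤ M → |F' t| ≤ C) {a b : ℝ} (ha : |a| ≤ M) (hb : |b| ≤ M) :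
    |F b - F a| ≤ C * |b - a| := by
  have := (convex_Icc (-M) M).norm_image_sub_le_of_norm_hasDerivWithin_le
    (fun t _ => (hF t).hasDerivWithinAt) (fun t ht => hC t (abs_le.2 ht)) (abs_le.1 ha) (abs_le.1 hb)
  exact this

theorem tendsto_remainder_div {F : ℝ → ℝ} {F' a : ℝ} (hF : HasDerivAt F F' a) {v : ℕ → ℝ}
    (hv : Tendsto v atTop (𝓝 0)) :
    Tendsto (fun j => (F (a + v j) - F a - F' * v j) / v j) atTop (𝓝 0) := by
  have h := (hasDerivAt_iff_isLittleO_nhds_zero.1 hF).tendsto_div_nhds_zero.comp hv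
  refine h.congr fun j => ?_
  simp [mul_comm]

theorem abs_remainder_div_le {F : ℝ → ℝ} {a v F' C C' : ℝ} (h : |F (a + v) - F a| ≤ C * |v|)
    (h' : |F'| ≤ C') (hC : 0 ≤ C) (hC' : 0 ≤ C') :
    |(F (a + v) - F a - F' * v) / v| ≤ C + C' := by
  by_cases hv : v = 0
  · rw [hv, div_zero, abs_zero]; positivity
  · rw [abs_div, div_le_iff₀ (abs_pos.2 hv), add_mul]
    refine (abs_sub _ _).trans (add_le_add h ?_)
    rw [abs_mul]
    exact mul_le_mul_of_nonneg_right h' (abs_nonneg _)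

theorem remainder_div_mul {F : ℝ → ℝ} {a v F' : ℝ} :
    (F (a + v) - F a - F' * v) / v * v = F (a + v) - F a - F' * v := by
  by_cases hv : v = 0
  · simp [hv]
  · rw [div_mul_cancel₀ _ hv]

theorem le_rpow_sub_one_mul_of_rpow_le {s a : ℝ} (hp : 1 < p) (ha : 0 ≤ a) (h : a ^ (1 / p) ≤ s) :
    a ≤ s ^ (p - 1) * s := by
  have hs : 0 ≤ s := (Real.rpow_nonneg ha _).trans h
  have h1 := Real.rpow_le_rpow (Real.rpow_nonneg ha _) h (by linarith : 0 ≤ p)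
  rw [← Real.rpow_mul ha, one_div_mul_cancel (by linarith), Real.rpow_one] at h1
  refine h1.trans (le_of_eq ?_)
  rw [← Real.rpow_add_one' hs (by linarith), sub_add_cancel]

theorem integral_gradient_le_normX (hp : 1 < p) (hV : ∀ᵐ x, 0 ≤ V x) (v : RN N → ℝ) :
    ∫ x, ‖weakGrad v x‖ ^ p ≤ normX p V v ^ (p - 1) * normX p V v :=
  le_rpow_sub_one_mul_of_rpow_le hp (integral_norm_rpow_nonneg _)
    ((integral_gradient_rpow_le_normV (by linarith) hV).trans (normV_le_normX _))

theorem integral_weight_le_normX (hp : 1 < p) (hV : ∀ᵐ x, 0 ≤ V x) (v : RN N → ℝ) :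
    ∫ x, V x * |v x| ^ p ≤ normX p V v ^ (p - 1) * normX p V v :=
  le_rpow_sub_one_mul_of_rpow_le hp (integral_weight_nonneg hV _)
    ((integral_weight_rpow_le_normV (by linarith) hV _).trans (normV_le_normX _))

/-- A sequence of increments in the unit ball of `X` which tends to `0`. -/
structure IsNullSeqX (p : ℝ) (V : RN N → ℝ) (v : ℕ → RN N → ℝ) : Prop where
  memX : ∀ n, MemX p V (v n)
  tendsto : Tendsto (fun n => normX p V (v n)) atTop (𝓝 0)
  le_one : ∀ n, normX p V (v n) ≤ 1

namespace IsNullSeqX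

variable {v : ℕ → RN N → ℝ}

theorem aemeasurable (S : IsNullSeqX p V v) (n : ℕ) : AEMeasurable (v n) :=
  (S.memX n).1.1.1.1.aemeasurable

theorem ae_abs_le_one (S : IsNullSeqX p V v) (hV : ∀ᵐ x, 0 ≤ V x) (n : ℕ) :
    ∀ᵐ x, |v n x| ≤ 1 := by
  filter_upwards [(S.memX n).ae_abs_le_normX hV] with x hx using hx.trans (S.le_one n)

theorem ae_tendsto (S : IsNullSeqX p V v) (hV : ∀ᵐ x, 0 ≤ V x) :
    ∀ᵐ x, Tendsto (fun n => v n x) atTop (𝓝 0) := by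
  filter_upwards [ae_all_iff.2 fun n => (S.memX n).ae_abs_le_normX hV] with x hx
  exact squeeze_zero_norm hx S.tendsto

theorem tendsto_rpow (S : IsNullSeqX p V v) (hp : 1 < p) :
    Tendsto (fun n => normX p V (v n) ^ (p - 1)) atTop (𝓝 0) := by
  have := S.tendsto.rpow_const (p := p - 1) (Or.inr (by linarith))
  rwa [Real.zero_rpow (by linarith)] at this

end IsNullSeqX

namespace Admissible

variable {u : RN N → ℝ} {v : ℕ → RN N → ℝ} {T : ℝ}

/-- The remainder splits into three: expanding `|·|^p` with coefficient `A(u+v)`, replacing `A(u+v)`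
by `A(u)` in the linear term, and expanding `A` with weight `|∇u|^p`. -/
theorem isLittleO_gradient (H : Admissible p q a₁ a₂ V A g) (hu : MemX p V u)
    (hT : ∀ᵐ x, |u x| ≤ T) (S : IsNullSeqX p V v) :
    (fun n => (∫ x, A x (u x + v n x) * ‖weakGrad u x + weakGrad (v n) x‖ ^ p)
      - (∫ x, A x (u x) * ‖weakGrad u x‖ ^ p)
      - p * (∫ x, A x (u x) * inner ℝ (pMap p (weakGrad u x)) (weakGrad (v n) x))
      - ∫ x, partialT A x (u x) * v n x * ‖weakGrad u x‖ ^ p)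
      =o[atTop] fun n => normX p V (v n) := by
  have hp := H.one_lt
  have hp0 := H.pos
  have hV := H.nonnegV
  obtain ⟨C, hC0, hC'⟩ := H.exists_bound_A (T + 1)
  have hT' : ∀ᵐ x, |u x| ≤ T + 1 := by filter_upwards [hT] with x hx using hx.trans (by linarith)
  have huv : ∀ n, ∀ᵐ x, |u x + v n x| ≤ T + 1 := fun n => by
    filter_upwards [hT, S.ae_abs_le_one hV n] with x h1 h2
    exact (abs_add_le _ _).trans (add_le_add h1 h2)
  have hum : AEMeasurable u := hu.1.1.1.1.aemeasurable
  have hAuv : ∀ n, AEMeasurable fun x => A x (u x + v n x) := fun n =>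
    H.aemeasurable_A (hum.add (S.aemeasurable n))
  have hAu : AEMeasurable fun x => A x (u x) := H.aemeasurable_A hum
  have hDu : AEMeasurable fun x => partialT A x (u x) := H.aemeasurable_At hum
  have hder : ∀ᵐ x, ∀ t, HasDerivAt (A x) (partialT A x t) t := by
    filter_upwards [H.caraA.2] with x hx t
    exact (hx.differentiable (by simp) t).hasDerivAt
  have hgu : MemLp (weakGrad u) (ENNReal.ofReal p) := hu.1.1.2.2
  have hgv : ∀ n, MemLp (weakGrad (v n)) (ENNReal.ofReal p) := fun n => (S.memX n).1.1.2.2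
  have bAuv : ∀ n, ∀ᵐ x, |A x (u x + v n x)| ≤ C := fun n => by
    filter_upwards [hC', huv n] with x h1 h2 using (h1 _ h2).1
  have bAu : ∀ᵐ x, |A x (u x)| ≤ C := by
    filter_upwards [hC', hT'] with x h1 h2 using (h1 _ h2).1
  have bDu : ∀ᵐ x, |partialT A x (u x)| ≤ C := by
    filter_upwards [hC', hT'] with x h1 h2 using (h1 _ h2).2
  have blip : ∀ n, ∀ᵐ x, |A x (u x + v n x) - A x (u x)| ≤ C * |v n x| := fun n => by
    filter_upwards [hC', hT', huv n, hder] with x h1 h2 h3 h4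
    have := abs_sub_le_of_hasDerivAt h4 (fun t ht => (h1 t ht).2) h2 h3
    rwa [add_sub_cancel_left] at this
  have hs0 : ∀ n, 0 ≤ normX p V (v n) := fun n => normX_nonneg hV _
  have hHol : ∀ n, ∫ x, ‖weakGrad u x‖ ^ (p - 1) * ‖weakGrad (v n) x‖
      ≤ (∫ x, ‖weakGrad u x‖ ^ p) ^ ((p - 1) / p) * normX p V (v n) := fun n =>
    (integral_rpow_sub_one_mul_le hp hgu (hgv n)).trans (mul_le_mul_of_nonneg_left
      ((integral_gradient_rpow_le_normV hp0 hV).trans (normV_le_normX _))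
      (Real.rpow_nonneg (integral_norm_rpow_nonneg _) _))
  have iHol := fun n => integrable_rpow_sub_one_mul hp hgu (hgv n)
  have iin := fun n => integrable_inner_pMap hp hgu (hgv n)
  have igu := integrable_norm_rpow hp0 hgu
  have igv := fun n => integrable_norm_rpow hp0 (hgv n)
  have iguv : ∀ n, Integrable fun x => ‖weakGrad u x + weakGrad (v n) x‖ ^ p := fun n =>
    integrable_norm_rpow hp0 (hgu.add (hgv n))
  have x1 : (fun n => ∫ x, A x (u x + v n x) * (‖weakGrad u x + weakGrad (v n) x‖ ^ p
      - ‖weakGrad u x‖ ^ p - p * inner ℝ (pMap p (weakGrad u x)) (weakGrad (v n) x)))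
      =o[atTop] fun n => normX p V (v n) := by
    refine isLittleO_of_forall_eps (K := C * (∫ x, ‖weakGrad u x‖ ^ p) ^ ((p - 1) / p))
      (S.tendsto_rpow hp) hs0 fun ε hε => ?_
    obtain ⟨D, hD0, hD⟩ := exists_abs_norm_rpow_expansion_le (RN N) hp hε
    refine ⟨C * D, fun n => ?_⟩
    have i1 := (iHol n).const_mul (C * ε)
    have i2 := (igv n).const_mul (C * D)
    have h1 := norm_integral_le_of_norm_le (f := fun x => A x (u x + v n x) *
      (‖weakGrad u x + weakGrad (v n) x‖ ^ p - ‖weakGrad u x‖ ^ p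
        - p * inner ℝ (pMap p (weakGrad u x)) (weakGrad (v n) x))) (i1.add i2) (by
        filter_upwards [bAuv n] with x hx
        rw [norm_mul]
        refine (mul_le_mul hx (hD _ _) (abs_nonneg _) hC0).trans (le_of_eq ?_)
        simp only [Pi.add_apply]
        ring)
    simp only [Pi.add_apply] at h1
    rw [integral_add i1 i2, integral_const_mul, integral_const_mul] at h1
    rw [Real.norm_eq_abs] at h1
    have h2 := mul_le_mul_of_nonneg_left (hHol n) (mul_nonneg hC0 hε.le)
    have h3 := mul_le_mul_of_nonneg_left (integral_gradient_le_normX hp hV (v n)) (mul_nonneg hC0 hD0)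
    linarith
  -- Quadratic in the increment: `A` is Lipschitz on bounded ranges, so one factor is the sup norm
  -- of `v n` and the other the `L^p` norm of its gradient.
  have x2 : (fun n => ∫ x, (A x (u x + v n x) - A x (u x)) *
      (p * inner ℝ (pMap p (weakGrad u x)) (weakGrad (v n) x)))
      =o[atTop] fun n => normX p V (v n) := by
    refine isLittleO_of_abs_le_mul (Y := fun n =>
      C * p * (∫ x, ‖weakGrad u x‖ ^ p) ^ ((p - 1) / p) * normX p V (v n))
      (by simpa using S.tendsto.const_mul (C * p * (∫ x, ‖weakGrad u x‖ ^ p) ^ ((p - 1) / p)))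
      hs0 fun n => ?_
    have h1 := norm_integral_le_of_norm_le (f := fun x => (A x (u x + v n x) - A x (u x)) *
      (p * inner ℝ (pMap p (weakGrad u x)) (weakGrad (v n) x)))
      ((iHol n).const_mul (C * normX p V (v n) * p)) (by
        filter_upwards [blip n, (S.memX n).ae_abs_le_normX hV] with x h1 h2
        rw [norm_mul, norm_mul, Real.norm_of_nonneg hp0.le, ← mul_assoc]
        refine mul_le_mul (mul_le_mul_of_nonneg_right
          (h1.trans (mul_le_mul_of_nonneg_left h2 hC0)) hp0.le) (inner_pMap_le hp _ _)
          (norm_nonneg _) ?_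
        exact mul_nonneg (mul_nonneg hC0 (hs0 n)) hp0.le)
    rw [integral_const_mul, Real.norm_eq_abs] at h1
    have h2 := mul_le_mul_of_nonneg_left (hHol n)
      (mul_nonneg (mul_nonneg hC0 (hs0 n)) hp0.le)
    linarith
  -- The sup norm of `v n` is factored out; the remaining difference quotient is bounded and tends
  -- to zero almost everywhere.
  have x3 : (fun n => ∫ x, (A x (u x + v n x) - A x (u x) - partialT A x (u x) * v n x) *
      ‖weakGrad u x‖ ^ p) =o[atTop] fun n => normX p V (v n) := by
    set r : ℕ → RN N → ℝ := fun n x =>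
      (A x (u x + v n x) - A x (u x) - partialT A x (u x) * v n x) / v n x with hr
    have rm : ∀ n, AEMeasurable (r n) := fun n =>
      (((hAuv n).sub hAu).sub (hDu.mul (S.aemeasurable n))).div (S.aemeasurable n)
    have rC : ∀ n, ∀ᵐ x, |r n x| ≤ C + C := fun n => by
      filter_upwards [blip n, bDu] with x h1 h2
      exact abs_remainder_div_le h1 h2 hC0 hC0
    have rt : ∀ᵐ x, Tendsto (fun n => r n x) atTop (𝓝 0) := by
      filter_upwards [hder, S.ae_tendsto hV] with x h1 h2
      exact tendsto_remainder_div (h1 _) h2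
    refine isLittleO_of_abs_le_mul (tendsto_integral_coeff_mul (fun n => (rm n).abs)
      (by simpa using rC) (by filter_upwards [rt] with x hx using by simpa using hx.abs) igu)
      hs0 fun n => ?_
    have h1 := norm_integral_le_of_norm_le
      (f := fun x => (A x (u x + v n x) - A x (u x) - partialT A x (u x) * v n x) *
        ‖weakGrad u x‖ ^ p)
      ((integrable_bdd_mul (rm n).abs (by simpa using rC n) igu).mul_const (normX p V (v n))) (by
        filter_upwards [(S.memX n).ae_abs_le_normX hV] with x hx
        have h2 := remainder_div_mul (F := A x) (a := u x) (v := v n x) (F' := partialT A x (u x))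
        rw [← h2, norm_mul, norm_mul, Real.norm_of_nonneg (Real.rpow_nonneg (norm_nonneg _) _),
          mul_right_comm]
        exact mul_le_mul_of_nonneg_left hx (mul_nonneg (abs_nonneg _)
          (Real.rpow_nonneg (norm_nonneg _) _)))
    rwa [integral_mul_const] at h1
  refine ((x1.add x2).add x3).congr_left fun n => ?_
  have j1 : Integrable fun x => A x (u x + v n x) * (‖weakGrad u x + weakGrad (v n) x‖ ^ p
      - ‖weakGrad u x‖ ^ p - p * inner ℝ (pMap p (weakGrad u x)) (weakGrad (v n) x)) :=
    integrable_bdd_mul (hAuv n) (bAuv n) (((iguv n).sub igu).sub ((iin n).const_mul p))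
  have j2 : Integrable fun x => (A x (u x + v n x) - A x (u x)) *
      (p * inner ℝ (pMap p (weakGrad u x)) (weakGrad (v n) x)) :=
    integrable_bdd_mul (C := C + C) ((hAuv n).sub hAu) (by
      filter_upwards [bAuv n, bAu] with x h1 h2
      exact (abs_sub _ _).trans (add_le_add h1 h2)) ((iin n).const_mul p)
  have k1 := integrable_bdd_mul (hAuv n) (bAuv n) (iguv n)
  have k2 := integrable_bdd_mul hAu bAu igu
  have k3 := (integrable_bdd_mul hAu bAu (iin n)).const_mul p
  have k4 := H.integrable_partialT hu.1.1 hT (S.aemeasurable n) (S.ae_abs_le_one hV n)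
  have j3 : Integrable fun x => (A x (u x + v n x) - A x (u x) - partialT A x (u x) * v n x) *
      ‖weakGrad u x‖ ^ p := by
    refine (((integrable_bdd_mul (hAuv n) (bAuv n) igu).sub k2).sub k4).congr
      (Eventually.of_forall fun x => ?_)
    simp only [Pi.sub_apply]
    ring
  have j12 := j1.add j2
  have k12 := k1.sub k2
  have k123 := k12.sub k3
  rw [← integral_const_mul, ← integral_sub' k1 k2, ← integral_sub' k12 k3,
    ← integral_sub' k123 k4, ← integral_add' j1 j2, ← integral_add' j12 j3]
  refine integral_congr_ae (Eventually.of_forall fun x => ?_)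
  simp only [Pi.sub_apply, Pi.add_apply]
  ring

end Admissible

end QuasilinearSchrodinger

/-! ### Expansion of the potential and nonlinear terms; differentiability of `J`. -/

namespace QuasilinearSchrodinger

variable {N : ℕ} {p q a₁ a₂ : ℝ} {V : RN N → ℝ} {A g : RN N → ℝ → ℝ}

namespace Admissible

variable {u : RN N → ℝ} {v : ℕ → RN N → ℝ} {T : ℝ}

/-- The first order expansion of `|·|^p` in dimension one, integrated against the weight `V`, and
Hölder's inequality for that weight. -/
theorem isLittleO_weight (H : Admissible p q a₁ a₂ V A g) (hu : MemX p V u)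
    (S : IsNullSeqX p V v) :
    (fun n => (∫ x, V x * |u x + v n x| ^ p) - (∫ x, V x * |u x| ^ p)
      - p * ∫ x, V x * |u x| ^ (p - 2) * u x * v n x) =o[atTop] fun n => normX p V (v n) := by
  have hp := H.one_lt
  have hp0 := H.pos
  have hV := H.nonnegV
  refine isLittleO_of_forall_eps (K := (∫ x, V x * |u x| ^ p) ^ ((p - 1) / p))
    (S.tendsto_rpow hp) (fun n => normX_nonneg hV _) fun ε hε => ?_
  obtain ⟨D, hD0, hD⟩ := exists_abs_norm_rpow_expansion_le ℝ hp hε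
  refine ⟨D, fun n => ?_⟩
  have i1 := (integrable_weight_mul hp H.measV hV hu.1 (S.memX n).1).const_mul ε
  have i2 := (S.memX n).1.2.const_mul D
  have k1 : Integrable fun x => V x * |u x + v n x| ^ p :=
    (hu.1.add hp0 H.measV (S.memX n).1).2
  have k2 := hu.1.2
  have k3 := (H.integrable_weight hu.1 (S.memX n).1).const_mul p
  have k12 := k1.sub k2
  have h1 := norm_integral_le_of_norm_le (f := fun x => V x * |u x + v n x| ^ p - V x * |u x| ^ p
      - p * (V x * |u x| ^ (p - 2) * u x * v n x)) (i1.add i2) (by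
    filter_upwards [hV] with x hx
    have h2 := mul_le_mul_of_nonneg_left (hD (u x) (v n x)) hx
    simp only [Real.norm_eq_abs, pMap, smul_eq_mul, RCLike.inner_apply, conj_trivial] at h2
    nth_rewrite 1 [← abs_of_nonneg hx] at h2
    rw [← abs_mul] at h2
    rw [Real.norm_eq_abs]
    simp only [Pi.add_apply]
    rw [show V x * |u x + v n x| ^ p - V x * |u x| ^ p - p * (V x * |u x| ^ (p - 2) * u x * v n x)
      = V x * (|u x + v n x| ^ p - |u x| ^ p - p * (v n x * (|u x| ^ (p - 2) * u x))) by ring]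
    linarith)
  simp only [Pi.add_apply] at h1
  rw [integral_add i1 i2, integral_const_mul, integral_const_mul, Real.norm_eq_abs] at h1
  rw [← integral_const_mul, ← integral_sub' k1 k2, ← integral_sub' k12 k3]
  simp only [Pi.sub_apply]
  have h2 := mul_le_mul_of_nonneg_left ((integral_weight_mul_le hp H.measV hV hu.1
    (S.memX n).1).trans (mul_le_mul_of_nonneg_left ((integral_weight_rpow_le_normV hp0 hV _).trans
      (normV_le_normX _)) (Real.rpow_nonneg (integral_weight_nonneg hV u) _))) hε.le
  have h3 := mul_le_mul_of_nonneg_left (integral_weight_le_normX hp hV (v n)) hD0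
  linarith

theorem ae_abs_primitiveT_sub_le (H : Admissible p q a₁ a₂ V A g) (T : ℝ) :
    ∃ D : ℝ, 0 ≤ D ∧ ∀ᵐ x, ∀ s t : ℝ, |s| ≤ T → |t| ≤ T →
      |primitiveT g x t - primitiveT g x s| ≤ D * max |s| |t| ^ (p - 1) * |t - s| := by
  have hp := H.one_lt
  obtain ⟨D, hD0, hD⟩ := H.exists_bound_g T
  refine ⟨D, hD0, ?_⟩
  filter_upwards [hD, H.caraG.ae_hasDerivAt_primitiveT] with x h1 h2 s t hs ht
  refine abs_sub_le_of_hasDerivAt h2 (M := max |s| |t|) (fun r hr => ?_) (le_max_left _ _)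
    (le_max_right _ _)
  exact (h1 r (hr.trans (max_le hs ht))).trans (mul_le_mul_of_nonneg_left
    (Real.rpow_le_rpow (abs_nonneg _) hr (by linarith)) hD0)

theorem integrable_primitiveT (H : Admissible p q a₁ a₂ V A g)
    (hu : MemLp u (ENNReal.ofReal p)) (hT : ∀ᵐ x, |u x| ≤ T) :
    Integrable fun x => primitiveT g x (u x) := by
  obtain ⟨D, hD0, hD⟩ := H.ae_abs_primitiveT_sub_le T
  refine ((integrable_norm_rpow H.pos hu).const_mul D).mono'
    (H.caraG.primitiveT.aemeasurable_comp hu.1.aemeasurable).aestronglyMeasurable ?_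
  filter_upwards [hD, hT] with x h1 h2
  have h3 := h1 0 (u x) (by rw [abs_zero]; exact (abs_nonneg _).trans h2) h2
  have h0 : primitiveT g x 0 = 0 := by simp [QuasilinearSchrodinger.primitiveT]
  rw [h0, sub_zero, sub_zero, abs_zero, max_eq_right (abs_nonneg _), mul_assoc,
    ← Real.rpow_add_one' (abs_nonneg _) (by linarith [H.pos]), sub_add_cancel] at h3
  exact h3

/-- Extracts from `x` a bounded multiple `y` of `a`, the rest being charged to `b`. For `a = 0` the
product `y * a` vanishes whatever the quotient is, and `b` alone suffices. -/
theorem rpow_le_min_add {a b x y K : ℝ} (ha : 0 ≤ a) (hb : 0 ≤ b)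
    (h : x ≤ K * (a + b)) (hK : 0 ≤ K) (hy : y = min (x / a) K) : x ≤ y * a + K * b := by
  rcases ha.eq_or_lt with h0 | h0
  · rw [← h0] at h ⊢
    linarith
  · rw [hy]
    rcases min_cases (x / a) K with ⟨h1, -⟩ | ⟨h1, -⟩
    · rw [h1, div_mul_cancel₀ _ h0.ne']
      exact le_add_of_nonneg_right (mul_nonneg hK hb)
    · rw [h1]; linarith

/-- On a space of infinite measure the sup norm of `v n` cannot simply be factored out, because
`|u|^{p-1}` need not be integrable. The estimate must keep `v n` in `L^p` and pair it with
`|u|^{p-1}` by Hölder. -/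
theorem isLittleO_primitiveT (H : Admissible p q a₁ a₂ V A g) {τ : ℝ} (hτ0 : 0 ≤ τ)
    (hτ : ∀ u, MemWV p V u → (∫ x, |u x| ^ p) ^ (1 / p) ≤ τ * normV p V u)
    (hu : MemX p V u) (hT : ∀ᵐ x, |u x| ≤ T) (S : IsNullSeqX p V v) :
    (fun n => (∫ x, primitiveT g x (u x + v n x)) - (∫ x, primitiveT g x (u x))
      - ∫ x, g x (u x) * v n x) =o[atTop] fun n => normX p V (v n) := by
  have hp := H.one_lt
  have hp0 := H.pos
  have hp1 : 0 < p - 1 := by linarith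
  have hV := H.nonnegV
  obtain ⟨D, hD0, hD⟩ := H.ae_abs_primitiveT_sub_le (T + 1)
  obtain ⟨D', hD'0, hD'⟩ := H.exists_bound_g T
  have hum : AEMeasurable u := hu.1.1.1.1.aemeasurable
  have huv : ∀ n, ∀ᵐ x, |u x + v n x| ≤ T + 1 := fun n => by
    filter_upwards [hT, S.ae_abs_le_one hV n] with x h1 h2
    exact (abs_add_le _ _).trans (add_le_add h1 h2)
  set s : ℕ → ℝ := fun n => normX p V (v n) with hs
  have hs0 : ∀ n, 0 ≤ s n := fun n => normX_nonneg hV _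
  set K := D * 2 ^ (p - 1) + D' with hK
  have hK0 : 0 ≤ K := by positivity
  -- the difference quotients
  set r : ℕ → RN N → ℝ := fun n x =>
    (primitiveT g x (u x + v n x) - primitiveT g x (u x) - g x (u x) * v n x) / v n x with hr
  have hGm : ∀ {z : RN N → ℝ}, AEMeasurable z → AEMeasurable fun x => primitiveT g x (z x) :=
    fun hz => H.caraG.primitiveT.aemeasurable_comp hz
  have rm : ∀ n, AEMeasurable (r n) := fun n =>
    (((hGm (hum.add (S.aemeasurable n))).sub (hGm hum)).sub
      ((H.aemeasurable_g hum).mul (S.aemeasurable n))).div (S.aemeasurable n)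
  have rt : ∀ᵐ x, Tendsto (fun n => r n x) atTop (𝓝 0) := by
    filter_upwards [H.caraG.ae_hasDerivAt_primitiveT, S.ae_tendsto hV] with x h1 h2
    exact tendsto_remainder_div (h1 _) h2
  have rb : ∀ n, ∀ᵐ x, |r n x| ≤ K * (|u x| ^ (p - 1) + |v n x| ^ (p - 1)) := fun n => by
    filter_upwards [hD, hD', hT, huv n] with x h1 h2 h3 h4
    have h5 := h1 (u x) (u x + v n x) (h3.trans (by linarith)) h4
    rw [add_sub_cancel_left] at h5
    have h6 : max |u x| |u x + v n x| ≤ 2 * max |u x| |v n x| := by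
      have := le_max_left |u x| |v n x|
      have := le_max_right |u x| |v n x|
      have := abs_nonneg (u x)
      refine max_le (by linarith) ((abs_add_le _ _).trans (by linarith))
    have h7 : max |u x| |u x + v n x| ^ (p - 1)
        ≤ 2 ^ (p - 1) * (|u x| ^ (p - 1) + |v n x| ^ (p - 1)) := by
      refine (Real.rpow_le_rpow (le_max_of_le_left (abs_nonneg _)) h6 hp1.le).trans ?_
      rw [Real.mul_rpow zero_le_two (le_max_of_le_left (abs_nonneg _))]
      refine mul_le_mul_of_nonneg_left ?_ (by positivity)
      have e1 := Real.rpow_nonneg (abs_nonneg (u x)) (p - 1)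
      have e2 := Real.rpow_nonneg (abs_nonneg (v n x)) (p - 1)
      rcases max_cases |u x| |v n x| with ⟨h, -⟩ | ⟨h, -⟩ <;> rw [h] <;> linarith
    have h8 := abs_remainder_div_le h5 (h2 _ h3)
      (mul_nonneg hD0 (Real.rpow_nonneg (le_max_of_le_left (abs_nonneg _)) _))
      (mul_nonneg hD'0 (Real.rpow_nonneg (abs_nonneg _) _))
    refine h8.trans ?_
    have h9 := mul_le_mul_of_nonneg_left h7 hD0
    have h10 := mul_nonneg hD'0 (Real.rpow_nonneg (abs_nonneg (v n x)) (p - 1))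
    rw [hK]
    linarith
  clear_value K
  -- The quotient `r n` is dominated by `|u|^{p-1} + |v n|^{p-1}`, which varies with `n`. The
  -- truncated ratio is bounded and still tends to zero; what the truncation loses is at most `K|v
  -- n|^{p-1}`, of higher order once multiplied by `v n`.
  set m : ℕ → RN N → ℝ := fun n x => min (|r n x| / |u x| ^ (p - 1)) K with hm
  have hm0 : ∀ n x, 0 ≤ m n x := fun n x =>
    le_min (div_nonneg (abs_nonneg _) (Real.rpow_nonneg (abs_nonneg _) _)) hK0
  have mm : ∀ n, AEMeasurable (m n) := fun n =>
    ((rm n).abs.div (hum.abs.pow_const _)).min aemeasurable_const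
  have mC : ∀ n, ∀ᵐ x, |m n x| ≤ K := fun n => Eventually.of_forall fun x => by
    rw [abs_of_nonneg (hm0 n x)]; exact min_le_right _ _
  have mt : ∀ᵐ x, Tendsto (fun n => m n x) atTop (𝓝 0) := by
    filter_upwards [rt] with x hx
    refine squeeze_zero (fun n => hm0 n x) (fun n => min_le_left _ _) ?_
    simpa using hx.abs.div_const (|u x| ^ (p - 1))
  -- normalised increments
  have hvp : ∀ n, MemLp (v n) (ENNReal.ofReal p) := fun n => (S.memX n).1.1.1
  have hvτ : ∀ n, ∫ x, |v n x| ^ p ≤ (τ * s n) ^ p := fun n => by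
    have h1 := (hτ _ (S.memX n).1).trans (mul_le_mul_of_nonneg_left (normV_le_normX _) hτ0)
    have h0 : 0 ≤ ∫ x, |v n x| ^ p :=
      integral_nonneg fun x => Real.rpow_nonneg (abs_nonneg _) _
    have h2 := Real.rpow_le_rpow (Real.rpow_nonneg h0 _) h1 hp0.le
    rwa [← Real.rpow_mul h0, one_div_mul_cancel hp0.ne', Real.rpow_one] at h2
  -- Dividing by the norm yields a bounded sequence in `L^p`, so the convergence for coefficients
  -- tending to zero gives exactly a little-o. If `s n = 0` the inverse is 0.
  have hwB : ∀ n, ∫ x, ‖((s n)⁻¹ • v n) x‖ ^ p ≤ τ ^ p := fun n => by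
    have e : ∀ x, ‖((s n)⁻¹ • v n) x‖ ^ p = ((s n)⁻¹) ^ p * |v n x| ^ p := fun x => by
      rw [Pi.smul_apply, norm_smul, Real.norm_eq_abs, Real.norm_eq_abs,
        abs_of_nonneg (inv_nonneg.2 (hs0 n)),
        Real.mul_rpow (inv_nonneg.2 (hs0 n)) (abs_nonneg _)]
    simp_rw [e]
    rw [integral_const_mul]
    refine (mul_le_mul_of_nonneg_left (hvτ n) (Real.rpow_nonneg (inv_nonneg.2 (hs0 n)) _)).trans ?_
    rw [← Real.mul_rpow (inv_nonneg.2 (hs0 n)) (mul_nonneg hτ0 (hs0 n))]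
    refine Real.rpow_le_rpow (by have := hs0 n; positivity) ?_ hp0.le
    rcases (hs0 n).eq_or_lt with h | h
    · rw [← h]; simpa using hτ0
    · rw [mul_comm, mul_assoc, mul_inv_cancel₀ h.ne', mul_one]
  have hY := tendsto_integral_coeff_mul_mul hp mm mC mt hu.1.1.1
    (fun n => (hvp n).const_smul (s n)⁻¹) hwB
  have hY2 := hY.add ((S.tendsto_rpow hp).const_mul (K * τ ^ p))
  rw [mul_zero, zero_add] at hY2
  refine isLittleO_of_abs_le_mul hY2 hs0 fun n => ?_
  have k1 : Integrable fun x => primitiveT g x (u x + v n x) :=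
    H.integrable_primitiveT (hu.1.1.1.add (hvp n)) (huv n)
  have k2 := H.integrable_primitiveT hu.1.1.1 hT
  have k3 := H.integrable_g hu.1.1.1 hT (hvp n)
  have k12 := k1.sub k2
  rw [← integral_sub' k1 k2, ← integral_sub' k12 k3]
  simp only [Pi.sub_apply]
  have i1 : Integrable fun x => |m n x| * (‖u x‖ ^ (p - 1) * ‖((s n)⁻¹ • v n) x‖) :=
    integrable_bdd_mul (mm n).abs (by simpa using mC n)
      (integrable_rpow_sub_one_mul hp hu.1.1.1 ((hvp n).const_smul (s n)⁻¹))
  have i2 := (integrable_norm_rpow hp0 (hvp n)).const_mul K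
  have h1 := norm_integral_le_of_norm_le
    (f := fun x => primitiveT g x (u x + v n x) - primitiveT g x (u x) - g x (u x) * v n x)
    ((i1.mul_const (s n)).add i2) (by
      filter_upwards [rb n, (S.memX n).ae_abs_le_normX hV] with x h1 h2
      have h3 := remainder_div_mul (F := primitiveT g x) (a := u x) (v := v n x) (F' := g x (u x))
      rw [← h3, norm_mul]
      have h4 := rpow_le_min_add (Real.rpow_nonneg (abs_nonneg (u x)) (p - 1))
        (Real.rpow_nonneg (abs_nonneg (v n x)) (p - 1)) h1 hK0
        (rfl : m n x = _)
      have h5 := mul_le_mul_of_nonneg_right h4 (abs_nonneg (v n x))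
      have h6 : |v n x| ^ (p - 1) * |v n x| = |v n x| ^ p := by
        rw [← Real.rpow_add_one' (abs_nonneg _) (by linarith), sub_add_cancel]
      have h7 : ‖((s n)⁻¹ • v n) x‖ * s n = |v n x| := by
        rw [Pi.smul_apply, norm_smul, Real.norm_eq_abs, Real.norm_eq_abs,
          abs_of_nonneg (inv_nonneg.2 (hs0 n))]
        rcases (hs0 n).eq_or_lt with h | h
        · have : |v n x| ≤ 0 := by rw [h]; exact h2
          rw [abs_nonpos_iff.1 this]; simp
        · rw [mul_right_comm, inv_mul_cancel₀ h.ne', one_mul]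
      refine h5.trans (le_of_eq ?_)
      simp only [Pi.add_apply]
      rw [abs_of_nonneg (hm0 n x), Real.norm_eq_abs (u x), Real.norm_eq_abs (v n x), ← h6]
      linear_combination -(m n x * |u x| ^ (p - 1)) * h7)
  simp only [Pi.add_apply] at h1
  rw [integral_add (i1.mul_const (s n)) i2, integral_mul_const, integral_const_mul,
    Real.norm_eq_abs] at h1
  refine h1.trans ?_
  rw [add_mul]
  refine add_le_add le_rfl ?_
  have h2 := mul_le_mul_of_nonneg_left (hvτ n) hK0
  rw [Real.mul_rpow hτ0 (hs0 n)] at h2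
  have h3 : s n ^ (p - 1) * s n = s n ^ p := by
    rw [← Real.rpow_add_one' (hs0 n) (by linarith), sub_add_cancel]
  simp only [Real.norm_eq_abs]
  calc K * ∫ x, |v n x| ^ p ≤ K * (τ ^ p * s n ^ p) := h2
    _ = _ := by rw [← h3]; ring

theorem hasFrechetDifferentialX (H : Admissible p q a₁ a₂ V A g) {τ : ℝ} (hτ0 : 0 ≤ τ)
    (hτ : ∀ u, MemWV p V u → (∫ x, |u x| ^ p) ^ (1 / p) ≤ τ * normV p V u)
    (hu : MemX p V u) : HasFrechetDifferentialX p V (J p A V g) u (dJ p A V g u) := by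
  refine ⟨fun v w hv hw => H.dJ_add hu hv hw, fun c v hv => dJ_smul c hv,
    H.exists_bound_dJ hτ0 hτ hu, ?_⟩
  -- A failure of differentiability yields a sequence of increments tending to zero in `X`, so the
  -- sequential expansions, which rest on dominated convergence, suffice.
  by_contra! hcon
  obtain ⟨ε, hε, h⟩ := hcon
  choose v hv hv1 hv2 using fun n : ℕ => h (1 / ((n : ℝ) + 1)) (by positivity)
  have hS : IsNullSeqX p V v := by
    refine ⟨hv, squeeze_zero (fun n => normX_nonneg H.nonnegV _) (fun n => (hv1 n).le)
      tendsto_one_div_add_atTop_nhds_zero_nat, fun n => (hv1 n).le.trans ?_⟩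
    rw [div_le_one (by positivity)]
    linarith [Nat.cast_nonneg (α := ℝ) n]
  obtain ⟨T, -, hT⟩ := hu.exists_bound
  have hlo := (((H.isLittleO_gradient hu hT hS).const_mul_left (1 / p)).add
    ((H.isLittleO_weight hu hS).const_mul_left (1 / p))).sub
    (H.isLittleO_primitiveT hτ0 hτ hu hT hS)
  obtain ⟨n, hn⟩ := (hlo.def hε).exists
  refine absurd hn (not_le.2 ?_)
  rw [Real.norm_eq_abs, Real.norm_eq_abs, abs_of_nonneg (normX_nonneg H.nonnegV _)]
  refine (hv2 n).trans_eq (congrArg _ ?_)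
  have e1 : ∫ x, A x ((u + v n) x) * ‖weakGrad (u + v n) x‖ ^ p
      = ∫ x, A x (u x + v n x) * ‖weakGrad u x + weakGrad (v n) x‖ ^ p := by
    refine integral_congr_ae ?_
    filter_upwards [hu.1.1.weakGrad_add (hv n).1.1] with x hx
    rw [hx]
    rfl
  rw [dJ_eq, J, J, e1]
  simp only [Pi.add_apply]
  have hp0 := H.pos
  field_simp
  ring

end Admissible

end QuasilinearSchrodinger

namespace QuasilinearSchrodinger

variable {N : ℕ} {p q a₁ a₂ : ℝ} {V : RN N → ℝ} {A g : RN N → ℝ → ℝ}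

/-! ### From the approximating sequence to its limit -/

theorem exists_bound_of_tendsto_eLpNorm {r : ℝ} (hr : 1 ≤ r) {w : ℕ → RN N → ℝ} {u : RN N → ℝ}
    (hw : ∀ j, MemLp (w j) (ENNReal.ofReal r)) (hu : AEStronglyMeasurable u)
    (h : Tendsto (fun j => eLpNorm (fun x => w j x - u x) (ENNReal.ofReal r) volume) atTop (𝓝 0)) :
    ∃ (B : ℝ) (j₀ : ℕ), ∀ j, j₀ ≤ j → ∫ x, |w j x| ^ r ≤ B := by
  have hr0 : 0 < r := by linarith
  obtain ⟨j₀, hj₀⟩ := eventually_atTop.1 (h.eventually_lt_const zero_lt_one)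
  -- The triangle inequality goes through a fixed member `w j₀`, as `u` is not assumed to be in
  -- `L^r`.
  set M := 1 + 1 + eLpNorm (w j₀) (ENNReal.ofReal r) volume with hM
  have hMt : M ≠ ⊤ := by
    rw [hM]
    exact ENNReal.add_ne_top.2 ⟨by norm_num, (hw j₀).2.ne⟩
  refine ⟨M.toReal ^ r, j₀, fun j hj => ?_⟩
  have h1 : eLpNorm (w j) (ENNReal.ofReal r) volume ≤ M := by
    have e : w j = ((fun x => w j x - u x) + fun x => -(w j₀ x - u x)) + w j₀ := by
      funext x; simp
    have hm : ∀ i, AEStronglyMeasurable (fun x => w i x - u x) volume := fun i => (hw i).1.sub hu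
    have hm' : AEStronglyMeasurable (fun x => -(w j₀ x - u x)) volume := (hm j₀).neg
    have hr1 : 1 ≤ ENNReal.ofReal r := by simpa using ENNReal.ofReal_le_ofReal hr
    rw [e]
    refine (eLpNorm_add_le ((hm j).add hm') (hw j₀).1 hr1).trans (add_le_add
      ((eLpNorm_add_le (hm j) hm' hr1).trans (add_le_add (hj₀ j hj).le ?_)) le_rfl)
    have e2 : (fun x => -(w j₀ x - u x)) = -(fun x => w j₀ x - u x) := rfl
    rw [e2, eLpNorm_neg]
    exact (hj₀ j₀ le_rfl).le
  rw [eLpNorm_ofReal_eq hr0 (hw j), ENNReal.ofReal_le_iff_le_toReal hMt] at h1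
  have h0 : 0 ≤ ∫ x, ‖w j x‖ ^ r := integral_norm_rpow_nonneg _
  have h2 := Real.rpow_le_rpow (Real.rpow_nonneg h0 _) h1 hr0.le
  rwa [← Real.rpow_mul h0, one_div_mul_cancel hr0.ne', Real.rpow_one] at h2

/-- Strong convergence in `L^p` and `L^q` bounds the two norms along a tail of the subsequence, and
these are all that the uniform bounds require. The sup bound passes to the limit almost everywhere,
which puts `u_∞` in `X`. -/
theorem Admissible.exists_boundedCriticalSeq (H : Admissible p q a₁ a₂ V A g) (hN : 2 ≤ N)
    {α₀ α₂ : ℝ} (hA2 : ∀ᵐ x, ∀ t : ℝ, α₀ ≤ A x t) (hα₂ : 0 < α₂)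
    (hA4 : ∀ᵐ x, ∀ t : ℝ, α₂ * A x t ≤ p * A x t + partialT A x t * t) (hα₀ : 0 < α₀)
    (hq : (q : EReal) < criticalExponent N p) {u : ℕ → RN N → ℝ}
    (hu_mem : ∀ k : ℕ, 1 ≤ k → MemXOn p V (Metric.ball 0 k) (u k))
    (hu_crit : ∀ k : ℕ, 1 ≤ k → ∀ v, MemXOn p V (Metric.ball 0 k) v → dJ p A V g (u k) v = 0)
    {σ : ℕ → ℕ} (hσ : StrictMono σ) {uinf : RN N → ℝ} (huinf : MemWV p V uinf)
    (h_weak : WeakTendstoWV p V (fun j => u (σ j)) uinf)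
    (h_strong : ∀ r : ℝ, p ≤ r → (r : EReal) < criticalExponent N p →
      Tendsto (fun j => eLpNorm (fun x => u (σ j) x - uinf x) (ENNReal.ofReal r) volume)
        atTop (𝓝 0))
    (h_ae : ∀ᵐ x, Tendsto (fun j => u (σ j) x) atTop (𝓝 (uinf x))) :
    ∃ (w : ℕ → RN N → ℝ) (T B : ℝ), BoundedCriticalSeq p V A g w uinf T B := by
  have hp := H.one_lt
  have hpq := H.le_q
  have hshift : ∀ m : ℕ, Tendsto (fun j => j + m) atTop atTop := tendsto_add_atTop_nat
  have hpos : ∀ j m : ℕ, 1 ≤ m → 1 ≤ σ (j + m) := fun j m hm =>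
    hm.trans ((Nat.le_add_left m j).trans (hσ.id_le (j + m)))
  have hLr : ∀ r : ℝ, p ≤ r → ∀ j, MemLp (u (σ (j + 1))) (ENNReal.ofReal r) := fun r hr j => by
    have h1 := hu_mem _ (hpos j 1 le_rfl)
    obtain ⟨T, -, hT⟩ := h1.2.exists_bound
    exact memLp_of_integrable_norm_rpow (by linarith) h1.2.1.1.1.1
      (integrable_abs_rpow_of_bounded H.pos hr h1.2.1.1.1 hT)
  have hbd : ∀ r : ℝ, p ≤ r → (r : EReal) < criticalExponent N p →
      ∃ (B : ℝ) (j₀ : ℕ), ∀ j, j₀ ≤ j → ∫ x, |u (σ (j + 1)) x| ^ r ≤ B := fun r hr hr' =>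
    exists_bound_of_tendsto_eLpNorm (by linarith) (hLr r hr) huinf.1.1.1
      ((h_strong r hr hr').comp (hshift 1))
  obtain ⟨B₁, j₁, hB₁⟩ := hbd p le_rfl (lt_of_le_of_lt (EReal.coe_le_coe_iff.2 hpq) hq)
  obtain ⟨B₂, j₂, hB₂⟩ := hbd q hpq hq
  -- The shift skips the terms without norm bounds; the extra 1 ensures `1 ≤ σ (j + m)`, since
  -- nothing is known about `u 0`.
  set m := max j₁ j₂ + 1 with hm
  set B := max (max B₁ B₂) 0 with hB
  have b1 : ∀ j, ∫ x, |u (σ (j + m)) x| ^ p ≤ B := fun j => by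
    have := hB₁ (j + max j₁ j₂) ((le_max_left _ _).trans (Nat.le_add_left _ _))
    rw [add_assoc] at this
    exact this.trans ((le_max_left _ _).trans (le_max_left _ _))
  have b2 : ∀ j, ∫ x, |u (σ (j + m)) x| ^ q ≤ B := fun j => by
    have := hB₂ (j + max j₁ j₂) ((le_max_right _ _).trans (Nat.le_add_left _ _))
    rw [add_assoc] at this
    exact this.trans ((le_max_right _ _).trans (le_max_left _ _))
  have hm1 : 1 ≤ m := by omega
  obtain ⟨T, hT0, hT⟩ := H.exists_uniform_bound hN hA2 hα₂ hA4 hα₀ hq (le_max_right (max B₁ B₂) 0)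
  have hTj : ∀ j, ∀ᵐ x, |u (σ (j + m)) x| ≤ T := fun j =>
    hT _ _ (hu_mem _ (hpos j m hm1)) (hu_crit _ (hpos j m hm1)) (b1 j) (b2 j)
  have hae : ∀ᵐ x, Tendsto (fun j => u (σ (j + m)) x) atTop (𝓝 (uinf x)) := by
    filter_upwards [h_ae] with x hx using hx.comp (hshift m)
  have hTinf : ∀ᵐ x, |uinf x| ≤ T := by
    filter_upwards [hae, ae_all_iff.2 hTj] with x h1 h2
    exact le_of_tendsto h1.abs (Eventually.of_forall h2)
  refine ⟨fun j => u (σ (j + m)), T, (a₁ + a₂) * B / (α₂ / p * α₀), hT0,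
    fun j => (hu_mem _ (hpos j m hm1)).2, hTj, fun j => H.gradient_bound hA2 hα₂ hA4 hα₀
      (hu_mem _ (hpos j m hm1)) (hu_crit _ (hpos j m hm1)) (b1 j) (b2 j),
    ⟨huinf, memLp_top_of_bound huinf.1.1.1 T hTinf⟩, hTinf, hae,
    fun ℓ hℓ => (h_weak ℓ hℓ).comp (hshift m), fun R => ?_⟩
  have hk : Tendsto (fun j => ((σ (j + m) : ℕ) : ℝ)) atTop atTop :=
    tendsto_natCast_atTop_atTop.comp (hσ.tendsto_atTop.comp (hshift m))
  -- As soon as the radius `σ (j + m)` exceeds `R`, `v` belongs to the space on that ball.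
  filter_upwards [hk.eventually_gt_atTop R] with j hj v hv hvR
  exact hu_crit _ (hpos j m hm1) v (hv.memXOn_ball hp.le hj hvR)

theorem IsTestFunction.memX (H : Admissible p q a₁ a₂ V A g) {φ : RN N → ℝ}
    (hφ : IsTestFunction φ) : MemX p V φ := by
  obtain ⟨K, hK0, hK⟩ := hφ.exists_bound_weight H
  have hi : Integrable fun x => |φ x| ^ p :=
    integrable_norm_rpow H.pos (hφ.memLp (ENNReal.ofReal p))
  refine ⟨⟨hφ.memW p, (hi.const_mul K).mono'
    (H.measV.mul (hφ.continuous.aemeasurable.abs.pow_const p)).aestronglyMeasurable ?_⟩,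
    hφ.memLp ⊤⟩
  filter_upwards [hK] with x hx
  by_cases h0 : φ x = 0
  · simp [h0, Real.zero_rpow H.pos.ne']
  · rw [norm_mul, Real.norm_of_nonneg (Real.rpow_nonneg (abs_nonneg _) _)]
    exact mul_le_mul_of_nonneg_right (hx h0) (Real.rpow_nonneg (abs_nonneg _) _)

end QuasilinearSchrodinger

/-! ### The limit is a critical point of `J` in `X`. -/

theorem proposition6p8 (N : ℕ) (hN : 2 ≤ N) (p : ℝ) (hp : 1 < p)
    (V : RN N → ℝ) (A g : RN N → ℝ → ℝ)
    -- assumptions on the potential `V`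
    (hV_meas : AEMeasurable V volume)
    (hV1 : ∃ c : ℝ, 0 < c ∧ ∀ᵐ x, c ≤ V x)
    (hV2 : Tendsto (fun x => ∫ y in Metric.ball x 1, 1 / V y) (cocompact (RN N)) (𝓝 0))
    (hV3 : ∀ ρ : ℝ, 0 < ρ → ∃ C : ℝ, 0 < C ∧ ∀ᵐ x, ‖x‖ ≤ ρ → V x ≤ C)
    -- assumptions on the coefficient `A`
    (hA0 : IsCaratheodory 1 A)
    (hA1 : ∀ ρ : ℝ, 0 < ρ →
      (∃ C : ℝ, ∀ᵐ x, ∀ t : ℝ, |t| ≤ ρ → |A x t| ≤ C) ∧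
      (∃ C : ℝ, ∀ᵐ x, ∀ t : ℝ, |t| ≤ ρ → |partialT A x t| ≤ C))
    (α₀ : ℝ) (hα₀ : 0 < α₀) (hA2 : ∀ᵐ x, ∀ t : ℝ, α₀ ≤ A x t)
    (μ : ℝ) (hμ : p < μ) (α₁ : ℝ) (hα₁ : 0 < α₁)
    (hA3 : ∀ᵐ x, ∀ t : ℝ, α₁ * A x t ≤ (μ - p) * A x t - partialT A x t * t)
    (α₂ : ℝ) (hα₂ : 0 < α₂)
    (hA4 : ∀ᵐ x, ∀ t : ℝ, α₂ * A x t ≤ p * A x t + partialT A x t * t)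
    -- assumptions on the nonlinearity `g`
    (hg0 : IsCaratheodory 0 g)
    (a₁ a₂ q : ℝ) (ha₁ : 0 < a₁) (ha₂ : 0 < a₂) (hpq : p ≤ q)
    (hg1 : ∀ᵐ x, ∀ t : ℝ, |g x t| ≤ a₁ * |t| ^ (p - 1) + a₂ * |t| ^ (q - 1))
    (hq : (q : EReal) < criticalExponent N p)
    (τ : ℝ) (hτ : 0 < τ)
    (hτ_emb : ∀ u, MemWV p V u → (∫ x, |u x| ^ p) ^ (1 / p) ≤ τ * normV p V u)
    (αbar : ℝ) (hαbar : αbar < α₀ / τ ^ p)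
    (hg2 : ∀ ε : ℝ, 0 < ε → ∃ δ : ℝ, 0 < δ ∧ ∀ᵐ x, ∀ t : ℝ, 0 < |t| → |t| < δ →
      |g x t / (|t| ^ (p - 2) * t) - αbar| < ε)
    (hg3 : ∀ᵐ x, ∀ t : ℝ, t ≠ 0 → 0 < μ * primitiveT g x t ∧ μ * primitiveT g x t ≤ g x t * t)
    -- the sequence of critical points on the balls `B_k`, `k ≥ 1`, at levels in `[β₁, β₂]`
    (u : ℕ → RN N → ℝ) (β₁ β₂ : ℝ)
    (hu_mem : ∀ k : ℕ, 1 ≤ k → MemXOn p V (Metric.ball 0 k) (u k))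
    (hu_level : ∀ k : ℕ, 1 ≤ k → β₁ ≤ J p A V g (u k) ∧ J p A V g (u k) ≤ β₂)
    (hu_crit : ∀ k : ℕ, 1 ≤ k → ∀ v, MemXOn p V (Metric.ball 0 k) v → dJ p A V g (u k) v = 0)
    -- its limit along a subsequence
    (σ : ℕ → ℕ) (hσ : StrictMono σ) (uinf : RN N → ℝ)
    (huinf : MemWV p V uinf)
    (h_weak : WeakTendstoWV p V (fun j => u (σ j)) uinf)
    (h_strong : ∀ r : ℝ, p ≤ r → (r : EReal) < criticalExponent N p →
      Tendsto (fun j => eLpNorm (fun x => u (σ j) x - uinf x) (ENNReal.ofReal r) volume)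
        atTop (𝓝 0))
    (h_ae : ∀ᵐ x, Tendsto (fun j => u (σ j) x) atTop (𝓝 (uinf x))) :
    MemX p V uinf ∧
    HasFrechetDifferentialX p V (J p A V g) uinf (dJ p A V g uinf) ∧
    (∀ φ : RN N → ℝ, IsTestFunction φ → dJ p A V g uinf φ = 0) ∧
    (∀ v : RN N → ℝ, MemX p V v → dJ p A V g uinf v = 0) := by
  have hV0 : ∀ᵐ x, 0 ≤ V x := by
    obtain ⟨c, hc, h⟩ := hV1
    filter_upwards [h] with x hx using hc.le.trans hx
  have H : Admissible p q a₁ a₂ V A g :=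
    ⟨hp, hV_meas, hV0, hV3, hA0, hA1, hg0, ha₁.le, ha₂.le, hpq, hg1⟩
  obtain ⟨w, T, B, S⟩ := H.exists_boundedCriticalSeq hN hA2 hα₂ hA4 hα₀ hq hu_mem hu_crit hσ huinf
    h_weak h_strong h_ae
  -- Vanishing on all of `X` is obtained first; test functions are then a special case, since `V` is
  -- bounded on their supports.
  have hzero : ∀ v, MemX p V v → dJ p A V g uinf v = 0 := fun v hv =>
    H.dJ_eq_zero_of_forall_compactSupport S.memX_lim
      (fun R v hv hR => S.dJ_eq_zero_of_compactSupport H hα₀ hA2 hv hR) hv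
  exact ⟨S.memX_lim, H.hasFrechetDifferentialX hτ.le hτ_emb S.memX_lim,
    fun φ hφ => hzero φ (hφ.memX H), hzero⟩
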